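/- Let $n\ge 2$ and let $\mathbb H^n=\mathbb C^n\times\mathbb R$ be the Heisenberg group, with points $(z,t)$ and left-invariant vector fields $$Z_\alpha=\partial_{z_\alpha}+\sqrt{-1}\,\overline{z_\alpha}\,\partial_t,\qquad Z_{\overline\alpha}=\partial_{\overline{z_\alpha}}-\sqrt{-1}\,z_\alpha\,\partial_t\qquad(1\le\alpha\le n),$$ and let $\Delta_b u=-\operatorname{Re}\sum_{\alpha=1}^n Z_{\overline\alpha}(Z_\alpha u)$ be the Heisenberg sub-Laplacian. Let $u:\mathbb H^n\to(0,\infty)$ be a smooth solution of $$4\Delta_b u=n^2u^{\frac{n+2}{n}}\quad\text{in }\mathbb H^n .$$ Suppose that, for some constant $C>0$, $$u(z,t)\le C\left(|z|^2+|t|\right)^{-\frac{n-2}{2}}\quad\forall (z,t)\in\mathbb H^n\setminus\{(0,0)\}.$$ Then there exist $\mu\in\mathbb C^n$ and $\lambda\in\mathbb C$ with $|\mu|^2<4\operatorname{Im}\lambda$ such that $$u(z,t)=\frac{\left(4\operatorname{Im}\lambda-|\mu|^2\right)^{n/2}}{\left|t+\sqrt{-1}\,|z|^2+\langle\mu,z\rangle+\lambda\right|^n}\quad\forall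 (z,t)\in\mathbb H^n,$$ where $\langle\mu,z\rangle=\sum_{\alpha=1}^n\overline{\mu_\alpha}z_\alpha$. In particular, for $n=2$, every bounded smooth positive solution of the equation is of this form. -/

import Mathlib

open scoped ContDiff ComplexConjugate

noncomputable section

/-- The underlying space `ℂⁿ × ℝ` of the Heisenberg group, with points `(z, t)`; the first factor
carries the Hermitian norm `|z|`. -/
abbrev HeisenbergSpace (n : ℕ) : Type := EuclideanSpace ℂ (Fin n) × ℝ

namespace HeisenbergSpace

variable {n : ℕ}

/-- The partial derivative in the direction `x_α`, where `z_α = x_α + i y_α`. -/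
def dx (α : Fin n) (F : HeisenbergSpace n → ℂ) (p : HeisenbergSpace n) : ℂ :=
  fderiv ℝ F p (EuclideanSpace.single α (1 : ℂ), 0)

/-- The partial derivative in the direction `y_α`, where `z_α = x_α + i y_α`. -/
def dy (α : Fin n) (F : HeisenbergSpace n → ℂ) (p : HeisenbergSpace n) : ℂ :=
  fderiv ℝ F p (EuclideanSpace.single α Complex.I, 0)

/-- The partial derivative in the direction `t`. -/
def dt (F : HeisenbergSpace n → ℂ) (p : HeisenbergSpace n) : ℂ :=
  fderiv ℝ F p (0, 1)

/-- The left-invariant vector field `Z_α = ∂/∂z_α + i conj(z_α) ∂/∂t`, where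
`∂/∂z_α = (∂/∂x_α - i ∂/∂y_α) / 2`. -/
def Z (α : Fin n) (F : HeisenbergSpace n → ℂ) (p : HeisenbergSpace n) : ℂ :=
  (dx α F p - Complex.I * dy α F p) / 2 + Complex.I * conj (p.1 α) * dt F p

/-- The left-invariant vector field `Z_ᾱ = ∂/∂(conj z_α) - i z_α ∂/∂t`, where
`∂/∂(conj z_α) = (∂/∂x_α + i ∂/∂y_α) / 2`. -/
def Zbar (α : Fin n) (F : HeisenbergSpace n → ℂ) (p : HeisenbergSpace n) : ℂ :=
  (dx α F p + Complex.I * dy α F p) / 2 - Complex.I * p.1 α * dt F p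

/-- The Heisenberg sub-Laplacian `Δ_b u = - Re ∑_α Z_ᾱ (Z_α u)`. -/
def subLaplacian (u : HeisenbergSpace n → ℝ) (p : HeisenbergSpace n) : ℝ :=
  -(∑ α : Fin n, Zbar α (Z α (fun q => (u q : ℂ))) p).re

/-- `u` is a smooth positive solution of `4 Δ_b u = n² u^((n+2)/n)` on the Heisenberg group. -/
structure IsPositiveSolution (u : HeisenbergSpace n → ℝ) : Prop where
  smooth : ContDiff ℝ ∞ u
  pos : ∀ p, 0 < u p
  eqn : ∀ p, 4 * subLaplacian u p = (n : ℝ) ^ 2 * u p ^ (((n : ℝ) + 2) / n)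

/-- `u` is one of the Jerison-Lee functions
`(4 Im λ - |μ|²)^(n/2) / |t + i|z|² + ⟨μ, z⟩ + λ|^n` with `|μ|² < 4 Im λ`. -/
def IsJerisonLee (u : HeisenbergSpace n → ℝ) : Prop :=
  ∃ (μ : EuclideanSpace ℂ (Fin n)) (lam : ℂ), ‖μ‖ ^ 2 < 4 * lam.im ∧
    ∀ (z : EuclideanSpace ℂ (Fin n)) (t : ℝ),
      u (z, t) = (4 * lam.im - ‖μ‖ ^ 2) ^ ((n : ℝ) / 2) /
        ‖(t : ℂ) + Complex.I * ((‖z‖ ^ 2 : ℝ) : ℂ) + inner ℂ μ z + lam‖ ^ n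

end HeisenbergSpace

end

/-! Write u = e^{nf} and q = e^{2f}/4. The equation becomes ∑ f_{αᾱ} = -n g with g = |∂f|² + q - i
f₀, where f₀ = ∂f/∂t. Three objects measure the distance to the model solutions: D_{αβ} = f_{αβ} - 2
f_α f_β, the trace-free Hermitian tensor E_{αβ̄} = f_{αβ̄} + g δ_{αβ}, and the vector G_α = i f_{0α}
+ g f_α. The proof shows that all three vanish, and that their vanishing determines u.

Vanishing rests on the Jerison–Lee identity (`IsYamabe.jl_identity`, `IsYamabe.reDiv_jlField`): the
real divergence of e^{2(n-1)f} times an explicit field, linear in the contractions of D and E with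
∂f and in G, equals e^{2(n-1)f} M. Here M is a sum of squares containing q(|D|² + |E|²) + |G|². The
squared length of the field is at most 75 |g|² M. Testing the identity against η⁴, with η a cutoff
at scale R, bounds the mass of M inside by δ times its mass in an annulus plus (δR²)⁻¹ times the
annular integral of e^{2(n-1)f}|g|².

The latter integral is controlled by a second divergence, that of e^{2(n-1)f}(2g + ḡ)∂f, whose real
part is coercive in |∂f|² and f₀ up to a q² term when n ≥ 2. This leaves annular integrals of
e^{(2n-2)f}|∂f|² and e^{(2n+2)f}. Without the factor u = e^{nf} they are O(R^{n+2}) and O(R^n) for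
every positive solution; the assumed decay u = O(R^{2-n}) turns these into O(R⁴) and O(R²), exactly
the borderline needed. So the mass of M is finite (`IsYamabe.exists_integral_density_le`). Its
annular part then tends to zero, and a large δ forces the total mass to vanish
(`IsYamabe.jlDensity_eq_zero`).

Once D = E = G = 0, the quantity |g|²e^{-2f} is a positive constant and w = i/g is annihilated by
every Z_ᾱ. The difference w - (t + i|z|²) has constant Z_α-derivatives, so it is affine holomorphic
in z, and e^{2f}|w|² is constant. This is the stated formula (`IsYamabe.exists_defining_function`).
For n = 2 the decay exponent is 0, so boundedness suffices. -/

noncomputable section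

namespace HeisenbergSpace

variable {n : ℕ}

/-! ### Smooth functions as a differential algebra. -/

/-- The algebra of smooth complex-valued functions on the Heisenberg group. -/
def smoothFunctions (n : ℕ) : Subalgebra ℂ (HeisenbergSpace n → ℂ) where
  carrier := {F | ContDiff ℝ ∞ F}
  mul_mem' {a b} ha hb := by
    have ha : ContDiff ℝ ∞ a := ha
    have hb : ContDiff ℝ ∞ b := hb
    exact ha.mul hb
  add_mem' {a b} ha hb := by
    have ha : ContDiff ℝ ∞ a := ha
    have hb : ContDiff ℝ ∞ b := hb
    exact ha.add hb
  algebraMap_mem' r := by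
    change ContDiff ℝ ∞ (fun _ => r)
    exact contDiff_const

/-- The type of smooth complex-valued functions on the Heisenberg group. -/
abbrev SmoothFn (n : ℕ) : Type := smoothFunctions n

namespace SmoothFn

theorem contDiff (F : SmoothFn n) : ContDiff ℝ ∞ (F : HeisenbergSpace n → ℂ) := F.2

theorem differentiable (F : SmoothFn n) : Differentiable ℝ (F : HeisenbergSpace n → ℂ) :=
  F.contDiff.differentiable (by simp)

theorem continuous (F : SmoothFn n) : Continuous (F : HeisenbergSpace n → ℂ) :=
  F.contDiff.continuous

@[ext] theorem ext {F G : SmoothFn n} (h : ∀ p, F.1 p = G.1 p) : F = G :=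
  Subtype.ext (funext h)

@[simp] theorem add_val (F G : SmoothFn n) (p) : (F + G).1 p = F.1 p + G.1 p := rfl
@[simp] theorem mul_val (F G : SmoothFn n) (p) : (F * G).1 p = F.1 p * G.1 p := rfl
@[simp] theorem sub_val (F G : SmoothFn n) (p) : (F - G).1 p = F.1 p - G.1 p := rfl
@[simp] theorem neg_val (F : SmoothFn n) (p) : (-F).1 p = -F.1 p := rfl
@[simp] theorem zero_val (p) : (0 : SmoothFn n).1 p = 0 := rfl
@[simp] theorem one_val (p) : (1 : SmoothFn n).1 p = 1 := rfl
@[simp] theorem smul_val (c : ℂ) (F : SmoothFn n) (p) : (c • F).1 p = c * F.1 p := rfl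
@[simp] theorem pow_val (F : SmoothFn n) (k : ℕ) (p) : (F ^ k).1 p = F.1 p ^ k := rfl
@[simp] theorem algebraMap_val (c : ℂ) (p) : (algebraMap ℂ (SmoothFn n) c).1 p = c := rfl
@[simp] theorem ofNat_val (k : ℕ) [k.AtLeastTwo] (p) :
    (ofNat(k) : SmoothFn n).1 p = (ofNat(k) : ℂ) := rfl
@[simp] theorem natCast_val (k : ℕ) (p) : (k : SmoothFn n).1 p = k := rfl

@[simp] theorem sum_val {ι : Type*} (s : Finset ι) (F : ι → SmoothFn n) (p) :
    (∑ i ∈ s, F i).1 p = ∑ i ∈ s, (F i).1 p := by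
  have h : (∑ i ∈ s, F i).1 = ∑ i ∈ s, (F i).1 := by
    exact map_sum (smoothFunctions n).val F s
  rw [h, Finset.sum_apply]

/-- Complex conjugation of smooth functions. -/
def cj : SmoothFn n →+* SmoothFn n where
  toFun F := ⟨fun p => conj (F.1 p), by
    have h : ContDiff ℝ ∞ F.1 := F.2
    exact Complex.conjCLE.contDiff.comp h⟩
  map_one' := by ext p; simp
  map_mul' F G := by ext p; simp
  map_zero' := by ext p; simp
  map_add' F G := by ext p; simp

@[simp] theorem cj_val (F : SmoothFn n) (p) : (cj F).1 p = conj (F.1 p) := rfl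

@[simp] theorem cj_cj (F : SmoothFn n) : cj (cj F) = F := by ext p; simp

@[simp] theorem cj_smul (c : ℂ) (F : SmoothFn n) : cj (c • F) = conj c • cj F := by ext p; simp

/-- The directional derivative along a constant vector, as a derivation. -/
def along (v : HeisenbergSpace n) : Derivation ℂ (SmoothFn n) (SmoothFn n) :=
  Derivation.mk'
    { toFun := fun F => ⟨fun p => fderiv ℝ F.1 p v,
        (F.contDiff.fderiv_right (m := ∞) (by simp)).clm_apply contDiff_const⟩
      map_add' := fun F G => by
        ext p
        change fderiv ℝ (F.1 + G.1) p v = fderiv ℝ F.1 p v + fderiv ℝ G.1 p v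
        rw [fderiv_add (F.differentiable p) (G.differentiable p)]
        rfl
      map_smul' := fun c F => by
        ext p
        change fderiv ℝ (c • F.1) p v = c * fderiv ℝ F.1 p v
        rw [fderiv_const_smul (F.differentiable p)]
        rfl }
    (fun F G => by
      ext p
      change fderiv ℝ (F.1 * G.1) p v = F.1 p * fderiv ℝ G.1 p v + G.1 p * fderiv ℝ F.1 p v
      rw [fderiv_mul (F.differentiable p) (G.differentiable p)]
      rfl)

theorem along_val (v : HeisenbergSpace n) (F : SmoothFn n) (p) :
    (along v F).1 p = fderiv ℝ F.1 p v := rfl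

theorem along_comm (v w : HeisenbergSpace n) (F : SmoothFn n) :
    along v (along w F) = along w (along v F) := by
  ext p
  have key : ∀ v w : HeisenbergSpace n,
      (along v (along w F)).1 p = fderiv ℝ (fderiv ℝ F.1) p v w := by
    intro v w
    have hd : DifferentiableAt ℝ (fderiv ℝ F.1) p :=
      ((F.contDiff.fderiv_right (m := ∞) (by simp)).differentiable (by simp)) p
    rw [along_val]
    change fderiv ℝ (fun q => fderiv ℝ F.1 q w) p v = _
    rw [fderiv_clm_apply hd (differentiableAt_const w)]
    simp
  rw [key, key]
  exact (F.contDiff.contDiffAt.isSymmSndFDerivAt (by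
    rw [minSmoothness_of_isRCLikeNormedField]
    exact WithTop.coe_le_coe.2 (le_top (a := (2 : ℕ∞))))).eq v w

theorem along_cj (v : HeisenbergSpace n) (F : SmoothFn n) : along v (cj F) = cj (along v F) := by
  ext p
  have h := (Complex.conjCLE : ℂ ≃L[ℝ] ℂ).toContinuousLinearMap.hasFDerivAt.comp p
    (F.differentiable p).hasFDerivAt
  rw [along_val, cj_val, along_val]
  have h2 : fderiv ℝ (cj F).1 p = _ := h.fderiv
  rw [h2]
  rfl

/-- The coordinate function `z_α`. -/
def zc (α : Fin n) : SmoothFn n :=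
  ⟨fun p => p.1 α, by
    have : (fun p : HeisenbergSpace n => p.1 α) =
      ((EuclideanSpace.proj (𝕜 := ℂ) α).restrictScalars ℝ).comp
        (ContinuousLinearMap.fst ℝ (EuclideanSpace ℂ (Fin n)) ℝ) := rfl
    change ContDiff ℝ ∞ (fun p : HeisenbergSpace n => p.1 α)
    rw [this]
    exact ContinuousLinearMap.contDiff _⟩

/-- The coordinate function `t`. -/
def tc : SmoothFn n :=
  ⟨fun p => (p.2 : ℂ), by
    change ContDiff ℝ ∞ (fun p : HeisenbergSpace n => (p.2 : ℂ))
    exact Complex.ofRealCLM.contDiff.comp contDiff_snd⟩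

@[simp] theorem zc_val (α : Fin n) (p : HeisenbergSpace n) : (zc α).1 p = p.1 α := rfl
@[simp] theorem tc_val (p : HeisenbergSpace n) : (tc : SmoothFn n).1 p = (p.2 : ℂ) := rfl

theorem along_zc_val (v : HeisenbergSpace n) (α : Fin n) (p) : (along v (zc α)).1 p = v.1 α := by
  have : (fun p : HeisenbergSpace n => p.1 α) =
      ((EuclideanSpace.proj (𝕜 := ℂ) α).restrictScalars ℝ).comp
        (ContinuousLinearMap.fst ℝ (EuclideanSpace ℂ (Fin n)) ℝ) := rfl
  rw [along_val]
  change fderiv ℝ (fun p : HeisenbergSpace n => p.1 α) p v = _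
  rw [this, ContinuousLinearMap.fderiv]
  rfl

theorem along_tc_val (v : HeisenbergSpace n) (p) : (along v tc).1 p = (v.2 : ℂ) := by
  have : (fun p : HeisenbergSpace n => (p.2 : ℂ)) =
      Complex.ofRealCLM.comp
        (ContinuousLinearMap.snd ℝ (EuclideanSpace ℂ (Fin n)) ℝ) := rfl
  rw [along_val]
  change fderiv ℝ (fun p : HeisenbergSpace n => (p.2 : ℂ)) p v = _
  rw [this, ContinuousLinearMap.fderiv]
  rfl

/-! ### The left-invariant frame and its commutation relations. -/

/-- The derivation `∂/∂t`. -/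
def T : Derivation ℂ (SmoothFn n) (SmoothFn n) := along (0, 1)

/-- The derivation `∂/∂x_α`. -/
def dX (α : Fin n) : Derivation ℂ (SmoothFn n) (SmoothFn n) :=
  along (EuclideanSpace.single α (1 : ℂ), 0)

/-- The derivation `∂/∂y_α`. -/
def dY (α : Fin n) : Derivation ℂ (SmoothFn n) (SmoothFn n) :=
  along (EuclideanSpace.single α Complex.I, 0)

/-- The vector field `Z_α` as a derivation. -/
def Zd (α : Fin n) : Derivation ℂ (SmoothFn n) (SmoothFn n) :=
  (1 / 2 : ℂ) • (dX α - Complex.I • dY α) + (Complex.I • cj (zc α)) • T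

/-- The vector field `Z_ᾱ` as a derivation. -/
def Zb (α : Fin n) : Derivation ℂ (SmoothFn n) (SmoothFn n) :=
  (1 / 2 : ℂ) • (dX α + Complex.I • dY α) - (Complex.I • zc α) • T

theorem Zd_apply (α : Fin n) (F : SmoothFn n) :
    Zd α F = (1 / 2 : ℂ) • (dX α F - Complex.I • dY α F) + (Complex.I • cj (zc α)) * T F := rfl

theorem Zb_apply (α : Fin n) (F : SmoothFn n) :
    Zb α F = (1 / 2 : ℂ) • (dX α F + Complex.I • dY α F) - (Complex.I • zc α) * T F := rfl

theorem Z_coe (α : Fin n) (F : SmoothFn n) : Z α F.1 = (Zd α F).1 := by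
  funext p
  rw [Zd_apply]
  simp only [add_val, smul_val, sub_val, mul_val, cj_val, zc_val]
  change (dx α F.1 p - Complex.I * dy α F.1 p) / 2 + Complex.I * conj (p.1 α) * dt F.1 p =
    1 / 2 * (dx α F.1 p - Complex.I * dy α F.1 p) + Complex.I * conj (p.1 α) * dt F.1 p
  ring

theorem Zbar_coe (α : Fin n) (F : SmoothFn n) : Zbar α F.1 = (Zb α F).1 := by
  funext p
  rw [Zb_apply]
  simp only [add_val, smul_val, sub_val, mul_val, zc_val]
  change (dx α F.1 p + Complex.I * dy α F.1 p) / 2 - Complex.I * p.1 α * dt F.1 p =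
    1 / 2 * (dx α F.1 p + Complex.I * dy α F.1 p) - Complex.I * p.1 α * dt F.1 p
  ring

theorem T_cj (F : SmoothFn n) : T (cj F) = cj (T F) := along_cj _ _

theorem Zd_cj (α : Fin n) (F : SmoothFn n) : Zd α (cj F) = cj (Zb α F) := by
  simp only [Zd_apply, Zb_apply, T, dX, dY, along_cj, map_add, map_sub, map_mul, cj_smul]
  ext p
  have h2 : conj (2 : ℂ) = 2 := Complex.conj_ofNat 2
  simp [h2]
  ring

theorem Zb_cj (α : Fin n) (F : SmoothFn n) : Zb α (cj F) = cj (Zd α F) := by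
  rw [← cj_cj (Zb α (cj F)), ← Zd_cj, cj_cj]

theorem dX_zc (α β : Fin n) : dX α (zc β) = if α = β then 1 else 0 := by
  ext p
  rw [dX, along_zc_val]
  by_cases h : α = β
  · subst h; simp
  · simp [h, Ne.symm h]

theorem dY_zc (α β : Fin n) :
    dY α (zc β) = if α = β then algebraMap ℂ (SmoothFn n) Complex.I else 0 := by
  ext p
  rw [dY, along_zc_val]
  by_cases h : α = β
  · subst h; simp
  · simp [h, Ne.symm h]

theorem T_zc (β : Fin n) : T (zc β) = 0 := by
  ext p
  rw [T, along_zc_val]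
  simp

theorem dX_tc (α : Fin n) : dX α (tc : SmoothFn n) = 0 := by
  ext p; rw [dX, along_tc_val]; simp

theorem dY_tc (α : Fin n) : dY α (tc : SmoothFn n) = 0 := by
  ext p; rw [dY, along_tc_val]; simp

theorem T_tc : T (tc : SmoothFn n) = 1 := by
  ext p; rw [T, along_tc_val]; simp

theorem Zd_zc (α β : Fin n) : Zd α (zc β) = if α = β then 1 else 0 := by
  rw [Zd_apply, dX_zc, dY_zc, T_zc]
  ext p
  split_ifs <;> simp
  norm_num

theorem Zb_zc (α β : Fin n) : Zb α (zc β) = 0 := by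
  rw [Zb_apply, dX_zc, dY_zc, T_zc]
  ext p
  split_ifs <;> simp

theorem Zd_cj_zc (α β : Fin n) : Zd α (cj (zc β)) = 0 := by
  rw [Zd_cj, Zb_zc, map_zero]

theorem Zb_cj_zc (α β : Fin n) : Zb α (cj (zc β)) = if α = β then 1 else 0 := by
  rw [Zb_cj, Zd_zc]; split_ifs <;> simp

theorem Zd_tc (α : Fin n) : Zd α tc = Complex.I • cj (zc α) := by
  rw [Zd_apply, dX_tc, dY_tc, T_tc]; simp

theorem Zb_tc (α : Fin n) : Zb α tc = -(Complex.I • zc α) := by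
  rw [Zb_apply, dX_tc, dY_tc, T_tc]; simp

theorem T_Zd (α : Fin n) (F : SmoothFn n) : T (Zd α F) = Zd α (T F) := by
  have h := T_zc α
  simp only [Zd_apply, map_add, map_sub, Derivation.map_smul, Derivation.leibniz, T_cj, h, map_zero,
    smul_zero, mul_zero, add_zero, smul_eq_mul]
  simp only [T, dX, dY, along_comm (0, 1)]

theorem T_Zb (α : Fin n) (F : SmoothFn n) : T (Zb α F) = Zb α (T F) := by
  rw [← cj_cj F, Zb_cj, T_cj, T_Zd, T_cj (cj F), Zb_cj]

theorem Zd_comm (α β : Fin n) (F : SmoothFn n) : Zd α (Zd β F) = Zd β (Zd α F) := by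
  have key : ∀ α β : Fin n, Zd α (Zd β F) = (1 / 2 : ℂ) • (Zd α (dX β F) - Complex.I • Zd α (dY β F))
      + (Complex.I • cj (zc β)) * Zd α (T F) := by
    intro α β
    rw [Zd_apply β F]
    simp only [map_add, map_sub, Derivation.map_smul, Derivation.leibniz, Zd_cj_zc, smul_zero, mul_zero,
      add_zero, smul_eq_mul]
  rw [key, key]
  simp only [Zd_apply, T, dX, dY, along_comm _ (0, 1),
    along_comm (EuclideanSpace.single β (1 : ℂ), 0) (EuclideanSpace.single α (1 : ℂ), 0),
    along_comm (EuclideanSpace.single β (1 : ℂ), 0) (EuclideanSpace.single α Complex.I, 0),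
    along_comm (EuclideanSpace.single β Complex.I, 0) (EuclideanSpace.single α (1 : ℂ), 0),
    along_comm (EuclideanSpace.single β Complex.I, 0) (EuclideanSpace.single α Complex.I, 0)]
  ext p
  simp
  ring

theorem Zb_comm (α β : Fin n) (F : SmoothFn n) : Zb α (Zb β F) = Zb β (Zb α F) := by
  rw [← cj_cj F, Zb_cj, Zb_cj, Zd_comm, ← Zb_cj, ← Zb_cj]

/-- The second-order parts cancel by symmetry. What remains comes from differentiating the
coefficients i z̄_α and -i z_β, each of which contributes one copy of i T when β = α. -/
theorem Zb_Zd (β α : Fin n) (F : SmoothFn n) :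
    Zb β (Zd α F) = Zd α (Zb β F) + if β = α then (2 * Complex.I) • T F else 0 := by
  have h1 : Zb β (Zd α F) = (1 / 2 : ℂ) • (Zb β (dX α F) - Complex.I • Zb β (dY α F))
      + (Complex.I • cj (zc α)) * Zb β (T F) + (if β = α then Complex.I • T F else 0) := by
    rw [Zd_apply α F]
    simp only [map_add, map_sub, Derivation.map_smul, Derivation.leibniz, Zb_cj_zc, smul_eq_mul]
    rw [add_assoc]
    congr 2
    split_ifs <;> simp
  have h2 : Zd α (Zb β F) = (1 / 2 : ℂ) • (Zd α (dX β F) + Complex.I • Zd α (dY β F))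
      - (Complex.I • zc β) * Zd α (T F) - (if β = α then Complex.I • T F else 0) := by
    rw [Zb_apply β F]
    simp only [map_add, map_sub, Derivation.map_smul, Derivation.leibniz, Zd_zc, smul_eq_mul]
    rw [sub_sub]
    congr 2
    by_cases h : β = α
    · simp [h]
    · simp [h, Ne.symm h]
  rw [h1, h2]
  simp only [Zd_apply, Zb_apply, T, dX, dY, along_comm _ (0, 1),
    along_comm (EuclideanSpace.single β (1 : ℂ), 0) (EuclideanSpace.single α (1 : ℂ), 0),
    along_comm (EuclideanSpace.single β (1 : ℂ), 0) (EuclideanSpace.single α Complex.I, 0),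
    along_comm (EuclideanSpace.single β Complex.I, 0) (EuclideanSpace.single α (1 : ℂ), 0),
    along_comm (EuclideanSpace.single β Complex.I, 0) (EuclideanSpace.single α Complex.I, 0)]
  ext p
  by_cases h : β = α
  · simp [h, along_comm (EuclideanSpace.single α Complex.I, 0)
      (EuclideanSpace.single α (1 : ℂ), 0)]
    ring
  · simp [h]; ring

/-- The constant function `i`. -/
def im : SmoothFn n := algebraMap ℂ (SmoothFn n) Complex.I

@[simp] theorem im_val (p : HeisenbergSpace n) : (im : SmoothFn n).1 p = Complex.I := rfl

theorem im_sq : (im : SmoothFn n) ^ 2 = -1 := by ext p; simp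

@[simp] theorem cj_im : cj (im : SmoothFn n) = -im := by ext p; simp

@[simp] theorem deriv_im (D : Derivation ℂ (SmoothFn n) (SmoothFn n)) : D im = 0 :=
  D.map_algebraMap _

@[simp] theorem deriv_ofNat (D : Derivation ℂ (SmoothFn n) (SmoothFn n)) (k : ℕ)
    [k.AtLeastTwo] : D (ofNat(k)) = 0 := D.map_natCast k

theorem commutator (β α : Fin n) (F : SmoothFn n) :
    Zb β (Zd α F) = Zd α (Zb β F) + if β = α then 2 * im * T F else 0 := by
  rw [Zb_Zd]
  congr 1

/-! ### The tensors D, E, G and their divergences. -/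

/-- The squared length `∑ |Z_α f|²` of the horizontal gradient of a real function. -/
def gradSq (f : SmoothFn n) : SmoothFn n := ∑ α, Zd α f * cj (Zd α f)

/-- The function `g = |∂f|² + q - i f₀` of Jerison and Lee. -/
def jlG (f q : SmoothFn n) : SmoothFn n := gradSq f + q - im * T f

/-- The tensor `D_{αβ} = f_{αβ} - 2 f_α f_β`. -/
def tensorD (f : SmoothFn n) (α β : Fin n) : SmoothFn n :=
  Zd β (Zd α f) - 2 * Zd α f * Zd β f

/-- The tensor `E_{αβ̄} = f_{αβ̄} + g δ_{αβ}`. -/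
def tensorE (f q : SmoothFn n) (α β : Fin n) : SmoothFn n :=
  Zb β (Zd α f) + if β = α then jlG f q else 0

/-- The contraction `D_α` of `D_{αβ}` with the gradient. -/
def vecD (f : SmoothFn n) (α : Fin n) : SmoothFn n := ∑ β, tensorD f α β * cj (Zd β f)

/-- The contraction `E_α` of `E_{αβ̄}` with the gradient. -/
def vecE (f q : SmoothFn n) (α : Fin n) : SmoothFn n := ∑ β, tensorE f q α β * Zd β f

/-- The vector `G_α = i f_{0α} + g f_α`. -/
def vecG (f q : SmoothFn n) (α : Fin n) : SmoothFn n := im * Zd α (T f) + jlG f q * Zd α f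

/-- The CR Yamabe equation for `f = (log u) / n` and `q = e^{2f} / 4`. -/
structure IsYamabe (f q : SmoothFn n) : Prop where
  real_f : cj f = f
  real_q : cj q = q
  Zd_q : ∀ α, Zd α q = 2 * q * Zd α f
  T_q : T q = 2 * q * T f
  eqn : ∑ α, Zb α (Zd α f) = -(n * jlG f q)

theorem Zb_real {f : SmoothFn n} (hf : cj f = f) (α : Fin n) : Zb α f = cj (Zd α f) := by
  conv_lhs => rw [← hf]
  exact Zb_cj α f

theorem T_real {f : SmoothFn n} (hf : cj f = f) : cj (T f) = T f := by
  rw [← T_cj, hf]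

theorem gradSq_real (f : SmoothFn n) : cj (gradSq f) = gradSq f := by
  simp [gradSq, mul_comm]

theorem Zd_Zd_eq (f : SmoothFn n) (α β : Fin n) :
    Zd β (Zd α f) = tensorD f α β + 2 * Zd α f * Zd β f := by
  simp [tensorD]

theorem Zb_Zd_eq (f q : SmoothFn n) (α β : Fin n) :
    Zb β (Zd α f) = tensorE f q α β - if β = α then jlG f q else 0 := by
  simp [tensorE]

theorem tensorD_symm (f : SmoothFn n) (α β : Fin n) : tensorD f α β = tensorD f β α := by
  rw [tensorD, tensorD, Zd_comm]
  ring

namespace IsYamabe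

variable {f q : SmoothFn n} (h : IsYamabe f q)
include h

theorem cj_jlG : cj (jlG f q) = jlG f q + 2 * im * T f := by
  simp only [jlG, map_sub, map_add, gradSq_real, h.real_q, map_mul, cj_im, T_real h.real_f]
  ring

theorem Zd_cj_Zd (α β : Fin n) :
    Zd α (cj (Zd β f)) = tensorE f q α β - if β = α then cj (jlG f q) else 0 := by
  rw [← Zb_real h.real_f, tensorE, commutator, h.cj_jlG]
  split_ifs <;> ring

/-- E is Hermitian because the skew part of f_{αβ̄} is the commutator term in i f₀ δ_{αβ}, and the
imaginary part -f₀ of g cancels it. -/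
theorem cj_tensorE (α β : Fin n) : cj (tensorE f q α β) = tensorE f q β α := by
  have h1 := h.Zd_cj_Zd β α
  rw [Zd_cj] at h1
  rw [tensorE, map_add, h1]
  by_cases hab : α = β
  · simp [hab]
  · simp [hab, Ne.symm hab]

theorem trace_tensorE : ∑ α, tensorE f q α α = 0 := by
  simp only [tensorE, if_true, Finset.sum_add_distrib, h.eqn]
  simp

theorem Zd_gradSq (α : Fin n) :
    Zd α (gradSq f) = vecD f α + vecE f q α + (2 * gradSq f - cj (jlG f q)) * Zd α f := by
  have h1 : ∀ γ, Zd α (Zd γ f * cj (Zd γ f)) = tensorE f q α γ * Zd γ f +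
      tensorD f α γ * cj (Zd γ f) + 2 * Zd α f * (Zd γ f * cj (Zd γ f)) -
      (if γ = α then cj (jlG f q) * Zd γ f else 0) := by
    intro γ
    rw [Derivation.leibniz, h.Zd_cj_Zd, Zd_Zd_eq, tensorD_symm f γ α]
    simp only [smul_eq_mul]
    split_ifs <;> ring
  rw [gradSq, map_sum, Finset.sum_congr rfl fun γ _ => h1 γ]
  rw [Finset.sum_sub_distrib, Finset.sum_add_distrib, Finset.sum_add_distrib, ← Finset.mul_sum]
  simp only [Finset.sum_ite_eq', Finset.mem_univ, if_true, vecD, vecE]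
  ring

/-- Together with `Zd_jlG` this closes the system: derivatives of g and ḡ are linear in D, E, G,
apart from 2 g f_α. Hence ḡ is killed by Z_α and g behaves like e^{2f} under Z_α as soon as the
tensors vanish. -/
theorem Zd_cj_jlG (α : Fin n) :
    Zd α (cj (jlG f q)) = vecD f α + vecE f q α + vecG f q α := by
  have e : cj (jlG f q) = gradSq f + q + im * T f := by
    rw [h.cj_jlG, jlG]; ring
  conv_lhs => rw [e]
  rw [map_add, map_add, h.Zd_gradSq, h.Zd_q, Derivation.leibniz, deriv_im, vecG, e, jlG]
  simp only [smul_eq_mul]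
  ring

theorem Zd_jlG (α : Fin n) :
    Zd α (jlG f q) = vecD f α + vecE f q α - vecG f q α + 2 * jlG f q * Zd α f := by
  have e : cj (jlG f q) = gradSq f + q + im * T f := by
    rw [h.cj_jlG, jlG]; ring
  conv_lhs => rw [jlG]
  rw [map_sub, map_add, h.Zd_gradSq, h.Zd_q, Derivation.leibniz, deriv_im, vecG, e, jlG]
  simp only [smul_eq_mul]
  ring

theorem Zb_jlG (α : Fin n) :
    Zb α (jlG f q) = cj (vecD f α + vecE f q α + vecG f q α) := by
  rw [← h.Zd_cj_jlG, ← Zb_cj, cj_cj]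

/-- Since Z_ᾱ and Z_β̄ commute, the third-order term is the Z_β̄-derivative of the equation. -/
theorem sum_Zb_tensorE (β : Fin n) :
    ∑ α, Zb α (tensorE f q α β) = (1 - n) * Zb β (jlG f q) := by
  have h1 : ∀ α, Zb α (tensorE f q α β) =
      Zb β (Zb α (Zd α f)) + if β = α then Zb α (jlG f q) else 0 := by
    intro α
    rw [tensorE, map_add, Zb_comm]
    split_ifs <;> simp
  rw [Finset.sum_congr rfl fun α _ => h1 α, Finset.sum_add_distrib, ← map_sum, h.eqn]
  simp only [map_neg, Derivation.leibniz, Derivation.map_natCast, Finset.sum_ite_eq,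
    Finset.mem_univ, if_true, smul_eq_mul]
  ring

/-- Moving Z_ᾱ past Z_β produces a multiple of i f_{0β}, which is what G_β records. The remaining
third-order term is the Z_β-derivative of the equation. -/
theorem sum_Zb_tensorD (β : Fin n) :
    ∑ α, Zb α (tensorD f α β) =
      -(n * vecD f β) - (n + 2) * vecE f q β + (n + 2) * vecG f q β := by
  have h1 : ∀ α, Zb α (tensorD f α β) = Zd β (Zb α (Zd α f)) +
      (if α = β then 2 * im * T (Zd α f) else 0) - 2 * Zd β f * Zb α (Zd α f)
      - 2 * (tensorE f q β α * Zd α f) + (if α = β then 2 * jlG f q * Zd α f else 0) := by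
    intro α
    rw [tensorD, map_sub, commutator, Derivation.leibniz, Derivation.leibniz, deriv_ofNat,
      Zb_Zd_eq f q β α]
    simp only [smul_eq_mul]
    split_ifs <;> ring
  rw [Finset.sum_congr rfl fun α _ => h1 α]
  simp only [Finset.sum_add_distrib, Finset.sum_sub_distrib, ← Finset.mul_sum, ← map_sum, h.eqn,
    Finset.sum_ite_eq', Finset.mem_univ, if_true]
  rw [map_neg, Derivation.leibniz, Derivation.map_natCast, h.Zd_jlG]
  have e : ∑ α, tensorE f q β α * Zd α f = vecE f q β := rfl
  rw [e, T_Zd]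
  have e2 : im * Zd β (T f) = vecG f q β - jlG f q * Zd β f := by simp [vecG]
  simp only [smul_eq_mul]
  linear_combination 2 * e2

theorem sum_Zb_vecE :
    ∑ α, Zb α (vecE f q α) =
      (1 - n) * ∑ β, Zd β f * cj (vecD f β + vecE f q β + vecG f q β) +
      ∑ α, ∑ β, tensorE f q α β * cj (tensorE f q α β) := by
  have h1 : ∀ α, Zb α (vecE f q α) = ∑ β, (tensorE f q α β * cj (tensorE f q α β)
      - (if α = β then jlG f q * tensorE f q α β else 0) + Zd β f * Zb α (tensorE f q α β)) := by
    intro α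
    rw [vecE, map_sum]
    refine Finset.sum_congr rfl fun β _ => ?_
    rw [Derivation.leibniz, Zb_Zd_eq f q β α, h.cj_tensorE]
    simp only [smul_eq_mul]
    split_ifs <;> ring
  rw [Finset.sum_congr rfl fun α _ => h1 α]
  simp only [Finset.sum_add_distrib, Finset.sum_sub_distrib, Finset.sum_ite_eq, Finset.mem_univ,
    if_true, ← Finset.mul_sum, h.trace_tensorE]
  rw [Finset.sum_comm (f := fun α β => Zd β f * Zb α (tensorE f q α β))]
  simp only [← Finset.mul_sum, h.sum_Zb_tensorE, h.Zb_jlG]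
  rw [Finset.mul_sum, mul_zero, sub_zero, add_comm]
  congr 1
  exact Finset.sum_congr rfl fun β _ => by ring

theorem sum_Zb_vecD :
    ∑ α, Zb α (vecD f α) =
      ∑ β, (-(n * vecD f β) - (n + 2) * vecE f q β + (n + 2) * vecG f q β) * cj (Zd β f) +
      ∑ α, ∑ β, tensorD f α β * cj (tensorD f α β) + 2 * ∑ α, vecD f α * cj (Zd α f) := by
  have h1 : ∀ α, Zb α (vecD f α) = ∑ β, (tensorD f α β * cj (tensorD f α β)
      + 2 * (tensorD f α β * cj (Zd β f) * cj (Zd α f)) +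
      cj (Zd β f) * Zb α (tensorD f α β)) := by
    intro α
    rw [vecD, map_sum]
    refine Finset.sum_congr rfl fun β _ => ?_
    rw [Derivation.leibniz, Zb_cj, Zd_Zd_eq f β α, tensorD_symm f β α]
    simp only [smul_eq_mul, map_add, map_mul, map_ofNat]
    ring
  rw [Finset.sum_congr rfl fun α _ => h1 α]
  simp only [Finset.sum_add_distrib, ← Finset.mul_sum, ← Finset.sum_mul]
  rw [Finset.sum_comm (f := fun α β => cj (Zd β f) * Zb α (tensorD f α β))]
  simp only [← Finset.mul_sum, h.sum_Zb_tensorD]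
  have e : ∀ α, ∑ β, tensorD f α β * cj (Zd β f) = vecD f α := fun α => rfl
  simp only [e, mul_comm (cj (Zd _ f))]
  ring

/-- Every f_{0α} is traded for G_α. Only f₀₀ cannot be removed. In the divergence of `jlField` it
enters with a purely imaginary coefficient, so it disappears from the real part. -/
theorem T_jlG :
    T (jlG f q) = im * ∑ α, (Zd α f * cj (vecG f q α) - vecG f q α * cj (Zd α f)) +
      T f * (jlG f q + cj (jlG f q)) - im * T (T f) := by
  have h0 : ∀ α, Zd α (T f) = im * (jlG f q * Zd α f - vecG f q α) := by
    intro α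
    rw [vecG]
    linear_combination Zd α (T f) * im_sq (n := n)
  have h1 : ∀ α, T (Zd α f * cj (Zd α f)) =
      im * (Zd α f * cj (vecG f q α) - vecG f q α * cj (Zd α f)) +
      (im * (jlG f q - cj (jlG f q))) * (Zd α f * cj (Zd α f)) := by
    intro α
    rw [Derivation.leibniz, T_cj, T_Zd, h0, map_mul, map_sub, map_mul, cj_im]
    simp only [smul_eq_mul]
    ring
  conv_lhs => rw [jlG, gradSq]
  rw [map_sub, map_add, map_sum, Finset.sum_congr rfl fun α _ => h1 α, h.T_q, Derivation.leibniz,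
    deriv_im, Finset.sum_add_distrib, ← Finset.mul_sum, ← Finset.mul_sum]
  have e : ∑ α, Zd α f * cj (Zd α f) = gradSq f := rfl
  rw [e, h.cj_jlG, jlG]
  simp only [smul_eq_mul]
  linear_combination (-2 * T f * gradSq f) * im_sq (n := n)

theorem sum_Zb_vecG :
    ∑ α, Zb α (vecG f q α) = -((im : SmoothFn n) * (n : SmoothFn n) * T (jlG f q)) +
      ∑ α, Zd α f * cj (vecD f α + vecE f q α + vecG f q α) - n * jlG f q ^ 2 := by
  have h1 : ∀ α, Zb α (vecG f q α) = im * T (Zb α (Zd α f)) + jlG f q * Zb α (Zd α f) +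
      Zd α f * cj (vecD f α + vecE f q α + vecG f q α) := by
    intro α
    rw [← h.Zb_jlG, vecG, map_add, Derivation.leibniz, Derivation.leibniz, deriv_im, ← T_Zd, ← T_Zb]
    simp only [smul_eq_mul]
    ring
  rw [Finset.sum_congr rfl fun α _ => h1 α]
  simp only [Finset.sum_add_distrib, ← Finset.mul_sum, ← map_sum, h.eqn]
  rw [map_neg, Derivation.leibniz, Derivation.map_natCast]
  simp only [smul_eq_mul]
  ring

end IsYamabe

/-! ### The Jerison–Lee divergence identity. -/

/-- The Hermitian pairing of two vectors of smooth functions. -/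
def pair (X Y : Fin n → SmoothFn n) : SmoothFn n := ∑ α, X α * cj (Y α)

theorem cj_pair (X Y : Fin n → SmoothFn n) : cj (pair X Y) = pair Y X := by
  simp [pair, mul_comm]

theorem pair_def (X Y : Fin n → SmoothFn n) : ∑ α, X α * cj (Y α) = pair X Y := rfl

/-- The vector field of Jerison and Lee. -/
def jlField (f q : SmoothFn n) (α : Fin n) : SmoothFn n :=
  (jlG f q + 3 * im * T f) * vecE f q α + (jlG f q - im * T f) * vecD f α -
    3 * im * T f * vecG f q α

namespace IsYamabe

variable {f q : SmoothFn n} (h : IsYamabe f q)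
include h

theorem pair_vecE_real : pair (vecE f q) (fun α => Zd α f) = pair (fun α => Zd α f) (vecE f q) := by
  simp only [pair, vecE, map_sum, map_mul, h.cj_tensorE, Finset.sum_mul, Finset.mul_sum]
  rw [Finset.sum_comm]
  exact Finset.sum_congr rfl fun α _ => Finset.sum_congr rfl fun β _ => by ring

omit h in
theorem im_Zd_T (α : Fin n) : im * Zd α (T f) = vecG f q α - jlG f q * Zd α f := by
  simp [vecG]

theorem sum_Zb_jlField :
    ∑ α, Zb α (jlField f q α) =
      (jlG f q + 3 * im * T f) * ∑ α, Zb α (vecE f q α) +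
      (jlG f q - im * T f) * ∑ α, Zb α (vecD f α) -
      3 * im * T f * ∑ α, Zb α (vecG f q α) +
      (pair (vecE f q) (vecD f) + pair (vecE f q) (vecE f q) - 2 * pair (vecE f q) (vecG f q) +
        3 * cj (jlG f q) * pair (vecE f q) (fun α => Zd α f)) +
      (pair (vecD f) (vecD f) + pair (vecD f) (vecE f q) + 2 * pair (vecD f) (vecG f q) -
        cj (jlG f q) * pair (vecD f) (fun α => Zd α f)) +
      3 * (pair (vecG f q) (vecG f q) - cj (jlG f q) * pair (vecG f q) (fun α => Zd α f)) := by
  have hT : ∀ α, im * Zb α (T f) = -cj (vecG f q α) + cj (jlG f q) * cj (Zd α f) := by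
    intro α
    have := congrArg cj (im_Zd_T (f := f) (q := q) α)
    rw [map_mul, cj_im, ← Zb_cj, T_real h.real_f, map_sub, map_mul] at this
    linear_combination -this
  have h1 : ∀ α, Zb α (jlField f q α) =
      (jlG f q + 3 * im * T f) * Zb α (vecE f q α) + (jlG f q - im * T f) * Zb α (vecD f α) -
      3 * im * T f * Zb α (vecG f q α) +
      (vecE f q α * cj (vecD f α) + vecE f q α * cj (vecE f q α)
        - 2 * (vecE f q α * cj (vecG f q α)) + 3 * cj (jlG f q) * (vecE f q α * cj (Zd α f))) +
      (vecD f α * cj (vecD f α) + vecD f α * cj (vecE f q α) + 2 * (vecD f α * cj (vecG f q α)) -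
        cj (jlG f q) * (vecD f α * cj (Zd α f))) +
      3 * (vecG f q α * cj (vecG f q α) - cj (jlG f q) * (vecG f q α * cj (Zd α f))) := by
    intro α
    simp only [jlField, map_add, map_sub, Derivation.leibniz, deriv_im, deriv_ofNat, h.Zb_jlG,
      smul_eq_mul]
    linear_combination (3 * vecE f q α - vecD f α - 3 * vecG f q α) * hT α
  rw [Finset.sum_congr rfl fun α _ => h1 α]
  simp only [Finset.sum_add_distrib, Finset.sum_sub_distrib, ← Finset.mul_sum, pair_def]

/-- The Jerison–Lee identity, for a real weight `W` behaving like `e^{2(n-1)f}`. -/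
theorem jl_identity {W : SmoothFn n} (hW : cj W = W)
    (hZW : ∀ α, Zb α W = 2 * ((n : SmoothFn n) - 1) * W * cj (Zd α f)) :
    ∑ α, Zb α (W * jlField f q α) + cj (∑ α, Zb α (W * jlField f q α)) =
      2 * W * ((gradSq f + q) * (∑ α, ∑ β, tensorE f q α β * cj (tensorE f q α β) +
          ∑ α, ∑ β, tensorD f α β * cj (tensorD f α β)) +
        3 * pair (vecG f q) (vecG f q) + pair (vecD f) (vecD f) + pair (vecE f q) (vecE f q) +
        (pair (vecG f q) (vecD f) + pair (vecD f) (vecG f q)) -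
        (pair (vecG f q) (vecE f q) + pair (vecE f q) (vecG f q)) +
        (pair (vecD f) (vecE f q) + pair (vecE f q) (vecD f))) := by
  -- The weight contributes only pairings with ∂f. With the exponent 2(n - 1) they cancel, in the
  -- real part, all such pairings coming from the divergence of the field.
  have h1 : ∑ α, Zb α (W * jlField f q α) = W * (∑ α, Zb α (jlField f q α) + 2 * ((n : SmoothFn n) - 1) *
      ((jlG f q + 3 * im * T f) * pair (vecE f q) (fun α => Zd α f) +
      (jlG f q - im * T f) * pair (vecD f) (fun α => Zd α f) -
      3 * im * T f * pair (vecG f q) (fun α => Zd α f))) := by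
    have : ∀ α, Zb α (W * jlField f q α) = W * Zb α (jlField f q α) + W * (2 * ((n : SmoothFn n) - 1) *
      ((jlG f q + 3 * im * T f) * (vecE f q α * cj (Zd α f)) +
      (jlG f q - im * T f) * (vecD f α * cj (Zd α f)) -
      3 * im * T f * (vecG f q α * cj (Zd α f)))) := by
      intro α
      rw [Derivation.leibniz, hZW, jlField]
      simp only [smul_eq_mul]
      ring
    rw [Finset.sum_congr rfl fun α _ => this α]
    simp only [Finset.sum_add_distrib, Finset.sum_sub_distrib, ← Finset.mul_sum, pair_def]
    ring
  have hE : ∑ β, Zd β f * cj (vecD f β + vecE f q β + vecG f q β) =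
      pair (fun α => Zd α f) (vecD f) + pair (vecE f q) (fun α => Zd α f) +
        pair (fun α => Zd α f) (vecG f q) := by
    rw [h.pair_vecE_real]
    simp only [map_add, mul_add, Finset.sum_add_distrib, pair]
  have hD : ∑ β, (-(n * vecD f β) - (n + 2) * vecE f q β + (n + 2) * vecG f q β) * cj (Zd β f) =
      -(n * pair (vecD f) (fun α => Zd α f)) - (n + 2) * pair (vecE f q) (fun α => Zd α f) +
        (n + 2) * pair (vecG f q) (fun α => Zd α f) := by
    simp only [pair, Finset.mul_sum, ← Finset.sum_neg_distrib, ← Finset.sum_add_distrib,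
      ← Finset.sum_sub_distrib]
    exact Finset.sum_congr rfl fun β _ => by ring
  have hG : ∑ α, (Zd α f * cj (vecG f q α) - vecG f q α * cj (Zd α f)) =
      pair (fun α => Zd α f) (vecG f q) - pair (vecG f q) (fun α => Zd α f) := by
    simp only [Finset.sum_sub_distrib, pair]
  have hEsq : cj (∑ α, ∑ β, tensorE f q α β * cj (tensorE f q α β)) =
      ∑ α, ∑ β, tensorE f q α β * cj (tensorE f q α β) := by
    simp [mul_comm]
  have hDsq : cj (∑ α, ∑ β, tensorD f α β * cj (tensorD f α β)) =
      ∑ α, ∑ β, tensorD f α β * cj (tensorD f α β) := by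
    simp [mul_comm]
  have hg : jlG f q = gradSq f + q - im * T f := rfl
  have h3 : (im : SmoothFn n) ^ 3 = -im := by rw [pow_succ, im_sq]; ring
  rw [h1, h.sum_Zb_jlField, h.sum_Zb_vecE, h.sum_Zb_vecD, h.sum_Zb_vecG, h.T_jlG, hE, hD, hG,
    pair_def, h.cj_jlG, hg]
  simp only [map_add, map_sub, map_mul, map_neg, map_pow, cj_pair, cj_im, hEsq, hDsq, hW,
    T_real h.real_f, T_real (T_real h.real_f), gradSq_real, h.real_q, map_ofNat, map_natCast,
    map_one, h.pair_vecE_real]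
  -- With squares and pairings treated as atoms the claim is a polynomial identity; the only extra
  -- relation needed is i³ = -i.
  generalize (∑ α, ∑ β, tensorE f q α β * cj (tensorE f q α β)) = eSq
  generalize (∑ α, ∑ β, tensorD f α β * cj (tensorD f α β)) = dSq
  generalize pair (fun α => Zd α f) (vecE f q) = fE
  generalize pair (fun α => Zd α f) (vecD f) = fD
  generalize pair (fun α => Zd α f) (vecG f q) = fG
  generalize pair (vecD f) (fun α => Zd α f) = Df
  generalize pair (vecG f q) (fun α => Zd α f) = Gf
  ring_nf
  simp only [h3]
  ring

omit h in
-- In the cross terms, f_β̄ contracts with D_{αβ} and f_γ with E_{αγ̄}, giving the pairings of the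
-- contracted vectors. This recognises the indefinite-looking terms of the identity as one square.
theorem sum_tensor_sq :
    ∑ α, ∑ β, ∑ γ, (tensorD f α β * cj (Zd γ f) + tensorE f q α γ * Zd β f) *
        cj (tensorD f α β * cj (Zd γ f) + tensorE f q α γ * Zd β f) =
      gradSq f * (∑ α, ∑ β, tensorE f q α β * cj (tensorE f q α β) +
          ∑ α, ∑ β, tensorD f α β * cj (tensorD f α β)) +
        (pair (vecD f) (vecE f q) + pair (vecE f q) (vecD f)) := by
  have h1 : ∀ α, ∑ β, ∑ γ, (tensorD f α β * cj (Zd γ f) + tensorE f q α γ * Zd β f) *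
        cj (tensorD f α β * cj (Zd γ f) + tensorE f q α γ * Zd β f) =
      gradSq f * (∑ β, tensorE f q α β * cj (tensorE f q α β)) +
        gradSq f * (∑ β, tensorD f α β * cj (tensorD f α β)) +
        (vecD f α * cj (vecE f q α) + vecE f q α * cj (vecD f α)) := by
    intro α
    have h2 : ∀ β γ, (tensorD f α β * cj (Zd γ f) + tensorE f q α γ * Zd β f) *
        cj (tensorD f α β * cj (Zd γ f) + tensorE f q α γ * Zd β f) =
        Zd β f * cj (Zd β f) * (tensorE f q α γ * cj (tensorE f q α γ)) +
        (tensorD f α β * cj (tensorD f α β)) * (Zd γ f * cj (Zd γ f)) +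
        (tensorD f α β * cj (Zd β f)) * (cj (tensorE f q α γ) * cj (Zd γ f)) +
        cj (tensorD f α β) * Zd β f * (tensorE f q α γ * Zd γ f) := by
      intro β γ
      simp only [map_add, map_mul, cj_cj]
      ring
    simp only [h2, Finset.sum_add_distrib, ← Finset.mul_sum, ← Finset.sum_mul]
    simp only [vecD, vecE, map_sum, map_mul, cj_cj, gradSq]
    ring
  rw [Finset.sum_congr rfl fun α _ => h1 α]
  simp only [Finset.sum_add_distrib, ← Finset.mul_sum, pair]
  ring

end IsYamabe

/-! ### Rigidity when D, E and G vanish. -/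

theorem fderiv_eq_zero {F : SmoothFn n} (hX : ∀ α, dX α F = 0) (hY : ∀ α, dY α F = 0)
    (hT : T F = 0) (p : HeisenbergSpace n) : fderiv ℝ F.1 p = 0 := by
  have hX' : ∀ α, fderiv ℝ F.1 p (EuclideanSpace.single α (1 : ℂ), 0) = 0 := fun α => by
    have := congrArg (fun G : SmoothFn n => G.1 p) (hX α); exact this
  have hY' : ∀ α, fderiv ℝ F.1 p (EuclideanSpace.single α Complex.I, 0) = 0 := fun α => by
    have := congrArg (fun G : SmoothFn n => G.1 p) (hY α); exact this
  have hT' : fderiv ℝ F.1 p (0, 1) = 0 := by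
    have := congrArg (fun G : SmoothFn n => G.1 p) hT; exact this
  refine ContinuousLinearMap.ext fun v => ?_
  have hv : v = ∑ α, ((v.1 α).re • ((EuclideanSpace.single α (1 : ℂ), 0) : HeisenbergSpace n) +
      (v.1 α).im • ((EuclideanSpace.single α Complex.I, 0) : HeisenbergSpace n)) +
      v.2 • ((0, 1) : HeisenbergSpace n) := by
    refine Prod.ext ?_ ?_
    · ext β
      simp [Prod.fst_sum, Finset.sum_add_distrib, Pi.single_apply]
    · simp [Prod.snd_sum]
  rw [hv]
  simp only [map_add, map_sum, map_smul, hX', hY', hT', smul_zero, add_zero,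
    Finset.sum_const_zero, zero_apply]

/-- The horizontal fields bracket-generate: the commutator of Z_α and Z_ᾱ recovers ∂/∂t, which
requires at least one index α. -/
theorem eq_const (hn : 0 < n) {F : SmoothFn n} (h1 : ∀ α, Zd α F = 0) (h2 : ∀ α, Zb α F = 0) :
    ∃ c : ℂ, ∀ p, F.1 p = c := by
  have hT : T F = 0 := by
    have := commutator ⟨0, hn⟩ ⟨0, hn⟩ F
    simp only [h1, h2, map_zero, if_true, zero_add] at this
    ext p
    have h3 := congrArg (fun G : SmoothFn n => G.1 p) this
    simpa using h3
  have key : ∀ α, dX α F = 0 ∧ dY α F = 0 := by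
    intro α
    have e1 := h1 α
    have e2 := h2 α
    rw [Zd_apply, hT, mul_zero, add_zero] at e1
    rw [Zb_apply, hT, mul_zero, sub_zero] at e2
    constructor
    · ext p
      have e1 := congrArg (fun G : SmoothFn n => G.1 p) e1
      have e2 := congrArg (fun G : SmoothFn n => G.1 p) e2
      simp only [smul_val, sub_val, add_val, zero_val] at e1 e2 ⊢
      linear_combination e1 + e2
    · ext p
      have e1 := congrArg (fun G : SmoothFn n => G.1 p) e1
      have e2 := congrArg (fun G : SmoothFn n => G.1 p) e2
      simp only [smul_val, sub_val, add_val, zero_val] at e1 e2 ⊢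
      linear_combination Complex.I * (e1 - e2) + (dY α F).1 p * Complex.I_sq
  refine ⟨F.1 0, fun p => ?_⟩
  exact is_const_of_fderiv_eq_zero F.differentiable
    (fderiv_eq_zero (fun α => (key α).1) (fun α => (key α).2) hT) p 0

/-- The function `t + i |z|²`. -/
def tIz : SmoothFn n := tc + im * ∑ α, zc α * cj (zc α)

theorem Zd_tIz (α : Fin n) : Zd α tIz = 2 * im * cj (zc α) := by
  have h : ∀ β, Zd α (zc β * cj (zc β)) = if α = β then cj (zc β) else 0 := by
    intro β
    rw [Derivation.leibniz, Zd_cj_zc, Zd_zc]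
    split_ifs <;> simp
  rw [tIz, map_add, Derivation.leibniz, deriv_im, map_sum, Finset.sum_congr rfl fun β _ => h β,
    Zd_tc]
  simp only [Finset.sum_ite_eq, Finset.mem_univ, if_true]
  ext p
  simp
  ring

theorem Zb_tIz (α : Fin n) : Zb α tIz = 0 := by
  have h : ∀ β, Zb α (zc β * cj (zc β)) = if α = β then zc β else 0 := by
    intro β
    rw [Derivation.leibniz, Zb_zc, Zb_cj_zc]
    split_ifs <;> simp
  rw [tIz, map_add, Derivation.leibniz, deriv_im, map_sum, Finset.sum_congr rfl fun β _ => h β,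
    Zb_tc]
  simp only [Finset.sum_ite_eq, Finset.mem_univ, if_true]
  ext p
  simp

namespace IsYamabe

variable {f q : SmoothFn n}

/-- If the tensors `D`, `E`, `G` vanish, then `e^{-2f} = |w|² / K` for the defining function `w` of
a Jerison–Lee extremal. -/
theorem exists_defining_function (h : IsYamabe f q) (hn : 0 < n) {e : SmoothFn n} (he : cj e = e)
    (hZe : ∀ α, Zd α e = -2 * e * Zd α f) (hqe : 4 * q * e = 1) (hqpos : ∀ p, 0 < (q.1 p).re)
    (hD : ∀ α β, tensorD f α β = 0) (hE : ∀ α β, tensorE f q α β = 0)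
    (hG : ∀ α, vecG f q α = 0) :
    ∃ (μ : EuclideanSpace ℂ (Fin n)) (lam : ℂ), ‖μ‖ ^ 2 < 4 * lam.im ∧
      ∀ p : HeisenbergSpace n, 4 * (q.1 p).re *
        ‖(p.2 : ℂ) + Complex.I * ((‖p.1‖ ^ 2 : ℝ) : ℂ) + inner ℂ μ p.1 + lam‖ ^ 2 =
          4 * lam.im - ‖μ‖ ^ 2 := by
  have hDv : ∀ α, vecD f α = 0 := fun α => by simp [vecD, hD]
  have hEv : ∀ α, vecE f q α = 0 := fun α => by simp [vecE, hE]
  set g := jlG f q with hg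
  have hZg : ∀ α, Zd α g = 2 * g * Zd α f := fun α => by
    rw [hg, h.Zd_jlG, hDv, hEv, hG]; simp
  have hZcg : ∀ α, Zd α (cj g) = 0 := fun α => by
    rw [hg, h.Zd_cj_jlG, hDv, hEv, hG]; simp
  -- Here g scales like e^{2f}, ḡ is killed and e = 1/(4q) scales like e^{-2f}, so the function
  -- |g|²e is constant.
  have hZN : ∀ α, Zd α (g * cj g * e) = 0 := by
    intro α
    rw [Derivation.leibniz, Derivation.leibniz, hZg, hZcg, hZe]
    simp only [smul_eq_mul]
    ring
  obtain ⟨N, hN⟩ := eq_const hn hZN (fun α => by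
    have : cj (g * cj g * e) = g * cj g * e := by
      rw [map_mul, map_mul, he, cj_cj]; ring
    rw [← this, Zb_cj, hZN, map_zero])
  have hqv : ∀ p, q.1 p = ((q.1 p).re : ℂ) := fun p => by
    have := congrArg (fun G : SmoothFn n => G.1 p) h.real_q
    simp only [cj_val] at this
    exact (Complex.conj_eq_iff_re.1 this).symm
  have hev : ∀ p, e.1 p = ((4 * (q.1 p).re)⁻¹ : ℝ) := fun p => by
    have := congrArg (fun G : SmoothFn n => G.1 p) hqe
    simp only [mul_val, ofNat_val, one_val] at this
    rw [hqv p] at this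
    push_cast
    exact eq_inv_of_mul_eq_one_right this
  have hgre : ∀ p, (g.1 p).re = ∑ α, Complex.normSq ((Zd α f).1 p) + (q.1 p).re := by
    intro p
    have hT : ((T f).1 p).im = 0 := by
      have := congrArg (fun G : SmoothFn n => G.1 p) (T_real h.real_f)
      simp only [cj_val] at this
      exact Complex.conj_eq_iff_im.1 this
    rw [hg, jlG, gradSq]
    simp [hT, Complex.mul_conj, ← Complex.ofReal_sum]
  have hgpos : ∀ p, 0 < (g.1 p).re := fun p => by
    rw [hgre]
    exact add_pos_of_nonneg_of_pos (Finset.sum_nonneg fun α _ => Complex.normSq_nonneg _) (hqpos p)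
  have hNv : ∀ p, N = ((Complex.normSq (g.1 p) * (4 * (q.1 p).re)⁻¹ : ℝ) : ℂ) := fun p => by
    rw [← hN p]
    simp only [mul_val, cj_val, Complex.mul_conj, hev]
    push_cast; ring
  set N0 : ℝ := Complex.normSq (g.1 0) * (4 * (q.1 0).re)⁻¹ with hN0
  have hN0pos : 0 < N0 := by
    have h1 : 0 < Complex.normSq (g.1 0) := by
      refine Complex.normSq_pos.2 fun h0 => ?_
      have := hgpos 0
      rw [h0] at this
      simp at this
    have := hqpos 0
    positivity
  have hNN : N = (N0 : ℂ) := hNv 0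
  have hN0v : ∀ p, Complex.normSq (g.1 p) = N0 * (4 * (q.1 p).re) := fun p => by
    have := hNv p
    rw [hNN] at this
    have h2 : N0 = Complex.normSq (g.1 p) * (4 * (q.1 p).re)⁻¹ := by exact_mod_cast this
    have := hqpos p
    rw [h2]
    field_simp
  set k : SmoothFn n := algebraMap ℂ (SmoothFn n) ((N0⁻¹ : ℝ) : ℂ) with hk
  have hDk : ∀ D : Derivation ℂ (SmoothFn n) (SmoothFn n), D k = 0 := fun D => D.map_algebraMap _
  have hkN : k * (g * cj g * e) = 1 := by
    ext p
    rw [mul_val, hN, hNN, hk, algebraMap_val, one_val, ← Complex.ofReal_mul,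
      inv_mul_cancel₀ hN0pos.ne', Complex.ofReal_one]
  -- As k g ḡ e = 1, this is w = i/g written without division. The factors ḡ and e have opposite
  -- logarithmic Z_ᾱ-derivatives, hence Z_ᾱ w = 0.
  set w : SmoothFn n := k * (im * (cj g * e)) with hw
  have hZw : ∀ α, Zd α w = -2 * Zd α f * w := by
    intro α
    rw [hw]
    simp only [Derivation.leibniz, hDk, deriv_im, hZcg, hZe, smul_eq_mul]
    ring
  have hZbw : ∀ α, Zb α w = 0 := by
    intro α
    have h1 : Zb α (cj g) = 2 * cj g * cj (Zd α f) := by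
      rw [Zb_cj, hZg]; simp only [map_mul, map_ofNat]
    have h2 : Zb α e = -2 * e * cj (Zd α f) := by
      rw [← he, Zb_cj, hZe]; simp only [map_mul, map_neg, map_ofNat, he]
    rw [hw]
    simp only [Derivation.leibniz, hDk, deriv_im, h1, h2, smul_eq_mul]
    ring
  set F : SmoothFn n := w - tIz with hF
  have hZF : ∀ α, Zd α F = -2 * Zd α f * w - 2 * im * cj (zc α) := by
    intro α
    rw [hF, map_sub, hZw, Zd_tIz]
  -- D = 0 makes the Z_β-derivative vanish. E = 0 replaces f_{αβ̄} by -g δ_{αβ}, and then g w = i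
  -- cancels the derivative of 2i z̄_α.
  have hm : ∀ α, ∃ c : ℂ, ∀ p, (Zd α F).1 p = c := by
    intro α
    refine eq_const hn (fun β => ?_) (fun β => ?_)
    · have hff := Zd_Zd_eq f α β
      rw [hD, zero_add] at hff
      have : Zd β (-2 : SmoothFn n) = 0 := by rw [map_neg, deriv_ofNat, neg_zero]
      rw [hZF]
      simp only [map_sub, Derivation.leibniz, hff, hZw, Zd_cj_zc, deriv_im, deriv_ofNat, this,
        smul_eq_mul]
      ring
    · have hff := Zb_Zd_eq f q α β
      rw [hE, zero_sub, ← hg] at hff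
      have : Zb β (-2 : SmoothFn n) = 0 := by rw [map_neg, deriv_ofNat, neg_zero]
      rw [hZF]
      simp only [map_sub, Derivation.leibniz, hff, hZbw, Zb_cj_zc, deriv_im, deriv_ofNat, this,
        smul_eq_mul]
      split_ifs
      · rw [hw]
        linear_combination 2 * im * hkN
      · ring
  choose m hm using hm
  obtain ⟨lam, hlam⟩ := eq_const hn
    (F := F - ∑ α, algebraMap ℂ (SmoothFn n) (m α) * zc α) (fun β => by
      have h1 : ∀ α, Zd β (algebraMap ℂ (SmoothFn n) (m α) * zc α) =
          if β = α then algebraMap ℂ (SmoothFn n) (m α) else 0 := by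
        intro α
        rw [Derivation.leibniz, Derivation.map_algebraMap, Zd_zc]
        split_ifs <;> simp
      rw [map_sub, map_sum, Finset.sum_congr rfl fun α _ => h1 α]
      ext p
      simp [hm])
    (fun β => by
      have h1 : ∀ α, Zb β (algebraMap ℂ (SmoothFn n) (m α) * zc α) = 0 := by
        intro α
        rw [Derivation.leibniz, Derivation.map_algebraMap, Zb_zc]
        simp
      rw [map_sub, map_sum, Finset.sum_congr rfl fun α _ => h1 α, hF, map_sub, hZbw, Zb_tIz]
      simp)
  set μ : EuclideanSpace ℂ (Fin n) := WithLp.toLp 2 (fun α => conj (m α)) with hμ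
  have hwv : ∀ p : HeisenbergSpace n, w.1 p =
      (p.2 : ℂ) + Complex.I * ((‖p.1‖ ^ 2 : ℝ) : ℂ) + inner ℂ μ p.1 + lam := by
    intro p
    have h1 := hlam p
    have h2 : ((‖p.1‖ ^ 2 : ℝ) : ℂ) = ∑ α, p.1 α * conj (p.1 α) := by
      rw [EuclideanSpace.norm_sq_eq]
      push_cast
      exact Finset.sum_congr rfl fun α _ => by rw [Complex.mul_conj, Complex.normSq_eq_norm_sq]; push_cast; rfl
    have h3 : inner ℂ μ p.1 = ∑ α, m α * p.1 α := by
      simp [PiLp.inner_apply, hμ, mul_comm]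
    rw [h2, h3]
    simp only [hF, tIz, sub_val, sum_val, mul_val, algebraMap_val, zc_val, add_val, tc_val, im_val,
      cj_val] at h1
    linear_combination h1
  have hwn : ∀ p, 4 * (q.1 p).re * ‖w.1 p‖ ^ 2 = N0⁻¹ := by
    intro p
    have hq := hqpos p
    rw [← Complex.normSq_eq_norm_sq, hw, mul_val, mul_val, mul_val, cj_val, hev, hk,
      algebraMap_val, im_val]
    simp only [Complex.normSq_mul, Complex.normSq_I, Complex.normSq_ofReal, Complex.normSq_conj,
      hN0v]
    field_simp
  have hlamv : w.1 0 = lam := by rw [hwv]; simp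
  -- Evaluation at the origin: λ = w(0), conj(μ_α) = -2 f_α w(0), |w(0)|² = e/N₀ and Im λ = (|∂f|² +
  -- q) e/N₀. The gradient terms cancel and 4qe = 1 remains.
  have hconst : N0⁻¹ = 4 * lam.im - ‖μ‖ ^ 2 := by
    have hq := hqpos 0
    have h1 : lam.im = N0⁻¹ * ((g.1 0).re * (4 * (q.1 0).re)⁻¹) := by
      rw [← hlamv, hw, mul_val, mul_val, mul_val, cj_val, hev, hk, algebraMap_val, im_val]
      simp
    have h2 : ‖μ‖ ^ 2 = ∑ α, 4 * Complex.normSq ((Zd α f).1 0) * ‖w.1 0‖ ^ 2 := by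
      rw [EuclideanSpace.norm_sq_eq]
      refine Finset.sum_congr rfl fun α _ => ?_
      have h3 := congrArg (fun G : SmoothFn n => G.1 0) (hZF α)
      simp only [hm] at h3
      have : ‖μ.ofLp α‖ = ‖m α‖ := by simp [hμ]
      rw [this, h3]
      simp [Complex.normSq_eq_norm_sq]
      ring
    rw [← Finset.sum_mul, ← Finset.mul_sum] at h2
    have h4 := hwn 0
    have h5 : ‖w.1 0‖ ^ 2 = N0⁻¹ * (4 * (q.1 0).re)⁻¹ := by
      rw [← h4]; field_simp
    rw [h1, h2, hgre, h5]
    field_simp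
    ring
  refine ⟨μ, lam, ?_, fun p => ?_⟩
  · have : 0 < N0⁻¹ := inv_pos.2 hN0pos
    linarith
  · rw [← hwv, hwn, hconst]

end IsYamabe
end SmoothFn

/-! ### Haar measure and integration by parts. -/

open MeasureTheory

/-- Haar measure on the Heisenberg group. -/
abbrev vol (n : ℕ) : Measure (HeisenbergSpace n) :=
  (Measure.addHaar : Measure (EuclideanSpace ℂ (Fin n))).prod volume

theorem finrank_euclideanSpace : Module.finrank ℝ (EuclideanSpace ℂ (Fin n)) = 2 * n := by
  rw [← Module.finrank_mul_finrank ℝ ℂ (EuclideanSpace ℂ (Fin n)), Complex.finrank_real_complex]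
  simp

/-- With s of order r² this gives the homogeneous dimension 2n + 2. -/
theorem vol_cylinder {r s : ℝ} (hr : 0 ≤ r) (hs : 0 ≤ s) :
    (vol n).real (Metric.closedBall 0 r ×ˢ Metric.closedBall 0 s) =
      r ^ (2 * n) * (Measure.addHaar : Measure (EuclideanSpace ℂ (Fin n))).real
        (Metric.closedBall 0 1) * (2 * s) := by
  rw [measureReal_def, Measure.prod_prod, ENNReal.toReal_mul, ← measureReal_def, ← measureReal_def,
    Measure.addHaar_real_closedBall' _ _ hr, finrank_euclideanSpace, Real.volume_real_closedBall hs]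

namespace SmoothFn

theorem hasCompactSupport_along {F : SmoothFn n} (hF : HasCompactSupport F.1)
    (v : HeisenbergSpace n) : HasCompactSupport (along v F).1 :=
  (hF.fderiv ℝ).comp_left (g := fun L : HeisenbergSpace n →L[ℝ] ℂ => L v) rfl

theorem integrable {F : SmoothFn n} (hF : HasCompactSupport F.1) : Integrable F.1 (vol n) :=
  F.continuous.integrable_of_hasCompactSupport hF

theorem integral_along {F : SmoothFn n} (hF : HasCompactSupport F.1) (v : HeisenbergSpace n) :
    ∫ p, (along v F).1 p ∂vol n = 0 := by
  have h := integral_mul_fderiv_eq_neg_fderiv_mul_of_integrable (μ := vol n) (v := v)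
    (f := fun _ : HeisenbergSpace n => (1 : ℂ)) (g := F.1) (by simp)
    (by simp only [one_mul]; exact integrable (hasCompactSupport_along hF v))
    (by simpa using integrable hF) (fun x _ => differentiableAt_const _)
    (fun x _ => F.differentiable x)
  simp only [along_val]
  simpa using h

theorem hasCompactSupport_mul {F : SmoothFn n} (hF : HasCompactSupport F.1) (G : SmoothFn n) :
    HasCompactSupport (F * G).1 := HasCompactSupport.mul_right hF

theorem hasCompactSupport_Zb {F : SmoothFn n} (hF : HasCompactSupport F.1) (α : Fin n) :
    HasCompactSupport (Zb α F).1 := by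
  refine HasCompactSupport.intro' hF.isCompact (isClosed_tsupport _) fun p hp => ?_
  have h0 : ∀ v, (along v F).1 p = 0 := fun v => by
    rw [along_val, fderiv_of_notMem_tsupport (𝕜 := ℝ) hp]; rfl
  have := Zb_apply α F
  rw [this]
  simp [dX, dY, T, h0]

/-- The coefficient z_α does not depend on t, so it can be moved inside ∂/∂t and Z_ᾱ is a
combination of pure derivatives of compactly supported functions. -/
theorem integral_Zb {F : SmoothFn n} (hF : HasCompactSupport F.1) (α : Fin n) :
    ∫ p, (Zb α F).1 p ∂vol n = 0 := by
  have e : Zb α F = (1 / 2 : ℂ) • (dX α F + Complex.I • dY α F) -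
      Complex.I • T (F * zc α) := by
    rw [Zb_apply, Derivation.leibniz, T_zc]
    ext p
    simp
  have hT : HasCompactSupport (F * zc α).1 := hasCompactSupport_mul hF _
  have i1 := integrable (hasCompactSupport_along hF (EuclideanSpace.single α (1 : ℂ), 0))
  have i2 := integrable (hasCompactSupport_along hF (EuclideanSpace.single α Complex.I, 0))
  have i3 := integrable (hasCompactSupport_along hT (0, 1))
  have j1 := integral_along hF (EuclideanSpace.single α (1 : ℂ), 0)
  have j2 := integral_along hF (EuclideanSpace.single α Complex.I, 0)
  have j3 := integral_along hT (0, 1)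
  rw [e]
  simp only [sub_val, smul_val, add_val, dX, dY, T]
  have i4 : Integrable (fun p => (along (EuclideanSpace.single α (1 : ℂ), 0) F).1 p +
      Complex.I * (along (EuclideanSpace.single α Complex.I, 0) F).1 p) (vol n) :=
    i1.add (i2.const_mul _)
  rw [integral_sub (i4.const_mul _) (i3.const_mul _), integral_const_mul,
    integral_add i1 (i2.const_mul _), integral_const_mul, integral_const_mul, j1, j2, j3]
  simp

/-- The real part of the divergence of a vector field of type `(1,0)`. -/
def reDiv (V : Fin n → SmoothFn n) (p : HeisenbergSpace n) : ℝ := ((∑ α, Zb α (V α)).1 p).re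

theorem integrable_reDiv {V : Fin n → SmoothFn n} (hV : ∀ α, HasCompactSupport (V α).1) :
    Integrable (reDiv V) (vol n) := by
  have : Integrable (fun p => (∑ α, Zb α (V α)).1 p) (vol n) := by
    simp only [sum_val]
    exact integrable_finsetSum _ fun α _ => integrable (hasCompactSupport_Zb (hV α) α)
  exact this.re

theorem integral_reDiv {V : Fin n → SmoothFn n} (hV : ∀ α, HasCompactSupport (V α).1) :
    ∫ p, reDiv V p ∂vol n = 0 := by
  have hi : ∀ α ∈ Finset.univ, Integrable (Zb α (V α)).1 (vol n) :=
    fun α _ => integrable (hasCompactSupport_Zb (hV α) α)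
  have h : ∫ p, (∑ α, Zb α (V α)).1 p ∂vol n = 0 := by
    simp only [sum_val]
    rw [integral_finsetSum _ hi]
    exact Finset.sum_eq_zero fun α _ => integral_Zb (hV α) α
  have h2 : Integrable (fun p => (∑ α, Zb α (V α)).1 p) (vol n) := by
    simp only [sum_val]
    exact integrable_finsetSum _ hi
  have h3 := integral_re h2
  rw [h] at h3
  exact h3

theorem integral_le_of_add_reDiv_le {V : Fin n → SmoothFn n} (hV : ∀ α, HasCompactSupport (V α).1)
    {F G : HeisenbergSpace n → ℝ} (hF : Integrable F (vol n)) (hG : Integrable G (vol n))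
    (h : ∀ p, F p + reDiv V p ≤ G p) : ∫ p, F p ∂vol n ≤ ∫ p, G p ∂vol n := by
  have := integral_mono (hF.add (integrable_reDiv hV)) hG h
  simp only [Pi.add_apply] at this
  rwa [integral_add hF (integrable_reDiv hV), integral_reDiv hV, add_zero] at this

theorem integral_le_of_le_add_reDiv {V : Fin n → SmoothFn n} (hV : ∀ α, HasCompactSupport (V α).1)
    {F G : HeisenbergSpace n → ℝ} (hF : Integrable F (vol n)) (hG : Integrable G (vol n))
    (h : ∀ p, F p ≤ G p + reDiv V p) : ∫ p, F p ∂vol n ≤ ∫ p, G p ∂vol n := by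
  have := integral_mono hF (hG.add (integrable_reDiv hV)) h
  simp only [Pi.add_apply] at this
  rwa [integral_add hG (integrable_reDiv hV), integral_reDiv hV, add_zero] at this

/-! ### Exponential weights, dilations and cutoff functions. -/

/-- A smooth real function as a smooth complex function. -/
def ofRe (φ : HeisenbergSpace n → ℝ) (hφ : ContDiff ℝ ∞ φ) : SmoothFn n :=
  ⟨fun p => (φ p : ℂ), by
    change ContDiff ℝ ∞ (fun p => (φ p : ℂ))
    exact Complex.ofRealCLM.contDiff.comp hφ⟩

@[simp] theorem ofRe_val (φ : HeisenbergSpace n → ℝ) (hφ : ContDiff ℝ ∞ φ) (p) :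
    (ofRe φ hφ).1 p = (φ p : ℂ) := rfl

@[simp] theorem cj_ofRe (φ : HeisenbergSpace n → ℝ) (hφ : ContDiff ℝ ∞ φ) :
    cj (ofRe φ hφ) = ofRe φ hφ := by ext p; simp

theorem along_ofRe_val (φ : HeisenbergSpace n → ℝ) (hφ : ContDiff ℝ ∞ φ) (v p) :
    (along v (ofRe φ hφ)).1 p = (fderiv ℝ φ p v : ℂ) := by
  have h := Complex.ofRealCLM.hasFDerivAt.comp p (hφ.differentiable (by simp) p).hasFDerivAt
  rw [along_val]
  have h2 : fderiv ℝ (ofRe φ hφ).1 p = _ := h.fderiv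
  rw [h2]
  rfl

/-- The function `e^{cφ}`. -/
def expFn (φ : HeisenbergSpace n → ℝ) (hφ : ContDiff ℝ ∞ φ) (c : ℝ) : SmoothFn n :=
  ofRe (fun p => Real.exp (c * φ p)) (Real.contDiff_exp.comp (contDiff_const.mul hφ))

section expFn

variable (φ : HeisenbergSpace n → ℝ) (hφ : ContDiff ℝ ∞ φ)

@[simp] theorem expFn_val (c : ℝ) (p) : (expFn φ hφ c).1 p = (Real.exp (c * φ p) : ℂ) := rfl

theorem along_expFn (c : ℝ) (v) :
    along v (expFn φ hφ c) = (c : ℂ) • (expFn φ hφ c * along v (ofRe φ hφ)) := by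
  ext p
  have h := (((hφ.differentiable (by simp) p).hasFDerivAt).const_mul c).exp
  rw [expFn, along_ofRe_val, smul_val, mul_val, along_ofRe_val, h.fderiv]
  simp
  ring

theorem T_expFn (c : ℝ) :
    T (expFn φ hφ c) = (c : ℂ) • (expFn φ hφ c * T (ofRe φ hφ)) := along_expFn φ hφ c _

theorem Zd_expFn (c : ℝ) (α : Fin n) :
    Zd α (expFn φ hφ c) = (c : ℂ) • (expFn φ hφ c * Zd α (ofRe φ hφ)) := by
  simp only [Zd_apply, dX, dY, T, along_expFn]
  ext p
  simp
  ring

theorem Zb_expFn (c : ℝ) (α : Fin n) :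
    Zb α (expFn φ hφ c) = (c : ℂ) • (expFn φ hφ c * cj (Zd α (ofRe φ hφ))) := by
  have : cj (expFn φ hφ c) = expFn φ hφ c := cj_ofRe _ _
  rw [← this, Zb_cj, Zd_expFn]
  ext p
  simp

end expFn

/-- The squared length of a vector of smooth functions. -/
def nsq (X : Fin n → SmoothFn n) (p : HeisenbergSpace n) : ℝ := ∑ α, Complex.normSq ((X α).1 p)

theorem nsq_nonneg (X : Fin n → SmoothFn n) (p) : 0 ≤ nsq X p :=
  Finset.sum_nonneg fun _ _ => Complex.normSq_nonneg _

@[fun_prop] theorem continuous_nsq (X : Fin n → SmoothFn n) : Continuous (nsq X) :=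
  continuous_finsetSum _ fun α _ => Complex.continuous_normSq.comp (X α).continuous

theorem pair_self_val (X : Fin n → SmoothFn n) (p) : (pair X X).1 p = (nsq X p : ℂ) := by
  simp [pair, nsq, Complex.mul_conj]

theorem along_comp_val (L : HeisenbergSpace n →L[ℝ] HeisenbergSpace n) {φ : HeisenbergSpace n → ℝ}
    (hφ : ContDiff ℝ ∞ φ) (v p) :
    (along v (ofRe (φ ∘ L) (hφ.comp L.contDiff))).1 p = (along (L v) (ofRe φ hφ)).1 (L p) := by
  rw [along_ofRe_val, along_ofRe_val]
  rw [fderiv_comp p (hφ.differentiable (by simp) _) L.differentiableAt]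
  simp

/-- The dilation `(z, t) ↦ (z / R, t / R²)`. -/
def dil (n : ℕ) (R : ℝ) : HeisenbergSpace n →L[ℝ] HeisenbergSpace n :=
  (R⁻¹ • ContinuousLinearMap.fst ℝ (EuclideanSpace ℂ (Fin n)) ℝ).prod
    ((R⁻¹ ^ 2) • ContinuousLinearMap.snd ℝ (EuclideanSpace ℂ (Fin n)) ℝ)

theorem dil_apply (R : ℝ) (p : HeisenbergSpace n) : dil n R p = (R⁻¹ • p.1, R⁻¹ ^ 2 * p.2) := rfl

/-- In the vertical term ∂/∂t gives R⁻² while z̄_α is R times the coefficient at the dilated point.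
This leaves the same factor R⁻¹ as the horizontal terms. -/
theorem Zd_dil {R : ℝ} (hR : R ≠ 0) {φ : HeisenbergSpace n → ℝ} (hφ : ContDiff ℝ ∞ φ) (α p) :
    (Zd α (ofRe (φ ∘ dil n R) (hφ.comp (dil n R).contDiff))).1 p =
      (R⁻¹ : ℂ) * (Zd α (ofRe φ hφ)).1 (dil n R p) := by
  have hs : ∀ (c : ℝ) (v w : HeisenbergSpace n), w = c • v → ∀ x,
      (along w (ofRe φ hφ)).1 x = c * (along v (ofRe φ hφ)).1 x := by
    intro c v w hw x
    rw [along_ofRe_val, along_ofRe_val, hw, map_smul]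
    simp
  have h1 : ∀ z : EuclideanSpace ℂ (Fin n),
      dil n R (z, 0) = R⁻¹ • ((z, 0) : HeisenbergSpace n) := fun z => by
    rw [dil_apply]; ext <;> simp
  have h2 : dil n R (0, 1) = (R⁻¹ ^ 2) • ((0, 1) : HeisenbergSpace n) := by
    rw [dil_apply]; ext <;> simp
  have h3 : conj ((dil n R p).1 α) = (R⁻¹ : ℂ) * conj (p.1 α) := by
    rw [dil_apply]; simp
  have hR' : (R : ℂ) ≠ 0 := by exact_mod_cast hR
  rw [Zd_apply, Zd_apply]
  simp only [dX, dY, T, add_val, smul_val, sub_val, mul_val, cj_val, zc_val]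
  rw [along_comp_val (dil n R) hφ, along_comp_val (dil n R) hφ, along_comp_val (dil n R) hφ,
    hs _ _ _ (h1 _), hs _ _ _ (h1 _), hs _ _ _ h2, h3]
  push_cast
  ring

theorem Zd_val_eq_zero {F : SmoothFn n} {p : HeisenbergSpace n} (hp : fderiv ℝ F.1 p = 0)
    (α : Fin n) : (Zd α F).1 p = 0 := by
  have h0 : ∀ v, (along v F).1 p = 0 := fun v => by rw [along_val, hp]; rfl
  rw [Zd_apply]
  simp [dX, dY, T, h0]

theorem exists_nsq_Zd_le {F : SmoothFn n} (hF : HasCompactSupport F.1) :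
    ∃ C : ℝ, ∀ p, nsq (fun α => Zd α F) p ≤ C := by
  have hs : HasCompactSupport (nsq (fun α => Zd α F)) := by
    refine HasCompactSupport.intro' hF.isCompact (isClosed_tsupport _) fun p hp => ?_
    exact Finset.sum_eq_zero fun α _ => by
      rw [Zd_val_eq_zero (fderiv_of_notMem_tsupport (𝕜 := ℝ) hp), map_zero]
  obtain ⟨C, hC⟩ := hs.exists_bound_of_continuous (continuous_nsq _)
  exact ⟨C, fun p => (le_abs_self _).trans (hC p)⟩

/-- A cutoff `η` at scale `R` together with a cutoff `ζ` supported in an annulus at scale `R` and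
equal to `1` where the gradient of `η` does not vanish. -/
structure IsCutoffPair (C R : ℝ) (η ζ : SmoothFn n) : Prop where
  real_η : cj η = η
  real_ζ : cj ζ = ζ
  η_nonneg : ∀ p, 0 ≤ (η.1 p).re
  η_le_one : ∀ p, (η.1 p).re ≤ 1
  ζ_nonneg : ∀ p, 0 ≤ (ζ.1 p).re
  ζ_le_one : ∀ p, (ζ.1 p).re ≤ 1
  supp_η : HasCompactSupport η.1
  supp_ζ : HasCompactSupport ζ.1
  ζ_eq_one : ∀ p, nsq (fun α => Zd α η) p ≠ 0 → (ζ.1 p).re = 1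
  grad_η : ∀ p, nsq (fun α => Zd α η) p ≤ C / R ^ 2
  grad_ζ : ∀ p, nsq (fun α => Zd α ζ) p ≤ C / R ^ 2
  far : ∀ p, ζ.1 p ≠ 0 → R ^ 2 ≤ C * (‖p.1‖ ^ 2 + |p.2|)
  vol_ζ : (vol n).real (tsupport ζ.1) ≤ C * R ^ (2 * n + 2)
  η_near : ∀ p, 2 * ‖p‖ ≤ R → η.1 p = 1
  ζ_near : ∀ p, 2 * ‖p‖ ≤ R → ζ.1 p = 0

/-- For R ≥ 1 the vertical factor R⁻² is at most R⁻¹. This lets the cutoffs be compared with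
ordinary norm balls, which exhaust the space. -/
theorem norm_dil_le {R : ℝ} (hR : 1 ≤ R) (p : HeisenbergSpace n) : ‖dil n R p‖ ≤ R⁻¹ * ‖p‖ := by
  have hR0 : 0 < R⁻¹ := by positivity
  have hR1 : R⁻¹ ≤ 1 := inv_le_one_of_one_le₀ hR
  rw [dil_apply, Prod.norm_def]
  refine max_le ?_ ?_
  · rw [norm_smul, Real.norm_of_nonneg hR0.le]
    exact mul_le_mul_of_nonneg_left (norm_fst_le p) hR0.le
  · rw [norm_mul, Real.norm_of_nonneg (by positivity)]
    calc R⁻¹ ^ 2 * ‖p.2‖ ≤ R⁻¹ * ‖p.2‖ := by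
          gcongr
          nlinarith
      _ ≤ R⁻¹ * ‖p‖ := mul_le_mul_of_nonneg_left (norm_snd_le p) hR0.le

theorem mem_cylinder_of_norm_dil_le {R : ℝ} (hR : 1 ≤ R) {p : HeisenbergSpace n}
    (hp : ‖dil n R p‖ ≤ 3) :
    p ∈ Metric.closedBall (0 : EuclideanSpace ℂ (Fin n)) (3 * R) ×ˢ
      Metric.closedBall (0 : ℝ) (3 * R ^ 2) := by
  have hR0 : 0 < R := by positivity
  rw [dil_apply, Prod.norm_def, max_le_iff, norm_smul, norm_mul, Real.norm_of_nonneg (by positivity),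
    Real.norm_of_nonneg (by positivity)] at hp
  refine ⟨?_, ?_⟩
  · rw [mem_closedBall_zero_iff]
    have := hp.1
    rwa [inv_mul_le_iff₀ hR0, mul_comm] at this
  · rw [mem_closedBall_zero_iff]
    have := hp.2
    rwa [inv_pow, inv_mul_le_iff₀ (by positivity), mul_comm] at this

/-- Both cutoffs are fixed bump functions pulled back by the dilation, so one constant serves every
scale. Before scaling, η is 1 on the unit ball and 0 outside radius 2, while ζ is 1 for 1 ≤ ‖x‖ ≤ 2
and vanishes for ‖x‖ ≤ 1/2 and for ‖x‖ ≥ 3. -/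
theorem exists_isCutoffPair (n : ℕ) :
    ∃ C : ℝ, 0 < C ∧ ∀ R : ℝ, 1 ≤ R → ∃ η ζ : SmoothFn n, IsCutoffPair C R η ζ := by
  let b₁ : ContDiffBump (0 : HeisenbergSpace n) := ⟨1, 2, by norm_num, by norm_num⟩
  let b₂ : ContDiffBump (0 : HeisenbergSpace n) := ⟨2, 3, by norm_num, by norm_num⟩
  let b₃ : ContDiffBump (0 : HeisenbergSpace n) := ⟨1 / 2, 1, by norm_num, by norm_num⟩
  have hη : ContDiff ℝ ∞ (b₁ : HeisenbergSpace n → ℝ) := b₁.contDiff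
  let ζ₀ : HeisenbergSpace n → ℝ := fun x => b₂ x * (1 - b₃ x)
  have hζ : ContDiff ℝ ∞ ζ₀ := b₂.contDiff.mul (contDiff_const.sub b₃.contDiff)
  have hη3 : ∀ x : HeisenbergSpace n, 3 < ‖x‖ → b₁ x = 0 := fun x hx =>
    b₁.zero_of_le_dist (by rw [dist_zero_right]; change (2 : ℝ) ≤ ‖x‖; linarith)
  have hζ3 : ∀ x : HeisenbergSpace n, 3 < ‖x‖ → ζ₀ x = 0 := fun x hx => by
    have : b₂ x = 0 :=
      b₂.zero_of_le_dist (by rw [dist_zero_right]; change (3 : ℝ) ≤ ‖x‖; linarith)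
    simp [ζ₀, this]
  have hη_near : ∀ x : HeisenbergSpace n, ‖x‖ ≤ 1 → b₁ x = 1 := fun x hx =>
    b₁.one_of_mem_closedBall (by rw [mem_closedBall_zero_iff]; exact hx)
  have hζ_near : ∀ x : HeisenbergSpace n, ‖x‖ ≤ 1 / 2 → ζ₀ x = 0 := fun x hx => by
    have : b₃ x = 1 := b₃.one_of_mem_closedBall (by rw [mem_closedBall_zero_iff]; exact hx)
    simp [ζ₀, this]
  have hζ_one : ∀ x : HeisenbergSpace n, 1 ≤ ‖x‖ → ‖x‖ ≤ 2 → ζ₀ x = 1 := fun x h1 h2 => by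
    have e1 : b₂ x = 1 := b₂.one_of_mem_closedBall (by rw [mem_closedBall_zero_iff]; exact h2)
    have e2 : b₃ x = 0 := b₃.zero_of_le_dist (by rw [dist_zero_right]; exact h1)
    simp [ζ₀, e1, e2]
  have hsη : HasCompactSupport (ofRe b₁ hη).1 :=
    HasCompactSupport.intro (isCompact_closedBall (0 : HeisenbergSpace n) 3) fun x hx => by
      rw [mem_closedBall_zero_iff, not_le] at hx
      simp [hη3 x hx]
  have hsζ : HasCompactSupport (ofRe ζ₀ hζ).1 :=
    HasCompactSupport.intro (isCompact_closedBall (0 : HeisenbergSpace n) 3) fun x hx => by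
      rw [mem_closedBall_zero_iff, not_le] at hx
      simp [hζ3 x hx]
  obtain ⟨C₁, hC₁⟩ := exists_nsq_Zd_le hsη
  obtain ⟨C₂, hC₂⟩ := exists_nsq_Zd_le hsζ
  have hgrad_zero : ∀ x : HeisenbergSpace n, ζ₀ x ≠ 1 → ∀ α, (Zd α (ofRe b₁ hη)).1 x = 0 := by
    intro x hx
    have hcases : ‖x‖ < 1 ∨ 2 < ‖x‖ := by
      by_contra hcon
      push Not at hcon
      exact hx (hζ_one x hcon.1 hcon.2)
    refine Zd_val_eq_zero ?_
    rcases hcases with h | h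
    · have : (ofRe b₁ hη).1 =ᶠ[nhds x] fun _ => (1 : ℂ) := by
        filter_upwards [(isOpen_lt continuous_norm continuous_const).mem_nhds h] with y hy
        simp [hη_near y (le_of_lt hy)]
      rw [this.fderiv_eq, fderiv_const_apply]
    · have : (ofRe b₁ hη).1 =ᶠ[nhds x] fun _ => (0 : ℂ) := by
        filter_upwards [(isOpen_lt continuous_const continuous_norm).mem_nhds h] with y hy
        have : b₁ y = 0 := b₁.zero_of_le_dist (by rw [dist_zero_right]; exact le_of_lt hy)
        simp [this]
      rw [this.fderiv_eq, fderiv_const_apply]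
  set κ : ℝ := (Measure.addHaar : Measure (EuclideanSpace ℂ (Fin n))).real
    (Metric.closedBall 0 1) with hκ
  have hκ0 : 0 ≤ κ := measureReal_nonneg
  -- The first two summands serve the gradient bounds and 4 serves `far`. The last is the volume of
  -- the cylinder of radius 3R and half-height 3R², divided by R^{2n+2}.
  refine ⟨|C₁| + |C₂| + 4 + 3 ^ (2 * n) * κ * 6, by positivity, fun R hR => ?_⟩
  set C := |C₁| + |C₂| + 4 + 3 ^ (2 * n) * κ * 6 with hC
  have hR0 : 0 < R := by positivity
  have hκ3 : 0 ≤ 3 ^ (2 * n) * κ * 6 := by positivity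
  have hgrad : ∀ (φ : HeisenbergSpace n → ℝ) (hφ : ContDiff ℝ ∞ φ) (p),
      nsq (fun α => Zd α (ofRe (φ ∘ dil n R) (hφ.comp (dil n R).contDiff))) p =
        nsq (fun α => Zd α (ofRe φ hφ)) (dil n R p) / R ^ 2 := by
    intro φ hφ p
    simp only [nsq, Zd_dil hR0.ne' hφ, Complex.normSq_mul]
    rw [← Finset.mul_sum, ← Complex.ofReal_inv, Complex.normSq_ofReal]
    field_simp
  have hcyl : ∀ p : HeisenbergSpace n,
      p ∉ Metric.closedBall (0 : EuclideanSpace ℂ (Fin n)) (3 * R) ×ˢ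
      Metric.closedBall (0 : ℝ) (3 * R ^ 2) → 3 < ‖dil n R p‖ := fun p hp => by
    by_contra hcon
    exact hp (mem_cylinder_of_norm_dil_le hR (not_lt.1 hcon))
  have hcomp : IsCompact (Metric.closedBall (0 : EuclideanSpace ℂ (Fin n)) (3 * R) ×ˢ
      Metric.closedBall (0 : ℝ) (3 * R ^ 2)) :=
    (isCompact_closedBall _ _).prod (isCompact_closedBall _ _)
  refine ⟨ofRe (b₁ ∘ dil n R) (hη.comp (dil n R).contDiff),
    ofRe (ζ₀ ∘ dil n R) (hζ.comp (dil n R).contDiff), ?_⟩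
  constructor
  · simp
  · simp
  · intro p; simpa using b₁.nonneg
  · intro p; simpa using b₁.le_one
  · intro p
    simpa [ζ₀] using mul_nonneg b₂.nonneg (sub_nonneg.2 b₃.le_one)
  · intro p
    have h1 := b₂.le_one (x := dil n R p)
    have h2 := b₂.nonneg (x := dil n R p)
    have h3 := b₃.nonneg (x := dil n R p)
    have h4 := b₃.le_one (x := dil n R p)
    have : b₂ (dil n R p) * (1 - b₃ (dil n R p)) ≤ 1 := by nlinarith
    simpa [ζ₀] using this
  · exact HasCompactSupport.intro hcomp fun p hp => by simp [hη3 _ (hcyl p hp)]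
  · exact HasCompactSupport.intro hcomp fun p hp => by simp [hζ3 _ (hcyl p hp)]
  · intro p hp
    by_contra hcon
    refine hp ?_
    rw [hgrad b₁ hη]
    have : ζ₀ (dil n R p) ≠ 1 := by simpa using hcon
    simp [nsq, hgrad_zero _ this]
  · intro p
    rw [hgrad b₁ hη]
    gcongr
    have := hC₁ (dil n R p)
    have := le_abs_self C₁
    have := abs_nonneg C₂
    linarith
  · intro p
    rw [hgrad ζ₀ hζ]
    gcongr
    have := hC₂ (dil n R p)
    have := le_abs_self C₂
    have := abs_nonneg C₁
    linarith
  · intro p hp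
    have hlt : 1 / 2 < ‖dil n R p‖ := by
      by_contra hcon
      exact hp (by simp [hζ_near _ (not_lt.1 hcon)])
    have hsum : R ^ 2 ≤ 4 * (‖p.1‖ ^ 2 + |p.2|) := by
      rw [dil_apply, Prod.norm_def, lt_max_iff, norm_smul, norm_mul,
        Real.norm_of_nonneg (by positivity), Real.norm_of_nonneg (by positivity)] at hlt
      have h0 := abs_nonneg p.2
      rcases hlt with h | h
      · rw [inv_mul_eq_div, lt_div_iff₀ hR0] at h
        nlinarith
      · rw [inv_pow, inv_mul_eq_div, lt_div_iff₀ (by positivity), Real.norm_eq_abs] at h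
        nlinarith [sq_nonneg ‖p.1‖]
    refine hsum.trans (mul_le_mul_of_nonneg_right ?_ (by positivity))
    have := abs_nonneg C₁
    have := abs_nonneg C₂
    linarith
  · have hsub : tsupport (ofRe (ζ₀ ∘ dil n R) (hζ.comp (dil n R).contDiff)).1 ⊆
        Metric.closedBall (0 : EuclideanSpace ℂ (Fin n)) (3 * R) ×ˢ
      Metric.closedBall (0 : ℝ) (3 * R ^ 2) := by
      refine closure_minimal (fun p hp => ?_) hcomp.isClosed
      by_contra hcon
      exact hp (by simp [hζ3 _ (hcyl p hcon)])
    refine (measureReal_mono hsub hcomp.measure_lt_top.ne).trans ?_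
    rw [vol_cylinder (by positivity) (by positivity), ← hκ]
    have e : (3 * R) ^ (2 * n) * κ * (2 * (3 * R ^ 2)) =
        (3 ^ (2 * n) * κ * 6) * R ^ (2 * n + 2) := by
      rw [mul_pow, pow_add]; ring
    rw [e]
    refine mul_le_mul_of_nonneg_right ?_ (by positivity)
    have := abs_nonneg C₁
    have := abs_nonneg C₂
    linarith
  · intro p hp
    have : ‖dil n R p‖ ≤ 1 := by
      refine (norm_dil_le hR p).trans ?_
      rw [inv_mul_le_iff₀ hR0]
      have := norm_nonneg p
      linarith
    simp [hη_near _ this]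
  · intro p hp
    have : ‖dil n R p‖ ≤ 1 / 2 := by
      refine (norm_dil_le hR p).trans ?_
      rw [inv_mul_le_iff₀ hR0]
      linarith
    simp [hζ_near _ this]

end SmoothFn

/-! ### Elementary inequalities. -/

theorem abs_le_of_sq_le_mul {a A B δ : ℝ} (h : a ^ 2 ≤ A * B) (hA : 0 ≤ A) (hB : 0 ≤ B)
    (hδ : 0 < δ) : |a| ≤ δ * A + B / (4 * δ) := by
  -- Weighted arithmetic–geometric mean. Each absorption below uses it with its own δ.
  have h1 : A * B ≤ (δ * A + B / (4 * δ)) ^ 2 := by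
    have : (δ * A + B / (4 * δ)) ^ 2 = (δ * A - B / (4 * δ)) ^ 2 + A * B := by
      field_simp
      ring
    rw [this]
    nlinarith [sq_nonneg (δ * A - B / (4 * δ))]
  exact abs_le_of_sq_le_sq (h.trans h1) (by positivity)

theorem normSq_sum_mul_le (X Y : Fin n → ℂ) :
    Complex.normSq (∑ α, X α * Y α) ≤
      (∑ α, Complex.normSq (X α)) * ∑ α, Complex.normSq (Y α) := by
  simp only [Complex.normSq_eq_norm_sq]
  calc ‖∑ α, X α * Y α‖ ^ 2 ≤ (∑ α, ‖X α‖ * ‖Y α‖) ^ 2 := by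
        gcongr
        exact (norm_sum_le _ _).trans (le_of_eq (by simp))
    _ ≤ _ := Finset.sum_mul_sq_le_sq_mul_sq _ _ _

theorem re_sq_le_normSq (z : ℂ) : z.re ^ 2 ≤ Complex.normSq z := by
  rw [Complex.normSq_apply]
  nlinarith [mul_self_nonneg z.im]

theorem normSq_add_le (a b : ℂ) :
    Complex.normSq (a + b) ≤ 2 * Complex.normSq a + 2 * Complex.normSq b := by
  simp only [Complex.normSq_apply, Complex.add_re, Complex.add_im]
  nlinarith [sq_nonneg (a.re - b.re), sq_nonneg (a.im - b.im)]

theorem normSq_add_add_le (a b c : ℂ) : Complex.normSq (a + b + c) ≤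
    3 * Complex.normSq a + 3 * Complex.normSq b + 3 * Complex.normSq c := by
  simp only [Complex.normSq_apply, Complex.add_re, Complex.add_im]
  nlinarith [sq_nonneg (a.re - b.re), sq_nonneg (a.im - b.im), sq_nonneg (a.re - c.re),
    sq_nonneg (a.im - c.im), sq_nonneg (b.re - c.re), sq_nonneg (b.im - c.im)]

/-! ### The Jerison–Lee density and what it controls pointwise. -/

namespace SmoothFn

theorem val_of_real {F : SmoothFn n} (hF : cj F = F) (p) : F.1 p = ((F.1 p).re : ℂ) := by
  have := congrArg (fun G : SmoothFn n => G.1 p) hF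
  simp only [cj_val] at this
  exact (Complex.conj_eq_iff_re.1 this).symm

theorem normSq_pair_le (X Y : Fin n → SmoothFn n) (p) :
    Complex.normSq ((pair X Y).1 p) ≤ nsq X p * nsq Y p := by
  have h := normSq_sum_mul_le (fun α => (X α).1 p) (fun α => conj ((Y α).1 p))
  simpa [pair, nsq] using h

theorem gradSq_val (f : SmoothFn n) (p) : (gradSq f).1 p = (nsq (fun α => Zd α f) p : ℂ) :=
  pair_self_val (fun α => Zd α f) p

/-- The nonnegative density in the Jerison–Lee identity. -/
def jlDensity (f q : SmoothFn n) (p : HeisenbergSpace n) : ℝ :=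
  (q.1 p).re * (∑ α, ∑ β, Complex.normSq ((tensorE f q α β).1 p) +
      ∑ α, ∑ β, Complex.normSq ((tensorD f α β).1 p)) +
    nsq (vecG f q) p + nsq (vecG f q + vecD f) p + nsq (vecG f q - vecE f q) p +
    ∑ α, ∑ β, ∑ γ, Complex.normSq
      ((tensorD f α β * cj (Zd γ f) + tensorE f q α γ * Zd β f).1 p)

@[fun_prop] theorem continuous_jlDensity (f q : SmoothFn n) : Continuous (jlDensity f q) := by
  have h : ∀ F : SmoothFn n, Continuous fun p => Complex.normSq (F.1 p) :=
    fun F => Complex.continuous_normSq.comp F.continuous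
  have h2 : Continuous fun p => (q.1 p).re := Complex.continuous_re.comp q.continuous
  unfold jlDensity
  refine ((((h2.mul ((continuous_finsetSum _ fun α _ => continuous_finsetSum _ fun β _ => h _).add
    (continuous_finsetSum _ fun α _ => continuous_finsetSum _ fun β _ => h _))).add
    (continuous_nsq _)).add (continuous_nsq _)).add (continuous_nsq _)).add
    (continuous_finsetSum _ fun α _ => continuous_finsetSum _ fun β _ =>
      continuous_finsetSum _ fun γ _ => h _)

section density

variable {f q : SmoothFn n} {p : HeisenbergSpace n}

theorem tensor_part_nonneg (hq : 0 ≤ (q.1 p).re) :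
    0 ≤ (q.1 p).re * (∑ α, ∑ β, Complex.normSq ((tensorE f q α β).1 p) +
      ∑ α, ∑ β, Complex.normSq ((tensorD f α β).1 p)) :=
  mul_nonneg hq (add_nonneg
    (Finset.sum_nonneg fun _ _ => Finset.sum_nonneg fun _ _ => Complex.normSq_nonneg _)
    (Finset.sum_nonneg fun _ _ => Finset.sum_nonneg fun _ _ => Complex.normSq_nonneg _))

theorem mixed_part_nonneg :
    0 ≤ ∑ α, ∑ β, ∑ γ, Complex.normSq
      ((tensorD f α β * cj (Zd γ f) + tensorE f q α γ * Zd β f).1 p) :=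
  Finset.sum_nonneg fun _ _ => Finset.sum_nonneg fun _ _ => Finset.sum_nonneg fun _ _ =>
    Complex.normSq_nonneg _

theorem vec_part_le_jlDensity (hq : 0 ≤ (q.1 p).re) :
    nsq (vecG f q) p + nsq (vecG f q + vecD f) p + nsq (vecG f q - vecE f q) p ≤
      jlDensity f q p := by
  have h1 := tensor_part_nonneg (f := f) hq
  have h2 := mixed_part_nonneg (f := f) (q := q) (p := p)
  unfold jlDensity
  linarith

theorem jlDensity_nonneg (hq : 0 ≤ (q.1 p).re) : 0 ≤ jlDensity f q p := by
  have := vec_part_le_jlDensity (f := f) hq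
  have := nsq_nonneg (vecG f q) p
  have := nsq_nonneg (vecG f q + vecD f) p
  have := nsq_nonneg (vecG f q - vecE f q) p
  linarith

/-- Strict positivity of q gives the vanishing of the full tensors D and E, not merely of their
contractions with ∂f. -/
theorem eq_zero_of_jlDensity_eq_zero (hq : 0 < (q.1 p).re) (h : jlDensity f q p = 0) :
    (∀ α β, (tensorD f α β).1 p = 0) ∧ (∀ α β, (tensorE f q α β).1 p = 0) ∧
      ∀ α, (vecG f q α).1 p = 0 := by
  have h1 := tensor_part_nonneg (f := f) hq.le
  have h2 := mixed_part_nonneg (f := f) (q := q) (p := p)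
  have h3 := nsq_nonneg (vecG f q) p
  have h4 := nsq_nonneg (vecG f q + vecD f) p
  have h5 := nsq_nonneg (vecG f q - vecE f q) p
  have hE : 0 ≤ ∑ α, ∑ β, Complex.normSq ((tensorE f q α β).1 p) :=
    Finset.sum_nonneg fun _ _ => Finset.sum_nonneg fun _ _ => Complex.normSq_nonneg _
  have hD : 0 ≤ ∑ α, ∑ β, Complex.normSq ((tensorD f α β).1 p) :=
    Finset.sum_nonneg fun _ _ => Finset.sum_nonneg fun _ _ => Complex.normSq_nonneg _
  unfold jlDensity at h
  have hz : ∑ α, ∑ β, Complex.normSq ((tensorE f q α β).1 p) +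
      ∑ α, ∑ β, Complex.normSq ((tensorD f α β).1 p) = 0 := by
    have : (q.1 p).re * (∑ α, ∑ β, Complex.normSq ((tensorE f q α β).1 p) +
      ∑ α, ∑ β, Complex.normSq ((tensorD f α β).1 p)) = 0 := by linarith
    exact (mul_eq_zero.1 this).resolve_left hq.ne'
  have hdouble : ∀ τ : Fin n → Fin n → SmoothFn n,
      ∑ α, ∑ β, Complex.normSq ((τ α β).1 p) = 0 → ∀ α β, (τ α β).1 p = 0 := by
    intro τ hτ α β
    have e1 := (Finset.sum_eq_zero_iff_of_nonneg fun α _ =>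
      Finset.sum_nonneg fun β _ => Complex.normSq_nonneg ((τ α β).1 p)).1 hτ α (Finset.mem_univ _)
    have e2 := (Finset.sum_eq_zero_iff_of_nonneg fun β _ =>
      Complex.normSq_nonneg ((τ α β).1 p)).1 e1 β (Finset.mem_univ _)
    exact Complex.normSq_eq_zero.1 e2
  refine ⟨hdouble _ (by linarith), hdouble _ (by linarith), fun α => ?_⟩
  have hG : nsq (vecG f q) p = 0 := by linarith
  exact Complex.normSq_eq_zero.1 ((Finset.sum_eq_zero_iff_of_nonneg fun α _ =>
      Complex.normSq_nonneg ((vecG f q α).1 p)).1 hG α (Finset.mem_univ _))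

theorem nsq_combination_le (hq : 0 ≤ (q.1 p).re) :
    nsq (fun α => 3 * vecD f α + 3 * vecE f q α + vecG f q α) p ≤ 27 * jlDensity f q p := by
  refine le_trans ?_ (mul_le_mul_of_nonneg_left (vec_part_le_jlDensity hq) (by norm_num))
  simp only [nsq, ← Finset.sum_add_distrib, Finset.mul_sum]
  refine Finset.sum_le_sum fun α _ => ?_
  -- 3D + 3E + G = 3(G + D) - 3(G - E) + G, so the squares in the density control it; 27 = 3 · 9.
  have e : (3 * vecD f α + 3 * vecE f q α + vecG f q α).1 p =
      3 * ((vecG f q + vecD f) α).1 p + (-3) * ((vecG f q - vecE f q) α).1 p +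
        (vecG f q α).1 p := by
    simp
    ring
  rw [e]
  refine (normSq_add_add_le _ _ _).trans ?_
  rw [Complex.normSq_mul, Complex.normSq_mul]
  have h3 : Complex.normSq 3 = 9 := by
    have := Complex.normSq_ofReal 3
    norm_num at this ⊢
  have h3' : Complex.normSq (-3) = 9 := by rw [Complex.normSq_neg, h3]
  rw [h3, h3']
  have := Complex.normSq_nonneg ((vecG f q α).1 p)
  linarith

end density

namespace IsYamabe

variable {f q : SmoothFn n} (h : IsYamabe f q)
include h

theorem jlG_val (p : HeisenbergSpace n) :
    (jlG f q).1 p = ((nsq (fun α => Zd α f) p + (q.1 p).re : ℝ) : ℂ) -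
      Complex.I * (((T f).1 p).re : ℂ) := by
  rw [jlG, sub_val, add_val, mul_val, im_val, gradSq_val, val_of_real h.real_q p,
    val_of_real (T_real h.real_f) p]
  simp

theorem jlG_re (p : HeisenbergSpace n) :
    ((jlG f q).1 p).re = nsq (fun α => Zd α f) p + (q.1 p).re := by
  rw [h.jlG_val]; simp

theorem jlG_im (p : HeisenbergSpace n) : ((jlG f q).1 p).im = -((T f).1 p).re := by
  rw [h.jlG_val]; simp

/-- Completing squares in the identity: the vector terms become |G|² + |G + D|² + |G - E|², and the
gradient part of the tensor terms becomes the mixed square of `sum_tensor_sq`. -/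
theorem reDiv_jlField {W : SmoothFn n} (hW : cj W = W)
    (hZW : ∀ α, Zb α W = 2 * (n - 1) * W * cj (Zd α f)) (p : HeisenbergSpace n) :
    reDiv (fun α => W * jlField f q α) p = (W.1 p).re * jlDensity f q p := by
  have hexp : ∀ X Y Z' W' : Fin n → SmoothFn n, pair (X + Y) (Z' + W') =
      pair X Z' + pair X W' + pair Y Z' + pair Y W' := by
    intro X Y Z' W'
    simp only [pair, Pi.add_apply, map_add, ← Finset.sum_add_distrib]
    exact Finset.sum_congr rfl fun _ _ => by ring
  have hexp' : ∀ X Y Z' W' : Fin n → SmoothFn n, pair (X - Y) (Z' - W') =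
      pair X Z' - pair X W' - pair Y Z' + pair Y W' := by
    intro X Y Z' W'
    simp only [pair, Pi.sub_apply, map_sub, ← Finset.sum_add_distrib, ← Finset.sum_sub_distrib]
    exact Finset.sum_congr rfl fun _ _ => by ring
  have key := h.jl_identity hW hZW
  have e : (gradSq f + q) * (∑ α, ∑ β, tensorE f q α β * cj (tensorE f q α β) +
          ∑ α, ∑ β, tensorD f α β * cj (tensorD f α β)) +
        3 * pair (vecG f q) (vecG f q) + pair (vecD f) (vecD f) + pair (vecE f q) (vecE f q) +
        (pair (vecG f q) (vecD f) + pair (vecD f) (vecG f q)) -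
        (pair (vecG f q) (vecE f q) + pair (vecE f q) (vecG f q)) +
        (pair (vecD f) (vecE f q) + pair (vecE f q) (vecD f)) =
      q * (∑ α, ∑ β, tensorE f q α β * cj (tensorE f q α β) +
          ∑ α, ∑ β, tensorD f α β * cj (tensorD f α β)) + pair (vecG f q) (vecG f q) +
        pair (vecG f q + vecD f) (vecG f q + vecD f) +
        pair (vecG f q - vecE f q) (vecG f q - vecE f q) +
        ∑ α, ∑ β, ∑ γ, (tensorD f α β * cj (Zd γ f) + tensorE f q α γ * Zd β f) *
        cj (tensorD f α β * cj (Zd γ f) + tensorE f q α γ * Zd β f) := by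
    rw [sum_tensor_sq, hexp, hexp']
    ring
  rw [e] at key
  have key' := congrArg (fun G : SmoothFn n => (G.1 p).re) key
  have hval : (q * (∑ α, ∑ β, tensorE f q α β * cj (tensorE f q α β) +
          ∑ α, ∑ β, tensorD f α β * cj (tensorD f α β)) + pair (vecG f q) (vecG f q) +
        pair (vecG f q + vecD f) (vecG f q + vecD f) +
        pair (vecG f q - vecE f q) (vecG f q - vecE f q) +
        ∑ α, ∑ β, ∑ γ, (tensorD f α β * cj (Zd γ f) + tensorE f q α γ * Zd β f) *
        cj (tensorD f α β * cj (Zd γ f) + tensorE f q α γ * Zd β f)).1 p =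
      ((jlDensity f q p : ℝ) : ℂ) := by
    have hs : ∀ F : SmoothFn n, (F * cj F).1 p = (Complex.normSq (F.1 p) : ℂ) := fun F => by
      rw [mul_val, cj_val, Complex.mul_conj]
    rw [jlDensity]
    simp only [add_val, sum_val, pair_self_val, hs]
    rw [mul_val, val_of_real h.real_q p]
    simp only [add_val, sum_val, hs]
    push_cast
    simp
  have hR : ∀ (X : SmoothFn n) (x : ℝ), X.1 p = x → ((2 * W * X).1 p).re = 2 * ((W.1 p).re * x) := by
    intro X x hX
    rw [mul_assoc, mul_val 2, mul_val W, hX, val_of_real hW p]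
    simp
  simp only [hR _ _ hval] at key'
  rw [add_val, cj_val, Complex.add_re, Complex.conj_re] at key'
  rw [reDiv]
  linarith

/-- The field is linear in E, D, G with coefficients a + 2ib, a - 2ib, -3ib, where g = a - ib.
Splitting E and D through G - E and G + D, the coefficient of |G|² is 3(4·2 + 4·2 + 9) = 75. -/
theorem nsq_jlField_le {p : HeisenbergSpace n} (hq : 0 ≤ (q.1 p).re) :
    nsq (jlField f q) p ≤ 75 * Complex.normSq ((jlG f q).1 p) * jlDensity f q p := by
  set a := nsq (fun α => Zd α f) p + (q.1 p).re with ha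
  set b := ((T f).1 p).re with hb
  have hT : (T f).1 p = (b : ℂ) := val_of_real (T_real h.real_f) p
  have hg : (jlG f q).1 p = (a : ℂ) - Complex.I * b := h.jlG_val p
  have hN : Complex.normSq ((jlG f q).1 p) = a ^ 2 + b ^ 2 := by
    rw [hg, Complex.normSq_apply]; simp; ring
  have h1 : Complex.normSq ((jlG f q).1 p + 3 * Complex.I * b) ≤ 4 * (a ^ 2 + b ^ 2) := by
    rw [hg, Complex.normSq_apply]; simp; nlinarith [sq_nonneg a, sq_nonneg b]
  have h2 : Complex.normSq ((jlG f q).1 p - Complex.I * b) ≤ 4 * (a ^ 2 + b ^ 2) := by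
    rw [hg, Complex.normSq_apply]; simp; nlinarith [sq_nonneg a, sq_nonneg b]
  have h3 : Complex.normSq (-(3 * Complex.I * (b : ℂ))) ≤ 9 * (a ^ 2 + b ^ 2) := by
    rw [Complex.normSq_apply]; simp; nlinarith [sq_nonneg a, sq_nonneg b]
  rw [hN, mul_assoc]
  refine le_trans ?_ (mul_le_mul_of_nonneg_left
    (mul_le_mul_of_nonneg_left (vec_part_le_jlDensity hq) (by positivity)) (by norm_num))
  simp only [nsq, ← Finset.sum_add_distrib, Finset.mul_sum]
  refine Finset.sum_le_sum fun α _ => ?_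
  have e : (jlField f q α).1 p =
      ((jlG f q).1 p + 3 * Complex.I * b) * (vecE f q α).1 p +
      ((jlG f q).1 p - Complex.I * b) * (vecD f α).1 p +
      (-(3 * Complex.I * (b : ℂ))) * (vecG f q α).1 p := by
    simp [jlField, hT]
    ring
  rw [e]
  refine (normSq_add_add_le _ _ _).trans ?_
  rw [Complex.normSq_mul, Complex.normSq_mul, Complex.normSq_mul]
  set G := (vecG f q α).1 p with hG
  have hE : Complex.normSq ((vecE f q α).1 p) ≤
      2 * Complex.normSq G + 2 * Complex.normSq (((vecG f q - vecE f q) α).1 p) := by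
    have := normSq_add_le G (-((vecG f q - vecE f q) α).1 p)
    rw [Complex.normSq_neg] at this
    convert! this using 2
    simp [hG]
  have hD : Complex.normSq ((vecD f α).1 p) ≤
      2 * Complex.normSq G + 2 * Complex.normSq (((vecG f q + vecD f) α).1 p) := by
    have := normSq_add_le (-G) (((vecG f q + vecD f) α).1 p)
    rw [Complex.normSq_neg] at this
    convert! this using 2
    simp [hG]
  have hab : 0 ≤ a ^ 2 + b ^ 2 := by positivity
  have i1 := mul_le_mul h1 hE (Complex.normSq_nonneg _) (by positivity)
  have i2 := mul_le_mul h2 hD (Complex.normSq_nonneg _) (by positivity)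
  have i3 := mul_le_mul_of_nonneg_right h3 (Complex.normSq_nonneg G)
  have j1 := mul_nonneg hab (Complex.normSq_nonneg G)
  have j2 := mul_nonneg hab (Complex.normSq_nonneg (((vecG f q - vecE f q) α).1 p))
  have j3 := mul_nonneg hab (Complex.normSq_nonneg (((vecG f q + vecD f) α).1 p))
  nlinarith

/-- The divergence of `ψ ∂f` for a product `ψ = w ρ` of a weight and a cutoff. -/
theorem reDiv_grad {w ρ : SmoothFn n} (hw : cj w = w) (hρ : cj ρ = ρ) {c : ℝ}
    (hZw : ∀ α, Zb α w = (c : ℂ) • (w * cj (Zd α f))) (p : HeisenbergSpace n) :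
    reDiv (fun α => w * ρ * Zd α f) p = (w.1 p).re * ((ρ.1 p).re *
      ((c - n) * nsq (fun α => Zd α f) p - n * (q.1 p).re) +
      ((pair (fun α => Zd α f) (fun α => Zd α ρ)).1 p).re) := by
  have hZρ : ∀ α, Zb α ρ = cj (Zd α ρ) := Zb_real hρ
  have e : ∑ α, Zb α (w * ρ * Zd α f) =
      w * (ρ * ((c : ℂ) • gradSq f - n * jlG f q) +
        pair (fun α => Zd α f) (fun α => Zd α ρ)) := by
    have h1 : ∀ α, Zb α (w * ρ * Zd α f) = w * ρ * Zb α (Zd α f) +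
        w * ρ * ((c : ℂ) • (Zd α f * cj (Zd α f))) + w * (Zd α f * cj (Zd α ρ)) := by
      intro α
      rw [Derivation.leibniz, Derivation.leibniz, hZw, hZρ]
      ext p
      simp
      ring
    rw [Finset.sum_congr rfl fun α _ => h1 α]
    simp only [Finset.sum_add_distrib, ← Finset.mul_sum, ← Finset.smul_sum, h.eqn]
    rw [gradSq, pair]
    ring
  rw [reDiv, e, mul_val, val_of_real hw p, Complex.re_ofReal_mul, add_val, mul_val,
    val_of_real hρ p, Complex.add_re, Complex.re_ofReal_mul, sub_val, smul_val, mul_val, gradSq_val,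
    natCast_val, h.jlG_val]
  have h2 : ∀ x a b : ℝ, ((c : ℂ) * (x : ℂ) - n * ((a : ℂ) - Complex.I * b)).re =
      c * x - n * a := fun x a b => by simp
  rw [h2]
  simp only [Complex.ofReal_re]
  ring

/-- The divergence of `w θ² (2g + ḡ) ∂f`. -/
theorem reDiv_jlG_grad {w θ : SmoothFn n} (hw : cj w = w) (hθ : cj θ = θ)
    (hZw : ∀ α, Zb α w = 2 * (n - 1) * w * cj (Zd α f)) (p : HeisenbergSpace n) :
    reDiv (fun α => w * θ ^ 2 * ((2 * jlG f q + cj (jlG f q)) * Zd α f)) p =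
      (w.1 p).re * ((θ.1 p).re ^ 2 *
        ((6 * n - 4) * (nsq (fun α => Zd α f) p + (q.1 p).re) * nsq (fun α => Zd α f) p -
          3 * n * (nsq (fun α => Zd α f) p + (q.1 p).re) ^ 2 + n * ((T f).1 p).re ^ 2 +
          ((pair (fun α => Zd α f)
            (fun α => 3 * vecD f α + 3 * vecE f q α + vecG f q α)).1 p).re) +
        2 * ((θ.1 p).re * ((2 * (jlG f q).1 p + conj ((jlG f q).1 p)) *
          (pair (fun α => Zd α f) (fun α => Zd α θ)).1 p).re)) := by
  have hZθ : ∀ α, Zb α θ = cj (Zd α θ) := Zb_real hθ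
  have e : ∑ α, Zb α (w * θ ^ 2 * ((2 * jlG f q + cj (jlG f q)) * Zd α f)) =
      w * (θ ^ 2 * (2 * ((n : SmoothFn n) - 1) * (2 * jlG f q + cj (jlG f q)) * gradSq f +
        2 * cj (jlG f q) * gradSq f - n * jlG f q * (2 * jlG f q + cj (jlG f q)) +
        pair (fun α => Zd α f) (fun α => 3 * vecD f α + 3 * vecE f q α + vecG f q α)) +
        2 * (θ * ((2 * jlG f q + cj (jlG f q)) *
          pair (fun α => Zd α f) (fun α => Zd α θ)))) := by
    have h1 : ∀ α, Zb α (w * θ ^ 2 * ((2 * jlG f q + cj (jlG f q)) * Zd α f)) =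
        w * θ ^ 2 * (2 * jlG f q + cj (jlG f q)) * Zb α (Zd α f) +
        w * θ ^ 2 * (2 * ((n : SmoothFn n) - 1) * (2 * jlG f q + cj (jlG f q)) + 2 * cj (jlG f q)) *
          (Zd α f * cj (Zd α f)) +
        w * θ ^ 2 * (Zd α f * cj (3 * vecD f α + 3 * vecE f q α + vecG f q α)) +
        2 * w * θ * (2 * jlG f q + cj (jlG f q)) * (Zd α f * cj (Zd α θ)) := by
      intro α
      simp only [Derivation.leibniz, Derivation.leibniz_pow, map_add, hZw, hZθ, h.Zb_jlG, Zb_cj,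
        h.Zd_jlG, smul_eq_mul, nsmul_eq_mul, deriv_ofNat, map_mul, map_sub, map_ofNat]
      push_cast
      ring
    rw [Finset.sum_congr rfl fun α _ => h1 α]
    simp only [Finset.sum_add_distrib, ← Finset.mul_sum, h.eqn]
    rw [gradSq]
    simp only [pair]
    ring
  set S := (pair (fun α => Zd α f) (fun α => 3 * vecD f α + 3 * vecE f q α + vecG f q α)).1 p
    with hS
  have hθ2 : (θ ^ 2).1 p = (((θ.1 p).re ^ 2 : ℝ) : ℂ) := by
    rw [pow_val, val_of_real hθ p]; simp
  have e2 : (2 * ((n : SmoothFn n) - 1) * (2 * jlG f q + cj (jlG f q)) * gradSq f +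
        2 * cj (jlG f q) * gradSq f - n * jlG f q * (2 * jlG f q + cj (jlG f q)) +
        pair (fun α => Zd α f) (fun α => 3 * vecD f α + 3 * vecE f q α + vecG f q α)).1 p =
      2 * ((n : ℂ) - 1) * (2 * (jlG f q).1 p + conj ((jlG f q).1 p)) *
          (nsq (fun α => Zd α f) p : ℂ) + 2 * conj ((jlG f q).1 p) * (nsq (fun α => Zd α f) p : ℂ) -
        n * (jlG f q).1 p * (2 * (jlG f q).1 p + conj ((jlG f q).1 p)) + S := by
    simp only [add_val, sub_val, mul_val, cj_val, gradSq_val, natCast_val, ofNat_val, one_val, hS]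
  have hre : (2 * ((n : ℂ) - 1) * (2 * (jlG f q).1 p + conj ((jlG f q).1 p)) *
          (nsq (fun α => Zd α f) p : ℂ) + 2 * conj ((jlG f q).1 p) * (nsq (fun α => Zd α f) p : ℂ) -
        n * (jlG f q).1 p * (2 * (jlG f q).1 p + conj ((jlG f q).1 p)) + S).re =
      (6 * n - 4) * (nsq (fun α => Zd α f) p + (q.1 p).re) * nsq (fun α => Zd α f) p -
          3 * n * (nsq (fun α => Zd α f) p + (q.1 p).re) ^ 2 + n * ((T f).1 p).re ^ 2 + S.re := by
    rw [h.jlG_val]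
    simp
    ring
  have h2 : ∀ z : ℂ, (2 * z).re = 2 * z.re := fun z => by simp
  rw [reDiv, e, mul_val, val_of_real hw p, Complex.re_ofReal_mul, add_val, Complex.add_re,
    mul_val (θ ^ 2), hθ2, Complex.re_ofReal_mul, e2, hre, mul_val 2, ofNat_val, h2, mul_val θ,
    val_of_real hθ p, Complex.re_ofReal_mul]
  simp only [mul_val, add_val, cj_val, ofNat_val, Complex.ofReal_re]

end IsYamabe

/-! ### Integral estimates valid for every positive solution. -/

theorem integrable_of_cutoff {ζ : SmoothFn n} (hζ : HasCompactSupport ζ.1)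
    {F : HeisenbergSpace n → ℝ} (hF : Continuous F) (h : ∀ p, (ζ.1 p).re = 0 → F p = 0) :
    Integrable F (vol n) := by
  refine hF.integrable_of_hasCompactSupport (hζ.mono fun p hp => ?_)
  intro h0
  exact hp (h p (by rw [h0]; rfl))

theorem exists_young (n : ℕ) (hn : 2 ≤ n) {A B : ℝ} (hA : 0 ≤ A) (hB : 0 < B) :
    ∃ K : ℝ, 0 ≤ K ∧ ∀ X : ℝ, 0 ≤ X → A * X ^ (n - 2) ≤ B * X ^ n + K := by
  refine ⟨A * (1 + A / B) ^ (n - 2), by positivity, fun X hX => ?_⟩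
  have hXn : X ^ n = X ^ (n - 2) * X ^ 2 := by rw [← pow_add]; congr 1; omega
  by_cases h : A ≤ B * X ^ 2
  · have h1 : 0 ≤ A * (1 + A / B) ^ (n - 2) := by positivity
    have h2 := mul_le_mul_of_nonneg_left h (pow_nonneg hX (n - 2))
    rw [hXn]
    nlinarith
  · push Not at h
    have h1 : X ^ 2 < A / B := by rw [lt_div_iff₀ hB]; linarith
    have h2 : X ≤ 1 + A / B := by nlinarith [sq_nonneg (X - 1)]
    have h3 : X ^ (n - 2) ≤ (1 + A / B) ^ (n - 2) := by gcongr
    have h4 : 0 ≤ B * X ^ n := by positivity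
    have := mul_le_mul_of_nonneg_left h3 hA
    linarith

theorem nsq_Zd_eq_zero {ζ : SmoothFn n} {p : HeisenbergSpace n} (hp : p ∉ tsupport ζ.1) :
    nsq (fun α => Zd α ζ) p = 0 :=
  Finset.sum_eq_zero fun α _ => by
    rw [Zd_val_eq_zero (fderiv_of_notMem_tsupport (𝕜 := ℝ) hp), map_zero]

@[fun_prop] theorem continuous_normSq_val (F : SmoothFn n) :
    Continuous fun p => Complex.normSq (F.1 p) :=
  Complex.continuous_normSq.comp F.continuous

@[fun_prop] theorem continuous_re_val (F : SmoothFn n) : Continuous fun p => (F.1 p).re :=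
  Complex.continuous_re.comp F.continuous

/-- The function `e^{2φ} / 4`. -/
def quarterExp (φ : HeisenbergSpace n → ℝ) (hφ : ContDiff ℝ ∞ φ) : SmoothFn n :=
  (1 / 4 : ℂ) • expFn φ hφ 2

theorem pair_grad_pow_re_sq_le {f ζ : SmoothFn n} (p : HeisenbergSpace n) :
    ((pair (fun α => Zd α f) (fun α => Zd α ζ)).1 p).re ^ 2 ≤
      nsq (fun α => Zd α f) p * nsq (fun α => Zd α ζ) p :=
  (re_sq_le_normSq _).trans (normSq_pair_le _ _ p)

theorem pair_grad_pow {f ζ : SmoothFn n} (hζ : cj ζ = ζ) (k : ℕ) (p : HeisenbergSpace n) :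
    ((pair (fun α => Zd α f) (fun α => Zd α (ζ ^ (k + 1)))).1 p).re = (k + 1) * (ζ.1 p).re ^ k *
      ((pair (fun α => Zd α f) (fun α => Zd α ζ)).1 p).re := by
  have e : pair (fun α => Zd α f) (fun α => Zd α (ζ ^ (k + 1))) =
      (k + 1) * ζ ^ k * pair (fun α => Zd α f) (fun α => Zd α ζ) := by
    simp only [pair, Finset.mul_sum]
    refine Finset.sum_congr rfl fun α _ => ?_
    rw [Derivation.leibniz_pow]
    simp only [add_tsub_cancel_right, smul_eq_mul, nsmul_eq_mul, map_mul, map_pow, hζ, map_natCast]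
    push_cast
    ring
  have e2 : ((k + 1) * ζ ^ k : SmoothFn n).1 p = (((k + 1) * (ζ.1 p).re ^ k : ℝ) : ℂ) := by
    rw [mul_val, pow_val, val_of_real hζ p]
    simp
  rw [e, mul_val, e2, Complex.re_ofReal_mul]

section estimates

variable {φ : HeisenbergSpace n → ℝ} {hφ : ContDiff ℝ ∞ φ}

theorem expFn_nat_re (k : ℕ) (p) : ((expFn φ hφ k).1 p).re = Real.exp (φ p) ^ k := by
  rw [expFn_val, Complex.ofReal_re, Real.exp_nat_mul]

theorem quarterExp_re (p) : ((quarterExp φ hφ).1 p).re = Real.exp (φ p) ^ 2 / 4 := by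
  have h4 : (1 / 4 : ℂ) = ((1 / 4 : ℝ) : ℂ) := by norm_num
  rw [quarterExp, smul_val, expFn_val, h4, Complex.re_ofReal_mul, Complex.ofReal_re,
    ← Real.exp_nat_mul]
  push_cast
  ring

theorem cj_expFn (c : ℝ) : cj (expFn φ hφ c) = expFn φ hφ c := cj_ofRe _ _

variable {C R : ℝ} {η ζ : SmoothFn n}

/-- With weight e^{(n-2)f} the divergence has -2|∂f|² and -(n/4)e^{2f}. Half the gradient term
absorbs the cutoff term, at the cost of e^{(n-2)f}ζ^{n-2}|∂ζ|², which the potential term absorbs by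
Young's inequality in X = R e^f ζ, up to K/Rⁿ. -/
theorem IsYamabe.gradient_integrand_le (h : IsYamabe (ofRe φ hφ) (quarterExp φ hφ)) (hn : 2 ≤ n)
    {K : ℝ} (hK : ∀ X : ℝ, 0 ≤ X → n ^ 2 / 4 * C * X ^ (n - 2) ≤ n / 4 * X ^ n + K)
    (hR : 0 < R) (hc : IsCutoffPair C R η ζ) (p : HeisenbergSpace n) :
    Real.exp (φ p) ^ (n - 2) * nsq (fun α => Zd α (ofRe φ hφ)) p * (ζ.1 p).re ^ n +
      reDiv (fun α => expFn φ hφ (n - 2 : ℕ) * ζ ^ n * Zd α (ofRe φ hφ)) p ≤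
        (tsupport ζ.1).indicator (fun _ => K / R ^ n) p := by
  have hn1 : n - 1 + 1 = n := by omega
  have hcast : ((n - 2 : ℕ) : ℝ) = n - 2 := by push_cast [hn]; ring
  have hζn : cj (ζ ^ n) = ζ ^ n := by rw [map_pow, hc.real_ζ]
  rw [h.reDiv_grad (cj_expFn _) hζn (Zb_expFn φ hφ _), expFn_nat_re, quarterExp_re, hcast,
    show ((ζ ^ n).1 p).re = (ζ.1 p).re ^ n by
      rw [pow_val, val_of_real hc.real_ζ p]; norm_cast]
  have hS := pair_grad_pow (f := ofRe φ hφ) hc.real_ζ (n - 1) p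
  rw [hn1] at hS
  rw [hS]
  have hcast1 : ((n - 1 : ℕ) : ℝ) + 1 = n := by exact_mod_cast hn1
  rw [hcast1]
  set s := ((pair (fun α => Zd α (ofRe φ hφ)) (fun α => Zd α ζ)).1 p).re with hs
  set r := (ζ.1 p).re with hr
  set t := Real.exp (φ p) with ht
  set x := nsq (fun α => Zd α (ofRe φ hφ)) p with hx
  set G := nsq (fun α => Zd α ζ) p with hG
  have ht0 : 0 < t := Real.exp_pos _
  have hr0 : 0 ≤ r := hc.ζ_nonneg p
  have hx0 : 0 ≤ x := nsq_nonneg _ _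
  have hG0 : 0 ≤ G := nsq_nonneg _ _
  have hs2 : s ^ 2 ≤ x * G := pair_grad_pow_re_sq_le p
  have hn0 : (0 : ℝ) < n := by exact_mod_cast (by omega : 0 < n)
  have hrs : |r * s| ≤ 1 / n * (r ^ 2 * x) + G / (4 * (1 / n)) := by
    refine abs_le_of_sq_le_mul ?_ (by positivity) hG0 (by positivity)
    rw [mul_pow, mul_assoc]
    exact mul_le_mul_of_nonneg_left hs2 (by positivity)
  have hrs' : n * (r * s) ≤ r ^ 2 * x + n ^ 2 / 4 * G := by
    have := mul_le_mul_of_nonneg_left ((le_abs_self _).trans hrs) hn0.le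
    refine this.trans (le_of_eq ?_)
    field_simp
  have hrn : r ^ n = r ^ (n - 2) * r ^ 2 := by rw [← pow_add]; congr 1; omega
  have hrn1 : r ^ (n - 1) = r ^ (n - 2) * r := by rw [← pow_succ]; congr 1; omega
  have htn : t ^ n = t ^ (n - 2) * t ^ 2 := by rw [← pow_add]; congr 1; omega
  have step : t ^ (n - 2) * x * r ^ n + t ^ (n - 2) * (r ^ n * ((n - 2 - n) * x -
      n * (t ^ 2 / 4)) + n * r ^ (n - 1) * s) ≤
      t ^ (n - 2) * r ^ (n - 2) * (n ^ 2 / 4 * G) - n / 4 * (t ^ n * r ^ n) := by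
    have := mul_le_mul_of_nonneg_left hrs' (by positivity : 0 ≤ t ^ (n - 2) * r ^ (n - 2))
    rw [hrn, hrn1, htn]
    nlinarith
  refine step.trans ?_
  by_cases hp : p ∈ tsupport ζ.1
  · rw [Set.indicator_of_mem hp]
    have hGC : G ≤ C / R ^ 2 := hc.grad_ζ p
    have hX := hK (R * t * r) (by positivity)
    have hRn : R ^ n = R ^ (n - 2) * R ^ 2 := by rw [← pow_add]; congr 1; omega
    rw [le_div_iff₀ (by positivity)]
    have h1 : t ^ (n - 2) * r ^ (n - 2) * (n ^ 2 / 4 * G) ≤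
        t ^ (n - 2) * r ^ (n - 2) * (n ^ 2 / 4 * (C / R ^ 2)) := by gcongr
    have h2 : (t ^ (n - 2) * r ^ (n - 2) * (n ^ 2 / 4 * (C / R ^ 2))) * R ^ n =
        n ^ 2 / 4 * C * (R * t * r) ^ (n - 2) := by
      rw [hRn, mul_pow, mul_pow]; field_simp
    have h3 : n / 4 * (t ^ n * r ^ n) * R ^ n = n / 4 * (R * t * r) ^ n := by
      rw [mul_pow, mul_pow]; ring
    have h4 := mul_le_mul_of_nonneg_right h1 (by positivity : 0 ≤ R ^ n)
    rw [sub_mul, h3]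
    linarith
  · rw [Set.indicator_of_notMem hp, hG, nsq_Zd_eq_zero hp]
    have : 0 ≤ n / 4 * (t ^ n * r ^ n) := by positivity
    linarith

theorem hasCompactSupport_cutoff_pow {F : SmoothFn n} (hζ : HasCompactSupport ζ.1) {k : ℕ}
    (hk : k ≠ 0) (G : SmoothFn n) : HasCompactSupport (G * ζ ^ k * F).1 := by
  refine hζ.mono fun p hp h0 => hp ?_
  simp [h0, hk]

/-- The pointwise remainder K/Rⁿ meets a support of volume O(R^{2n+2}). -/
theorem IsYamabe.exists_integral_gradient_le (h : IsYamabe (ofRe φ hφ) (quarterExp φ hφ))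
    (hn : 2 ≤ n) (hC : 0 < C) :
    ∃ K : ℝ, 0 < K ∧ ∀ R η ζ, 1 ≤ R → IsCutoffPair C R η ζ →
      ∫ p, Real.exp (φ p) ^ (n - 2) * nsq (fun α => Zd α (ofRe φ hφ)) p * (ζ.1 p).re ^ n ∂vol n ≤
        K * R ^ (n + 2) := by
  have hn0 : (0 : ℝ) < n := by exact_mod_cast (by omega : 0 < n)
  obtain ⟨K, hK0, hK⟩ := exists_young n hn (A := n ^ 2 / 4 * C) (B := n / 4) (by positivity)
    (by positivity)
  refine ⟨K * C + 1, by positivity, fun R η ζ hR hc => ?_⟩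
  have hR0 : 0 < R := by positivity
  have hts : MeasurableSet (tsupport ζ.1) := (isClosed_tsupport _).measurableSet
  have hfin : vol n (tsupport ζ.1) ≠ ⊤ := hc.supp_ζ.isCompact.measure_lt_top.ne
  have hφc := hφ.continuous
  have hn1 : n ≠ 0 := by omega
  have hle := integral_le_of_add_reDiv_le (V := fun α => expFn φ hφ (n - 2 : ℕ) * ζ ^ n *
      Zd α (ofRe φ hφ)) (fun α => hasCompactSupport_cutoff_pow hc.supp_ζ (by omega) _)
    (F := fun p => Real.exp (φ p) ^ (n - 2) * nsq (fun α => Zd α (ofRe φ hφ)) p * (ζ.1 p).re ^ n)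
    (integrable_of_cutoff hc.supp_ζ (by fun_prop) fun p hp => by simp [hp, hn1])
    ((integrable_indicator_iff hts).2 (integrableOn_const hfin))
    (h.gradient_integrand_le hn hK hR0 hc)
  refine hle.trans ?_
  rw [integral_indicator_const _ hts, smul_eq_mul]
  have e : R ^ (2 * n + 2) = R ^ (n + 2) * R ^ n := by rw [← pow_add]; congr 1; omega
  calc (vol n).real (tsupport ζ.1) * (K / R ^ n) ≤ C * R ^ (2 * n + 2) * (K / R ^ n) := by
        gcongr
        exact hc.vol_ζ
    _ = K * C * R ^ (n + 2) := by rw [e]; field_simp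
    _ ≤ _ := by nlinarith [pow_pos hR0 (n + 2)]

/-- With weight e^{nf} the |∂f|² term drops out of the divergence, leaving -(n/4)e^{(n+2)f} and a
cutoff term. Half the potential absorbs part of the latter; the rest is the integrand bounded just
before. -/
theorem IsYamabe.potential_integrand_le (h : IsYamabe (ofRe φ hφ) (quarterExp φ hφ)) (hn : 2 ≤ n)
    (hC : 0 < C) (hR : 0 < R) (hc : IsCutoffPair C R η ζ) (p : HeisenbergSpace n) :
    n / 8 * (Real.exp (φ p) ^ (n + 2) * (ζ.1 p).re ^ (n + 2)) +
      reDiv (fun α => expFn φ hφ n * ζ ^ (n + 2) * Zd α (ofRe φ hφ)) p ≤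
      2 * (n + 2) ^ 2 * C / n / R ^ 2 *
        (Real.exp (φ p) ^ (n - 2) * nsq (fun α => Zd α (ofRe φ hφ)) p * (ζ.1 p).re ^ n) := by
  have hζn : cj (ζ ^ (n + 2)) = ζ ^ (n + 2) := by rw [map_pow, hc.real_ζ]
  rw [h.reDiv_grad (cj_expFn _) hζn (Zb_expFn φ hφ _), expFn_nat_re, quarterExp_re,
    show ((ζ ^ (n + 2)).1 p).re = (ζ.1 p).re ^ (n + 2) by
      rw [pow_val, val_of_real hc.real_ζ p]; norm_cast,
    pair_grad_pow (f := ofRe φ hφ) hc.real_ζ (n + 1) p]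
  set s := ((pair (fun α => Zd α (ofRe φ hφ)) (fun α => Zd α ζ)).1 p).re with hs
  set r := (ζ.1 p).re with hr
  set t := Real.exp (φ p) with ht
  set x := nsq (fun α => Zd α (ofRe φ hφ)) p with hx
  set G := nsq (fun α => Zd α ζ) p with hG
  have ht0 : 0 < t := Real.exp_pos _
  have hr0 : 0 ≤ r := hc.ζ_nonneg p
  have hx0 : 0 ≤ x := nsq_nonneg _ _
  have hG0 : 0 ≤ G := nsq_nonneg _ _
  have hGC : G ≤ C / R ^ 2 := hc.grad_ζ p
  have hs2 : s ^ 2 ≤ x * G := pair_grad_pow_re_sq_le p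
  have hn0 : (0 : ℝ) < n := by exact_mod_cast (by omega : 0 < n)
  -- Chosen so that (n + 2)(C/R²)/(4δ) = n/8, half of the available n/4.
  set δ : ℝ := 2 * (n + 2) * C / n / R ^ 2 with hδ
  have hδ0 : 0 < δ := by positivity
  have hrs : |r * s| ≤ δ * (x / t ^ 2) + (t ^ 2 * r ^ 2 * G) / (4 * δ) := by
    refine abs_le_of_sq_le_mul ?_ (by positivity) (by positivity) hδ0
    have : x / t ^ 2 * (t ^ 2 * r ^ 2 * G) = r ^ 2 * (x * G) := by field_simp
    rw [this, mul_pow]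
    exact mul_le_mul_of_nonneg_left hs2 (by positivity)
  have h2 : (t ^ 2 * r ^ 2 * G) / (4 * δ) ≤ n / (8 * (n + 2)) * (t ^ 2 * r ^ 2) := by
    calc (t ^ 2 * r ^ 2 * G) / (4 * δ) ≤ (t ^ 2 * r ^ 2 * (C / R ^ 2)) / (4 * δ) := by gcongr
      _ = _ := by rw [hδ]; field_simp; ring
  have h3 : (n + 2) * (r * s) ≤ (n + 2) * δ * (x / t ^ 2) + n / 8 * (t ^ 2 * r ^ 2) := by
    have h4 := mul_le_mul_of_nonneg_left ((le_abs_self _).trans (hrs.trans (add_le_add_right h2 _)))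
      (by positivity : (0 : ℝ) ≤ n + 2)
    refine h4.trans (le_of_eq ?_)
    field_simp
  have htn : t ^ n = t ^ (n - 2) * t ^ 2 := by rw [← pow_add]; congr 1; omega
  have h5 := mul_le_mul_of_nonneg_left h3 (by positivity : 0 ≤ t ^ n * r ^ n)
  have h6 : t ^ n * r ^ n * ((n + 2) * δ * (x / t ^ 2) + n / 8 * (t ^ 2 * r ^ 2)) =
      2 * (n + 2) ^ 2 * C / n / R ^ 2 * (t ^ (n - 2) * x * r ^ n) +
        n / 8 * (t ^ (n + 2) * r ^ (n + 2)) := by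
    rw [hδ, pow_add t, pow_add r, htn]; field_simp
  rw [h6] at h5
  have e : t ^ n * (r ^ (n + 2) * ((n - n) * x - n * (t ^ 2 / 4)) +
      ((n + 1 : ℕ) + 1) * r ^ (n + 1) * s) =
      t ^ n * r ^ n * ((n + 2) * (r * s)) - n / 4 * (t ^ (n + 2) * r ^ (n + 2)) := by
    push_cast; ring
  rw [e]
  linarith

theorem IsYamabe.exists_integral_potential_le (h : IsYamabe (ofRe φ hφ) (quarterExp φ hφ))
    (hn : 2 ≤ n) (hC : 0 < C) :
    ∃ K : ℝ, 0 < K ∧ ∀ R η ζ, 1 ≤ R → IsCutoffPair C R η ζ →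
      ∫ p, Real.exp (φ p) ^ (n + 2) * (ζ.1 p).re ^ (n + 2) ∂vol n ≤ K * R ^ n := by
  have hn0 : (0 : ℝ) < n := by exact_mod_cast (by omega : 0 < n)
  obtain ⟨K, hK0, hK⟩ := h.exists_integral_gradient_le hn hC
  refine ⟨8 / n * (2 * (n + 2) ^ 2 * C / n) * K, by positivity, fun R η ζ hR hc => ?_⟩
  have hR0 : 0 < R := by positivity
  have hφc := hφ.continuous
  have hn1 : n ≠ 0 := by omega
  have hi1 : Integrable (fun p => Real.exp (φ p) ^ (n - 2) * nsq (fun α => Zd α (ofRe φ hφ)) p *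
      (ζ.1 p).re ^ n) (vol n) :=
    integrable_of_cutoff hc.supp_ζ (by fun_prop) fun p hp => by simp [hp, hn1]
  have hi2 : Integrable (fun p => Real.exp (φ p) ^ (n + 2) * (ζ.1 p).re ^ (n + 2)) (vol n) :=
    integrable_of_cutoff hc.supp_ζ (by fun_prop) fun p hp => by simp [hp]
  have hle := integral_le_of_add_reDiv_le (V := fun α => expFn φ hφ n * ζ ^ (n + 2) *
      Zd α (ofRe φ hφ)) (fun α => hasCompactSupport_cutoff_pow hc.supp_ζ (by omega) _)
    (hi2.const_mul (n / 8)) (hi1.const_mul (2 * (n + 2) ^ 2 * C / n / R ^ 2))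
    (h.potential_integrand_le hn hC hR0 hc)
  rw [integral_const_mul, integral_const_mul] at hle
  have h1 := hle.trans (mul_le_mul_of_nonneg_left (hK R η ζ hR hc) (by positivity))
  have h2 := mul_le_mul_of_nonneg_left h1 (by positivity : (0 : ℝ) ≤ 8 / n)
  refine (le_of_eq ?_).trans (h2.trans (le_of_eq ?_))
  · field_simp
  · rw [pow_add]; field_simp

end estimates

/-! ### Annular estimates for g and for the density. -/

/-- The product rule for the divergence, with a real factor. -/
theorem reDiv_mul {ψ : SmoothFn n} (hψ : cj ψ = ψ) (V : Fin n → SmoothFn n) (p) :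
    reDiv (fun α => ψ * V α) p = (ψ.1 p).re * reDiv V p +
      ((pair V (fun α => Zd α ψ)).1 p).re := by
  have e : ∑ α, Zb α (ψ * V α) = ψ * ∑ α, Zb α (V α) + pair V (fun α => Zd α ψ) := by
    simp only [pair, Finset.mul_sum, ← Finset.sum_add_distrib]
    refine Finset.sum_congr rfl fun α _ => ?_
    rw [Derivation.leibniz, Zb_real hψ]
    simp only [smul_eq_mul]
  rw [reDiv, e, add_val, Complex.add_re, mul_val, val_of_real hψ p, Complex.re_ofReal_mul, reDiv]
  simp only [Complex.ofReal_re]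

section estimates

variable {φ : HeisenbergSpace n → ℝ} {hφ : ContDiff ℝ ∞ φ}
variable {C R : ℝ} {η ζ : SmoothFn n}

theorem Zb_weight (hn : 2 ≤ n) (α : Fin n) :
    Zb α (expFn φ hφ (2 * n - 2 : ℕ)) =
      2 * (n - 1) * expFn φ hφ (2 * n - 2 : ℕ) * cj (Zd α (ofRe φ hφ)) := by
  have hcast : ((2 * n - 2 : ℕ) : ℝ) = 2 * (n - 1) := by
    rw [Nat.cast_sub (by omega)]; push_cast; ring
  rw [Zb_expFn]
  ext p
  simp only [smul_val, mul_val, sub_val, ofNat_val, natCast_val, one_val, hcast]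
  push_cast
  ring

/-- As 0 ≤ ζ ≤ 1 and 2(n - 1) ≥ n, a factor ζⁿ can be kept on the right. It matches the cutoff power
in the gradient integral. -/
theorem nsq_Zd_cutoff_le (hn : 2 ≤ n) (hc : IsCutoffPair C R η ζ)
    (p : HeisenbergSpace n) :
    nsq (fun α => Zd α (η * ζ ^ n)) p ≤ (2 + 2 * n ^ 2) * C / R ^ 2 * (ζ.1 p).re ^ n := by
  set r := (ζ.1 p).re with hr
  set e := (η.1 p).re with he
  have hr0 : 0 ≤ r := hc.ζ_nonneg p
  have hr1 : r ≤ 1 := hc.ζ_le_one p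
  have he0 : 0 ≤ e := hc.η_nonneg p
  have he1 : e ≤ 1 := hc.η_le_one p
  have hval : ∀ α, (Zd α (η * ζ ^ n)).1 p =
      ((e * (n * r ^ (n - 1)) : ℝ) : ℂ) * (Zd α ζ).1 p + ((r ^ n : ℝ) : ℂ) * (Zd α η).1 p := by
    intro α
    have hev : η.1 p = (e : ℂ) := val_of_real hc.real_η p
    have hrv : ζ.1 p = (r : ℂ) := val_of_real hc.real_ζ p
    rw [Derivation.leibniz, Derivation.leibniz_pow]
    simp only [smul_eq_mul, nsmul_eq_mul, add_val, mul_val, pow_val, natCast_val, hev, hrv]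
    push_cast
    ring
  have h1 : nsq (fun α => Zd α (η * ζ ^ n)) p ≤ 2 * (e * (n * r ^ (n - 1))) ^ 2 *
      nsq (fun α => Zd α ζ) p + 2 * (r ^ n) ^ 2 * nsq (fun α => Zd α η) p := by
    simp only [nsq, Finset.mul_sum, ← Finset.sum_add_distrib]
    refine Finset.sum_le_sum fun α _ => ?_
    rw [hval]
    refine (normSq_add_le _ _).trans (le_of_eq ?_)
    rw [Complex.normSq_mul, Complex.normSq_mul, Complex.normSq_ofReal, Complex.normSq_ofReal]
    ring
  have h2 : (e * (n * r ^ (n - 1))) ^ 2 ≤ n ^ 2 * r ^ n := by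
    have i1 : r ^ (2 * (n - 1)) ≤ r ^ n := pow_le_pow_of_le_one hr0 hr1 (by omega)
    have i2 : e ^ 2 ≤ 1 := pow_le_one₀ he0 he1
    calc (e * (n * r ^ (n - 1))) ^ 2 = e ^ 2 * (n ^ 2 * r ^ (2 * (n - 1))) := by
          rw [mul_comm 2 (n - 1), pow_mul]; ring
      _ ≤ 1 * (n ^ 2 * r ^ n) := by gcongr
      _ = _ := by ring
  have h3 : (r ^ n) ^ 2 ≤ r ^ n := by
    rw [← pow_mul]
    exact pow_le_pow_of_le_one hr0 hr1 (by omega)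
  have hGζ := hc.grad_ζ p
  have hGη := hc.grad_η p
  have hζ0 := nsq_nonneg (fun α => Zd α ζ) p
  have hη0 := nsq_nonneg (fun α => Zd α η) p
  calc nsq (fun α => Zd α (η * ζ ^ n)) p ≤ 2 * (n ^ 2 * r ^ n) * (C / R ^ 2) +
        2 * (r ^ n) * (C / R ^ 2) := by
        refine h1.trans ?_
        gcongr
    _ = _ := by ring

/-- The multiplier 2g + ḡ is chosen for signs: Re(-n g(2g + ḡ)) contains +n f₀², while
differentiating the weight and g restores a positive multiple of |∂f|⁴. The derivative of g also
brings in 3D + 3E + G, which the density controls. -/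
theorem IsYamabe.quartic_integrand_le (h : IsYamabe (ofRe φ hφ) (quarterExp φ hφ)) (hn : 2 ≤ n)
    (hC : 0 < C) (hR : 0 < R) (hc : IsCutoffPair C R η ζ) {δ : ℝ} (hδ : 0 < δ)
    (p : HeisenbergSpace n) :
    1 / 4 * (Real.exp (φ p) ^ (2 * n - 2) *
        Complex.normSq ((jlG (ofRe φ hφ) (quarterExp φ hφ)).1 p) *
        ((η.1 p).re * (ζ.1 p).re ^ n) ^ 2) ≤
      ((6 + 3 * n) / 16 * (Real.exp (φ p) ^ (2 * n + 2) * (ζ.1 p).re ^ (n + 2)) +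
      27 * δ * R ^ 2 * (Real.exp (φ p) ^ (2 * n - 2) *
        jlDensity (ofRe φ hφ) (quarterExp φ hφ) p * ((η.1 p).re ^ 4 * (ζ.1 p).re ^ 2)) +
      (1 / (4 * δ) + 36 * ((2 + 2 * n ^ 2) * C)) / R ^ 2 * (Real.exp (φ p) ^ (2 * n - 2) *
        nsq (fun α => Zd α (ofRe φ hφ)) p * (ζ.1 p).re ^ n)) +
      reDiv (fun α => expFn φ hφ (2 * n - 2 : ℕ) * (η * ζ ^ n) ^ 2 *
        ((2 * jlG (ofRe φ hφ) (quarterExp φ hφ) + cj (jlG (ofRe φ hφ) (quarterExp φ hφ))) *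
          Zd α (ofRe φ hφ))) p := by
  have hθ : cj (η * ζ ^ n) = η * ζ ^ n := by rw [map_mul, map_pow, hc.real_η, hc.real_ζ]
  have hθv : ((η * ζ ^ n).1 p).re = (η.1 p).re * (ζ.1 p).re ^ n := by
    rw [mul_val, pow_val, val_of_real hc.real_η p, val_of_real hc.real_ζ p]
    norm_cast
  have hq0 : 0 ≤ ((quarterExp φ hφ).1 p).re := by rw [quarterExp_re]; positivity
  have hN : Complex.normSq ((jlG (ofRe φ hφ) (quarterExp φ hφ)).1 p) =
      (nsq (fun α => Zd α (ofRe φ hφ)) p + ((quarterExp φ hφ).1 p).re) ^ 2 +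
        ((T (ofRe φ hφ)).1 p).re ^ 2 := by
    rw [Complex.normSq_apply, h.jlG_re, h.jlG_im]; ring
  have hP : Complex.normSq (2 * (jlG (ofRe φ hφ) (quarterExp φ hφ)).1 p +
      conj ((jlG (ofRe φ hφ) (quarterExp φ hφ)).1 p)) ≤
      9 * Complex.normSq ((jlG (ofRe φ hφ) (quarterExp φ hφ)).1 p) := by
    simp only [Complex.normSq_apply, Complex.add_re, Complex.add_im, Complex.conj_re,
      Complex.conj_im, Complex.mul_re, Complex.mul_im, Complex.re_ofNat, Complex.im_ofNat]
    nlinarith [sq_nonneg ((jlG (ofRe φ hφ) (quarterExp φ hφ)).1 p).im]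
  rw [h.reDiv_jlG_grad (cj_expFn _) hθ (Zb_weight hn) p, expFn_nat_re, hθv]
  have hY := nsq_combination_le (f := ofRe φ hφ) hq0
  have hL := (re_sq_le_normSq _).trans (normSq_pair_le (fun α => Zd α (ofRe φ hφ))
    (fun α => 3 * vecD (ofRe φ hφ) α + 3 * vecE (ofRe φ hφ) (quarterExp φ hφ) α +
      vecG (ofRe φ hφ) (quarterExp φ hφ) α) p)
  have hS := (re_sq_le_normSq ((2 * (jlG (ofRe φ hφ) (quarterExp φ hφ)).1 p +
      conj ((jlG (ofRe φ hφ) (quarterExp φ hφ)).1 p)) *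
    (pair (fun α => Zd α (ofRe φ hφ)) (fun α => Zd α (η * ζ ^ n))).1 p))
  rw [Complex.normSq_mul] at hS
  have hS2 := hS.trans (mul_le_mul hP (normSq_pair_le (fun α => Zd α (ofRe φ hφ))
    (fun α => Zd α (η * ζ ^ n)) p) (Complex.normSq_nonneg _)
      (mul_nonneg (by norm_num) (Complex.normSq_nonneg _)))
  have hGθ := nsq_Zd_cutoff_le hn hc p
  have hM0 := jlDensity_nonneg (f := ofRe φ hφ) hq0
  have hqv := quarterExp_re (φ := φ) (hφ := hφ) p
  set N := Complex.normSq ((jlG (ofRe φ hφ) (quarterExp φ hφ)).1 p) with hNdef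
  set L := ((pair (fun α => Zd α (ofRe φ hφ)) (fun α => 3 * vecD (ofRe φ hφ) α +
    3 * vecE (ofRe φ hφ) (quarterExp φ hφ) α + vecG (ofRe φ hφ) (quarterExp φ hφ) α)).1 p).re
  set Yn := nsq (fun α => 3 * vecD (ofRe φ hφ) α +
    3 * vecE (ofRe φ hφ) (quarterExp φ hφ) α + vecG (ofRe φ hφ) (quarterExp φ hφ) α) p
  set S := ((2 * (jlG (ofRe φ hφ) (quarterExp φ hφ)).1 p +
      conj ((jlG (ofRe φ hφ) (quarterExp φ hφ)).1 p)) *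
    (pair (fun α => Zd α (ofRe φ hφ)) (fun α => Zd α (η * ζ ^ n))).1 p).re
  set Gθ := nsq (fun α => Zd α (η * ζ ^ n)) p with hGdef
  set M := jlDensity (ofRe φ hφ) (quarterExp φ hφ) p
  set x := nsq (fun α => Zd α (ofRe φ hφ)) p with hxdef
  set q := ((quarterExp φ hφ).1 p).re
  set b := ((T (ofRe φ hφ)).1 p).re
  set t := Real.exp (φ p) with ht
  set r := (ζ.1 p).re with hr
  set e := (η.1 p).re with he
  have ht0 : 0 < t := Real.exp_pos _
  have hr0 : 0 ≤ r := hc.ζ_nonneg p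
  have hr1 : r ≤ 1 := hc.ζ_le_one p
  have he0 : 0 ≤ e := hc.η_nonneg p
  have he1 : e ≤ 1 := hc.η_le_one p
  have hx0 : 0 ≤ x := nsq_nonneg _ _
  have hGθ0 : 0 ≤ Gθ := nsq_nonneg _ _
  have hYn0 : 0 ≤ Yn := nsq_nonneg _ _
  have hN0 : 0 ≤ N := Complex.normSq_nonneg _
  have hn2 : (2 : ℝ) ≤ n := by exact_mod_cast hn
  -- The right side expands to (3n - 4)x² - 4xq - 3nq² + nb², coercive in x and b for n ≥ 2; the q²
  -- term is potential.
  have hA : 1 / 2 * N - (6 + 3 * n) * q ^ 2 ≤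
      (6 * n - 4) * (x + q) * x - 3 * n * (x + q) ^ 2 + n * b ^ 2 := by
    rw [hN]
    nlinarith [sq_nonneg (3 * x - 5 * q), sq_nonneg b, sq_nonneg x, sq_nonneg q,
      mul_nonneg (sub_nonneg.2 hn2) (sq_nonneg x), mul_nonneg (sub_nonneg.2 hn2) (sq_nonneg b)]
  -- The parameter δR² gives the gradient term a factor R⁻², the same scaling as the term coming
  -- from the derivative of the cutoff.
  have hLb : |(e * r ^ n) ^ 2 * L| ≤ δ * R ^ 2 * (e ^ 4 * r ^ 2 * (27 * M)) +
      (r ^ n * x) / (4 * (δ * R ^ 2)) := by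
    refine abs_le_of_sq_le_mul ?_ (by positivity) (by positivity) (by positivity)
    have i1 : r ^ (4 * n) ≤ r ^ 2 * r ^ n := by
      rw [← pow_add]; exact pow_le_pow_of_le_one hr0 hr1 (by omega)
    calc ((e * r ^ n) ^ 2 * L) ^ 2 = e ^ 4 * r ^ (4 * n) * L ^ 2 := by
          rw [mul_comm 4 n, pow_mul]; ring
      _ ≤ e ^ 4 * (r ^ 2 * r ^ n) * (x * (27 * M)) := by
          gcongr
          exact hL.trans (by gcongr)
      _ = _ := by ring
  have hSb : |(e * r ^ n) * S| ≤ 1 / 8 * ((e * r ^ n) ^ 2 * N) +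
      18 * (x * Gθ) := by
    have e1 : 18 * (x * Gθ) = (9 * (x * Gθ)) / (4 * (1 / 8)) := by ring
    rw [e1]
    refine abs_le_of_sq_le_mul ?_ (by positivity) (by positivity) (by norm_num)
    calc ((e * r ^ n) * S) ^ 2 = (e * r ^ n) ^ 2 * S ^ 2 := by ring
      _ ≤ (e * r ^ n) ^ 2 * (9 * N * (x * Gθ)) := by gcongr
      _ = _ := by ring
  have hLb' := neg_le_of_abs_le hLb
  have hSb' := neg_le_of_abs_le hSb
  have hxG : x * Gθ ≤ (2 + 2 * n ^ 2) * C / R ^ 2 * (x * r ^ n) := by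
    have := mul_le_mul_of_nonneg_left hGθ hx0
    linarith
  have hθq : (e * r ^ n) ^ 2 * q ^ 2 ≤ t ^ 4 / 16 * r ^ (n + 2) := by
    have i1 : r ^ (2 * n) ≤ r ^ (n + 2) := pow_le_pow_of_le_one hr0 hr1 (by omega)
    have i2 : e ^ 2 ≤ 1 := pow_le_one₀ he0 he1
    calc (e * r ^ n) ^ 2 * q ^ 2 = e ^ 2 * r ^ (2 * n) * (t ^ 4 / 16) := by
          rw [hqv, mul_comm 2 n, pow_mul]; ring
      _ ≤ 1 * r ^ (n + 2) * (t ^ 4 / 16) := by gcongr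
      _ = _ := by ring
  have hAθ := mul_le_mul_of_nonneg_left hA (sq_nonneg (e * r ^ n))
  have hθq' := mul_le_mul_of_nonneg_left hθq (by positivity : (0 : ℝ) ≤ 6 + 3 * n)
  have hconst : (r ^ n * x) / (4 * (δ * R ^ 2)) + 36 * ((2 + 2 * n ^ 2) * C / R ^ 2 * (x * r ^ n)) =
      (1 / (4 * δ) + 36 * ((2 + 2 * n ^ 2) * C)) / R ^ 2 * (x * r ^ n) := by
    field_simp
  have main : 1 / 4 * (N * (e * r ^ n) ^ 2) ≤
      (6 + 3 * n) / 16 * (t ^ 4 * r ^ (n + 2)) + 27 * δ * R ^ 2 * (M * (e ^ 4 * r ^ 2)) +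
      (1 / (4 * δ) + 36 * ((2 + 2 * n ^ 2) * C)) / R ^ 2 * (x * r ^ n) +
      ((e * r ^ n) ^ 2 * ((6 * n - 4) * (x + q) * x - 3 * n * (x + q) ^ 2 + n * b ^ 2 + L) +
        2 * (e * r ^ n * S)) := by
    rw [← hconst]
    linarith
  have hmul := mul_le_mul_of_nonneg_left main (pow_nonneg ht0.le (2 * n - 2))
  have ht4 : t ^ (2 * n + 2) = t ^ (2 * n - 2) * t ^ 4 := by rw [← pow_add]; congr 1; omega
  rw [ht4]
  linarith

/-- The identity is tested against η⁴, and the cutoff term is split by Young's inequality between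
the density and |g|²; the constant is 300 = 4 · 75. -/
theorem IsYamabe.density_integrand_le (h : IsYamabe (ofRe φ hφ) (quarterExp φ hφ)) (hn : 2 ≤ n)
    (hC : 0 < C) (hR : 0 < R) (hc : IsCutoffPair C R η ζ) {δ : ℝ} (hδ : 0 < δ)
    (p : HeisenbergSpace n) :
    Real.exp (φ p) ^ (2 * n - 2) * jlDensity (ofRe φ hφ) (quarterExp φ hφ) p * (η.1 p).re ^ 4 ≤
      (δ * (Real.exp (φ p) ^ (2 * n - 2) * jlDensity (ofRe φ hφ) (quarterExp φ hφ) p *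
        ((η.1 p).re ^ 4 * (ζ.1 p).re ^ 2)) +
      300 * C / (δ * R ^ 2) * (Real.exp (φ p) ^ (2 * n - 2) *
        Complex.normSq ((jlG (ofRe φ hφ) (quarterExp φ hφ)).1 p) *
        ((η.1 p).re * (ζ.1 p).re ^ n) ^ 2)) +
      reDiv (fun α => η ^ 4 * (expFn φ hφ (2 * n - 2 : ℕ) *
        jlField (ofRe φ hφ) (quarterExp φ hφ) α)) p := by
  have hη4 : cj (η ^ 4) = η ^ 4 := by rw [map_pow, hc.real_η]
  have hη4v : ((η ^ 4).1 p).re = (η.1 p).re ^ 4 := by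
    rw [pow_val, val_of_real hc.real_η p]; norm_cast
  have hq0 : 0 ≤ ((quarterExp φ hφ).1 p).re := by rw [quarterExp_re]; positivity
  have hpair : ((pair (fun α => expFn φ hφ (2 * n - 2 : ℕ) *
      jlField (ofRe φ hφ) (quarterExp φ hφ) α) (fun α => Zd α (η ^ 4))).1 p).re =
      4 * (η.1 p).re ^ 3 * (Real.exp (φ p) ^ (2 * n - 2) *
        ((pair (jlField (ofRe φ hφ) (quarterExp φ hφ)) (fun α => Zd α η)).1 p).re) := by
    have e : pair (fun α => expFn φ hφ (2 * n - 2 : ℕ) *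
      jlField (ofRe φ hφ) (quarterExp φ hφ) α) (fun α => Zd α (η ^ 4)) =
        4 * η ^ 3 * (expFn φ hφ (2 * n - 2 : ℕ) *
          pair (jlField (ofRe φ hφ) (quarterExp φ hφ)) (fun α => Zd α η)) := by
      simp only [pair, Finset.mul_sum]
      refine Finset.sum_congr rfl fun α _ => ?_
      rw [Derivation.leibniz_pow]
      simp only [smul_eq_mul, nsmul_eq_mul, map_mul, map_pow, hc.real_η, map_natCast]
      push_cast
      ring
    have e2 : (4 * η ^ 3 : SmoothFn n).1 p = ((4 * (η.1 p).re ^ 3 : ℝ) : ℂ) := by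
      rw [mul_val, pow_val, val_of_real hc.real_η p]
      simp
    rw [e, mul_val, e2, Complex.re_ofReal_mul, mul_val, val_of_real (cj_expFn _) p,
      Complex.re_ofReal_mul, expFn_nat_re]
  rw [reDiv_mul hη4, h.reDiv_jlField (cj_expFn _) (Zb_weight hn), hη4v, hpair, expFn_nat_re]
  have hM0 := jlDensity_nonneg (f := ofRe φ hφ) hq0
  have hJ := h.nsq_jlField_le hq0
  have hs := (re_sq_le_normSq _).trans (normSq_pair_le (jlField (ofRe φ hφ) (quarterExp φ hφ))
    (fun α => Zd α η) p)
  have hG := hc.grad_η p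
  have hone := hc.ζ_eq_one p
  set N := Complex.normSq ((jlG (ofRe φ hφ) (quarterExp φ hφ)).1 p) with hNdef
  set M := jlDensity (ofRe φ hφ) (quarterExp φ hφ) p
  set J := nsq (jlField (ofRe φ hφ) (quarterExp φ hφ)) p
  set s := ((pair (jlField (ofRe φ hφ) (quarterExp φ hφ)) (fun α => Zd α η)).1 p).re
  set G := nsq (fun α => Zd α η) p with hGdef
  set t := Real.exp (φ p) with ht
  set r := (ζ.1 p).re with hr
  set e := (η.1 p).re with he
  have ht0 : 0 < t := Real.exp_pos _
  have hr0 : 0 ≤ r := hc.ζ_nonneg p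
  have he0 : 0 ≤ e := hc.η_nonneg p
  have hG0 : 0 ≤ G := nsq_nonneg _ _
  have hJ0 : 0 ≤ J := nsq_nonneg _ _
  have hN0 : 0 ≤ N := Complex.normSq_nonneg _
  have hsb : |e ^ 3 * s| ≤ δ / 4 * (e ^ 4 * r ^ 2 * M) +
      (75 * (e * r ^ n) ^ 2 * N * (C / R ^ 2)) / (4 * (δ / 4)) := by
    refine abs_le_of_sq_le_mul ?_ (by positivity) (by positivity) (by positivity)
    -- Where ∂η ≠ 0 one has ζ = 1, so powers of ζ may be inserted; this localises both resulting
    -- terms to the annulus.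
    by_cases hGz : G = 0
    · have : s ^ 2 ≤ 0 := by simpa [hGz] using hs
      rw [mul_pow]
      have h0 : s ^ 2 = 0 := le_antisymm this (sq_nonneg s)
      rw [h0, mul_zero]
      positivity
    · rw [hone hGz, one_pow, one_pow]
      calc (e ^ 3 * s) ^ 2 = e ^ 6 * s ^ 2 := by ring
        _ ≤ e ^ 6 * ((75 * N * M) * (C / R ^ 2)) := by
            gcongr
            exact hs.trans (by gcongr)
        _ = _ := by ring
  have hsb' := neg_le_of_abs_le hsb
  have hmul := mul_le_mul_of_nonneg_left hsb' (pow_nonneg ht0.le (2 * n - 2))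
  have hconst : 300 * C / (δ * R ^ 2) * (t ^ (2 * n - 2) * N * (e * r ^ n) ^ 2) =
      4 * (t ^ (2 * n - 2) * ((75 * (e * r ^ n) ^ 2 * N * (C / R ^ 2)) / (4 * (δ / 4)))) := by
    field_simp
    ring
  rw [hconst]
  linarith

end estimates

/-! ### Use of the decay hypothesis, and vanishing of the density. -/

section estimates

variable {φ : HeisenbergSpace n → ℝ} {hφ : ContDiff ℝ ∞ φ}
variable {C D : ℝ}

/-- The decay of `u = e^{nφ}` at scale `R` on the support of the annular cutoff. -/
def AnnularDecay (φ : HeisenbergSpace n → ℝ) (C D : ℝ) : Prop :=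
  ∀ (R : ℝ) (η ζ : SmoothFn n), 1 ≤ R → IsCutoffPair C R η ζ →
    ∀ p, (ζ.1 p).re ≠ 0 → Real.exp (φ p) ^ n * R ^ n ≤ D * R ^ 2

theorem AnnularDecay.mul_le (hD : AnnularDecay φ C D) {R : ℝ} {η ζ : SmoothFn n} (hR : 1 ≤ R)
    (hc : IsCutoffPair C R η ζ) {k : ℕ} (hk : k ≠ 0) {y : ℝ} (hy : 0 ≤ y) (p : HeisenbergSpace n) :
    Real.exp (φ p) ^ n * (y * (ζ.1 p).re ^ k) ≤ D * R ^ 2 / R ^ n * (y * (ζ.1 p).re ^ k) := by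
  by_cases h : (ζ.1 p).re = 0
  · simp [h, hk]
  · have hR0 : 0 < R := by positivity
    refine mul_le_mul_of_nonneg_right ?_ (mul_nonneg hy (pow_nonneg (hc.ζ_nonneg p) _))
    rw [le_div_iff₀ (by positivity)]
    exact hD R η ζ hR hc p h

/-- Since 2n - 2 = n + (n - 2), one factor u = e^{nf} is split off and bounded by D R^{2-n} where ζ
≠ 0. The companion estimate for the potential uses 2n + 2 = n + (n + 2). -/
theorem IsYamabe.exists_integral_weighted_gradient_le
    (h : IsYamabe (ofRe φ hφ) (quarterExp φ hφ)) (hn : 2 ≤ n) (hC : 0 < C) (hD0 : 0 < D)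
    (hD : AnnularDecay φ C D) :
    ∃ K : ℝ, 0 < K ∧ ∀ R η ζ, 1 ≤ R → IsCutoffPair C R η ζ →
      ∫ p, Real.exp (φ p) ^ (2 * n - 2) * nsq (fun α => Zd α (ofRe φ hφ)) p *
        (ζ.1 p).re ^ n ∂vol n ≤ K * R ^ 4 := by
  obtain ⟨K, hK0, hK⟩ := h.exists_integral_gradient_le hn hC
  refine ⟨D * K, by positivity, fun R η ζ hR hc => ?_⟩
  have hR0 : 0 < R := by positivity
  have hφc := hφ.continuous
  have hn1 : n ≠ 0 := by omega
  have hi1 : Integrable (fun p => Real.exp (φ p) ^ (n - 2) * nsq (fun α => Zd α (ofRe φ hφ)) p *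
      (ζ.1 p).re ^ n) (vol n) :=
    integrable_of_cutoff hc.supp_ζ (by fun_prop) fun p hp => by simp [hp, hn1]
  have hi2 : Integrable (fun p => Real.exp (φ p) ^ (2 * n - 2) *
      nsq (fun α => Zd α (ofRe φ hφ)) p * (ζ.1 p).re ^ n) (vol n) :=
    integrable_of_cutoff hc.supp_ζ (by fun_prop) fun p hp => by simp [hp, hn1]
  have hle := integral_mono hi2 (hi1.const_mul (D * R ^ 2 / R ^ n)) fun p => by
    have e : Real.exp (φ p) ^ (2 * n - 2) = Real.exp (φ p) ^ n * Real.exp (φ p) ^ (n - 2) := by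
      rw [← pow_add]; congr 1; omega
    have := hD.mul_le hR hc hn1 (y := Real.exp (φ p) ^ (n - 2) *
      nsq (fun α => Zd α (ofRe φ hφ)) p)
      (mul_nonneg (by positivity) (nsq_nonneg _ _)) p
    simp only
    rw [e]
    refine (le_of_eq ?_).trans this
    ring
  rw [integral_const_mul] at hle
  refine hle.trans ((mul_le_mul_of_nonneg_left (hK R η ζ hR hc) (by positivity)).trans
    (le_of_eq ?_))
  rw [pow_add]
  field_simp

theorem IsYamabe.exists_integral_weighted_potential_le
    (h : IsYamabe (ofRe φ hφ) (quarterExp φ hφ)) (hn : 2 ≤ n) (hC : 0 < C) (hD0 : 0 < D)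
    (hD : AnnularDecay φ C D) :
    ∃ K : ℝ, 0 < K ∧ ∀ R η ζ, 1 ≤ R → IsCutoffPair C R η ζ →
      ∫ p, Real.exp (φ p) ^ (2 * n + 2) * (ζ.1 p).re ^ (n + 2) ∂vol n ≤ K * R ^ 2 := by
  obtain ⟨K, hK0, hK⟩ := h.exists_integral_potential_le hn hC
  refine ⟨D * K, by positivity, fun R η ζ hR hc => ?_⟩
  have hR0 : 0 < R := by positivity
  have hφc := hφ.continuous
  have hi1 : Integrable (fun p => Real.exp (φ p) ^ (n + 2) * (ζ.1 p).re ^ (n + 2)) (vol n) :=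
    integrable_of_cutoff hc.supp_ζ (by fun_prop) fun p hp => by simp [hp]
  have hi2 : Integrable (fun p => Real.exp (φ p) ^ (2 * n + 2) * (ζ.1 p).re ^ (n + 2)) (vol n) :=
    integrable_of_cutoff hc.supp_ζ (by fun_prop) fun p hp => by simp [hp]
  have hle := integral_mono hi2 (hi1.const_mul (D * R ^ 2 / R ^ n)) fun p => by
    have e : Real.exp (φ p) ^ (2 * n + 2) = Real.exp (φ p) ^ n * Real.exp (φ p) ^ (n + 2) := by
      rw [← pow_add]; congr 1; omega
    have := hD.mul_le hR hc (k := n + 2) (by omega) (y := Real.exp (φ p) ^ (n + 2))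
      (by positivity) p
    simp only
    rw [e]
    refine (le_of_eq ?_).trans this
    ring
  rw [integral_const_mul] at hle
  refine hle.trans ((mul_le_mul_of_nonneg_left (hK R η ζ hR hc) (by positivity)).trans
    (le_of_eq ?_))
  field_simp

/-- The mass of the Jerison–Lee density in a ball is controlled by its mass in an annulus. -/
theorem IsYamabe.exists_integral_density_le
    (h : IsYamabe (ofRe φ hφ) (quarterExp φ hφ)) (hn : 2 ≤ n) (hC : 0 < C) (hD0 : 0 < D)
    (hD : AnnularDecay φ C D) :
    ∃ K : ℝ, 0 < K ∧ ∀ R η ζ, 1 ≤ R → IsCutoffPair C R η ζ → ∀ δ ε : ℝ, 0 < δ → 0 < ε →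
      ∫ p, Real.exp (φ p) ^ (2 * n - 2) * jlDensity (ofRe φ hφ) (quarterExp φ hφ) p *
        (η.1 p).re ^ 4 ∂vol n ≤
      δ * (∫ p, Real.exp (φ p) ^ (2 * n - 2) * jlDensity (ofRe φ hφ) (quarterExp φ hφ) p *
        ((η.1 p).re ^ 4 * (ζ.1 p).re ^ 2) ∂vol n) +
      K / δ * (1 + 1 / ε + ε * (∫ p, Real.exp (φ p) ^ (2 * n - 2) *
        jlDensity (ofRe φ hφ) (quarterExp φ hφ) p * ((η.1 p).re ^ 4 * (ζ.1 p).re ^ 2) ∂vol n)) := by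
  obtain ⟨K₁, hK₁0, hK₁⟩ := h.exists_integral_weighted_gradient_le hn hC hD0 hD
  obtain ⟨K₂, hK₂0, hK₂⟩ := h.exists_integral_weighted_potential_le hn hC hD0 hD
  set a : ℝ := (6 + 3 * n) / 16 with ha
  set b : ℝ := 36 * ((2 + 2 * n ^ 2) * C) with hb
  have ha0 : 0 < a := by positivity
  have hb0 : 0 < b := by positivity
  refine ⟨300 * C * 4 * (a * K₂ + 27 + (1 + b) * K₁), by positivity,
    fun R η ζ hR hc δ ε hδ hε => ?_⟩
  have hR0 : 0 < R := by positivity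
  have hφc := hφ.continuous
  have hn1 : n ≠ 0 := by omega
  have i1 : Integrable (fun p => Real.exp (φ p) ^ (2 * n - 2) *
      nsq (fun α => Zd α (ofRe φ hφ)) p * (ζ.1 p).re ^ n) (vol n) :=
    integrable_of_cutoff hc.supp_ζ (by fun_prop) fun p hp => by simp [hp, hn1]
  have i2 : Integrable (fun p => Real.exp (φ p) ^ (2 * n + 2) * (ζ.1 p).re ^ (n + 2)) (vol n) :=
    integrable_of_cutoff hc.supp_ζ (by fun_prop) fun p hp => by simp [hp]
  have iA : Integrable (fun p => Real.exp (φ p) ^ (2 * n - 2) *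
      jlDensity (ofRe φ hφ) (quarterExp φ hφ) p * (η.1 p).re ^ 4) (vol n) :=
    integrable_of_cutoff hc.supp_η (by fun_prop) fun p hp => by simp [hp]
  have iB : Integrable (fun p => Real.exp (φ p) ^ (2 * n - 2) *
      jlDensity (ofRe φ hφ) (quarterExp φ hφ) p * ((η.1 p).re ^ 4 * (ζ.1 p).re ^ 2)) (vol n) :=
    integrable_of_cutoff hc.supp_η (by fun_prop) fun p hp => by simp [hp]
  have iQ : Integrable (fun p => Real.exp (φ p) ^ (2 * n - 2) *
      Complex.normSq ((jlG (ofRe φ hφ) (quarterExp φ hφ)).1 p) *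
        ((η.1 p).re * (ζ.1 p).re ^ n) ^ 2) (vol n) :=
    integrable_of_cutoff hc.supp_η (by fun_prop) fun p hp => by simp [hp]
  have hQ := integral_le_of_le_add_reDiv
    (V := fun α => expFn φ hφ (2 * n - 2 : ℕ) * (η * ζ ^ n) ^ 2 *
      ((2 * jlG (ofRe φ hφ) (quarterExp φ hφ) + cj (jlG (ofRe φ hφ) (quarterExp φ hφ))) *
        Zd α (ofRe φ hφ)))
    (fun α => hc.supp_η.mono fun p hp h0 => hp (by simp [h0]))
    (iQ.const_mul (1 / 4)) (((i2.const_mul a).add (iB.const_mul (27 * ε * R ^ 2))).add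
      (i1.const_mul ((1 / (4 * ε) + b) / R ^ 2)))
    (h.quartic_integrand_le hn hC hR0 hc hε)
  have hA := integral_le_of_le_add_reDiv
    (V := fun α => η ^ 4 * (expFn φ hφ (2 * n - 2 : ℕ) *
        jlField (ofRe φ hφ) (quarterExp φ hφ) α))
    (fun α => hc.supp_η.mono fun p hp h0 => hp (by simp [h0]))
    iA ((iB.const_mul δ).add (iQ.const_mul (300 * C / (δ * R ^ 2))))
    (h.density_integrand_le hn hC hR0 hc hδ)
  simp only [Pi.add_apply] at hQ hA
  have i3 : Integrable (fun p => a * (Real.exp (φ p) ^ (2 * n + 2) * (ζ.1 p).re ^ (n + 2)) +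
      27 * ε * R ^ 2 * (Real.exp (φ p) ^ (2 * n - 2) *
        jlDensity (ofRe φ hφ) (quarterExp φ hφ) p * ((η.1 p).re ^ 4 * (ζ.1 p).re ^ 2))) (vol n) :=
    (i2.const_mul a).add (iB.const_mul _)
  rw [integral_add i3 (i1.const_mul _),
    integral_add (i2.const_mul a) (iB.const_mul _), integral_const_mul, integral_const_mul,
    integral_const_mul, integral_const_mul] at hQ
  rw [integral_add (iB.const_mul δ) (iQ.const_mul _), integral_const_mul, integral_const_mul] at hA
  have h1 := hK₁ R η ζ hR hc
  have h2 := hK₂ R η ζ hR hc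
  have hB0 : 0 ≤ ∫ p, Real.exp (φ p) ^ (2 * n - 2) * jlDensity (ofRe φ hφ) (quarterExp φ hφ) p *
        ((η.1 p).re ^ 4 * (ζ.1 p).re ^ 2) ∂vol n := by
    refine integral_nonneg fun p => mul_nonneg (mul_nonneg (by positivity) (jlDensity_nonneg ?_))
      (mul_nonneg (pow_nonneg (hc.η_nonneg p) _) (pow_nonneg (hc.ζ_nonneg p) _))
    rw [quarterExp_re]; positivity
  set B := ∫ p, Real.exp (φ p) ^ (2 * n - 2) * jlDensity (ofRe φ hφ) (quarterExp φ hφ) p *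
        ((η.1 p).re ^ 4 * (ζ.1 p).re ^ 2) ∂vol n
  set Q := ∫ p, Real.exp (φ p) ^ (2 * n - 2) *
      Complex.normSq ((jlG (ofRe φ hφ) (quarterExp φ hφ)).1 p) *
        ((η.1 p).re * (ζ.1 p).re ^ n) ^ 2 ∂vol n
  refine hA.trans (add_le_add_right ?_ _)
  -- The weighted integrals O(R⁴) and O(R²) make Q of order R², which the factor 1/R² in front of Q
  -- cancels. The final constant is thus independent of R.
  have hQ2 : Q ≤ R ^ 2 * (4 * (a * K₂ + 27 + (1 + b) * K₁) * (1 + 1 / ε + ε * B)) := by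
    have e1 : (1 / (4 * ε) + b) / R ^ 2 * (K₁ * R ^ 4) = R ^ 2 * ((1 / (4 * ε) + b) * K₁) := by
      field_simp
    have j1 := mul_le_mul_of_nonneg_left h1
      (by positivity : 0 ≤ (1 / (4 * ε) + b) / R ^ 2)
    have j2 := mul_le_mul_of_nonneg_left h2 ha0.le
    rw [e1] at j1
    have j3 : Q ≤ R ^ 2 * (4 * (a * K₂ + 27 * ε * B + (1 / (4 * ε) + b) * K₁)) := by
      linarith
    refine j3.trans (mul_le_mul_of_nonneg_left ?_ (by positivity))
    have e2 : 1 / (4 * ε) = 1 / 4 * (1 / ε) := by field_simp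
    rw [e2]
    have p1 : 0 < 1 / ε := by positivity
    have p2 : 0 ≤ ε * B := by positivity
    have q1 : 0 ≤ a * K₂ * (1 / ε + ε * B) := by positivity
    have q2 : 0 ≤ 27 * (1 + 1 / ε) := by positivity
    have q3 : 0 ≤ K₁ * (1 + 3 / 4 * (1 / ε) + ε * B) := by positivity
    have q4 : 0 ≤ b * K₁ * (1 / ε + ε * B) := by positivity
    nlinarith
  refine (mul_le_mul_of_nonneg_left hQ2 (by positivity)).trans (le_of_eq ?_)
  field_simp

/-- The estimate is used twice: with small δ and ε it absorbs the annular mass and proves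
integrability; then, the annular mass tending to 0, it bounds the total mass by a constant over an
arbitrary δ. -/
theorem IsYamabe.jlDensity_eq_zero
    (h : IsYamabe (ofRe φ hφ) (quarterExp φ hφ)) (hn : 2 ≤ n) (hC : 0 < C) (hD0 : 0 < D)
    (hD : AnnularDecay φ C D)
    (hcut : ∀ R : ℝ, 1 ≤ R → ∃ η ζ : SmoothFn n, IsCutoffPair C R η ζ) (p : HeisenbergSpace n) :
    jlDensity (ofRe φ hφ) (quarterExp φ hφ) p = 0 := by
  obtain ⟨K, hK0, hK⟩ := h.exists_integral_density_le hn hC hD0 hD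
  have hφc := hφ.continuous
  set m : HeisenbergSpace n → ℝ := fun p => Real.exp (φ p) ^ (2 * n - 2) *
    jlDensity (ofRe φ hφ) (quarterExp φ hφ) p with hm
  have hmc : Continuous m := by fun_prop
  have hm0 : ∀ p, 0 ≤ m p := fun p => mul_nonneg (by positivity) (jlDensity_nonneg (by
    rw [quarterExp_re]; positivity))
  -- The scale 2k + 1 is at least 1 and makes η = 1 and ζ = 0 on the ball of radius k.
  choose η ζ hc using fun k : ℕ => hcut (2 * k + 1) (by
    have : (0 : ℝ) ≤ k := k.cast_nonneg
    linarith)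
  have hR : ∀ k : ℕ, (1 : ℝ) ≤ 2 * k + 1 := fun k => by
    have : (0 : ℝ) ≤ k := k.cast_nonneg
    linarith
  set A : ℕ → ℝ := fun k => ∫ p, m p * ((η k).1 p).re ^ 4 ∂vol n with hA
  set B : ℕ → ℝ := fun k => ∫ p, m p * (((η k).1 p).re ^ 4 * ((ζ k).1 p).re ^ 2) ∂vol n with hB
  have iA : ∀ k, Integrable (fun p => m p * ((η k).1 p).re ^ 4) (vol n) := fun k =>
    integrable_of_cutoff (hc k).supp_η (by fun_prop) fun p hp => by simp [hp]
  have iB : ∀ k, Integrable (fun p => m p * (((η k).1 p).re ^ 4 * ((ζ k).1 p).re ^ 2)) (vol n) :=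
    fun k => integrable_of_cutoff (hc k).supp_η (by fun_prop) fun p hp => by simp [hp]
  have hη4 : ∀ k p, 0 ≤ ((η k).1 p).re ^ 4 ∧ ((η k).1 p).re ^ 4 ≤ 1 := fun k p =>
    ⟨pow_nonneg ((hc k).η_nonneg p) _, pow_le_one₀ ((hc k).η_nonneg p) ((hc k).η_le_one p)⟩
  have hζ2 : ∀ k p, 0 ≤ ((ζ k).1 p).re ^ 2 ∧ ((ζ k).1 p).re ^ 2 ≤ 1 := fun k p =>
    ⟨pow_nonneg ((hc k).ζ_nonneg p) _, pow_le_one₀ ((hc k).ζ_nonneg p) ((hc k).ζ_le_one p)⟩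
  have hBA : ∀ k, B k ≤ A k := fun k => integral_mono (iB k) (iA k) fun p =>
    mul_le_mul_of_nonneg_left (mul_le_of_le_one_right (hη4 k p).1 (hζ2 k p).2) (hm0 p)
  have hest : ∀ k (δ ε : ℝ), 0 < δ → 0 < ε →
      A k ≤ δ * B k + K / δ * (1 + 1 / ε + ε * B k) := fun k δ ε hδ hε =>
    hK _ _ _ (hR k) (hc k) δ ε hδ hε
  obtain ⟨A', hA'0, hA'⟩ : ∃ A' : ℝ, 0 ≤ A' ∧ ∀ k, A k ≤ A' := by
    refine ⟨8 * K * (1 + 16 * K), by positivity, fun k => ?_⟩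
    -- Each of the two terms in B k then has coefficient 1/4, and B k ≤ A k lets half of A k be
    -- absorbed.
    have h1 := hest k (1 / 4) (1 / (16 * K)) (by norm_num) (by positivity)
    have e : K / (1 / 4) * (1 + 1 / (1 / (16 * K)) + 1 / (16 * K) * B k) =
        4 * K * (1 + 16 * K) + 1 / 4 * B k := by field_simp; ring
    rw [e] at h1
    linarith [hBA k]
  have hnear : ∀ p : HeisenbergSpace n, ∀ k : ℕ, ‖p‖ ≤ k →
      ((η k).1 p).re = 1 ∧ ((ζ k).1 p).re = 0 := fun p k hpk => by
    constructor
    · rw [(hc k).η_near p (by linarith)]; rfl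
    · rw [(hc k).ζ_near p (by linarith)]; rfl
  have hint : Integrable m (vol n) := by
    refine (aecover_closedBall (μ := vol n) (x := (0 : HeisenbergSpace n))
      (r := fun k : ℕ => (k : ℝ))
      tendsto_natCast_atTop_atTop).integrable_of_integral_bounded_of_nonneg_ae A'
      (fun k => (hmc.continuousOn).integrableOn_compact (isCompact_closedBall _ _))
      (Filter.Eventually.of_forall hm0) (Filter.Eventually.of_forall fun k => ?_)
    refine le_trans ?_ (hA' k)
    calc ∫ p in Metric.closedBall 0 (k : ℝ), m p ∂vol n =
        ∫ p in Metric.closedBall 0 (k : ℝ), m p * ((η k).1 p).re ^ 4 ∂vol n := by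
          refine setIntegral_congr_fun Metric.isClosed_closedBall.measurableSet fun p hp => ?_
          rw [mem_closedBall_zero_iff] at hp
          simp [(hnear p k hp).1]
      _ ≤ A k := setIntegral_le_integral (iA k)
          (Filter.Eventually.of_forall fun p => mul_nonneg (hm0 p) (hη4 k p).1)
  have hev : ∀ p : HeisenbergSpace n, ∀ᶠ k : ℕ in Filter.atTop, ‖p‖ ≤ k := fun p =>
    (tendsto_natCast_atTop_atTop (R := ℝ)).eventually_ge_atTop ‖p‖
  have hAlim : Filter.Tendsto A Filter.atTop (nhds (∫ p, m p ∂vol n)) := by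
    refine tendsto_integral_of_dominated_convergence m (fun k => (iA k).aestronglyMeasurable) hint
      (fun k => Filter.Eventually.of_forall fun p => ?_)
      (Filter.Eventually.of_forall fun p => ?_)
    · rw [Real.norm_of_nonneg (mul_nonneg (hm0 p) (hη4 k p).1)]
      exact mul_le_of_le_one_right (hm0 p) (hη4 k p).2
    · refine tendsto_const_nhds.congr' ?_
      filter_upwards [hev p] with k hk
      simp [(hnear p k hk).1]
  have hBlim : Filter.Tendsto B Filter.atTop (nhds 0) := by
    have : Filter.Tendsto B Filter.atTop (nhds (∫ _, (0 : ℝ) ∂vol n)) := by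
      refine tendsto_integral_of_dominated_convergence m (fun k => (iB k).aestronglyMeasurable) hint
        (fun k => Filter.Eventually.of_forall fun p => ?_)
        (Filter.Eventually.of_forall fun p => ?_)
      · rw [Real.norm_of_nonneg (mul_nonneg (hm0 p) (mul_nonneg (hη4 k p).1 (hζ2 k p).1))]
        exact mul_le_of_le_one_right (hm0 p) (mul_le_one₀ (hη4 k p).2 (hζ2 k p).1 (hζ2 k p).2)
      · refine tendsto_const_nhds.congr' ?_
        filter_upwards [hev p] with k hk
        simp [(hnear p k hk).2]
    simpa using this
  -- Now ε = 1 and δ is fixed as k → ∞, so δ B k disappears. Afterwards δ → ∞.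
  have hle : ∀ δ : ℝ, 0 < δ → ∫ p, m p ∂vol n ≤ K * (2 + A') / δ := by
    intro δ hδ
    have h1 : Filter.Tendsto (fun k => δ * B k + K * (2 + A') / δ) Filter.atTop
        (nhds (δ * 0 + K * (2 + A') / δ)) := (hBlim.const_mul δ).add_const _
    rw [mul_zero, zero_add] at h1
    refine le_of_tendsto_of_tendsto' hAlim h1 fun k => ?_
    refine (hest k δ 1 hδ one_pos).trans (add_le_add_right ?_ _)
    rw [div_mul_eq_mul_div]
    have hBk : 1 + 1 / 1 + 1 * B k ≤ 2 + A' := by linarith [(hBA k).trans (hA' k)]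
    gcongr
  have hzero : ∫ p, m p ∂vol n = 0 := by
    refine le_antisymm ?_ (integral_nonneg hm0)
    refine ge_of_tendsto (f := fun δ : ℝ => K * (2 + A') / δ)
      (tendsto_const_nhds.div_atTop Filter.tendsto_id) ?_
    filter_upwards [Filter.eventually_gt_atTop 0] with δ hδ using hle δ hδ
  have hae := (integral_eq_zero_iff_of_nonneg hm0 hint).1 hzero
  have hfun : m = 0 := (hmc.ae_eq_iff_eq (vol n) continuous_zero).1 hae
  have hp := congrFun hfun p
  have hexp : Real.exp (φ p) ^ (2 * n - 2) ≠ 0 := by positivity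
  exact (mul_eq_zero.1 hp).resolve_left hexp

end estimates

/-! ### From the original equation to the logarithmic one, and the conclusion. -/

theorem cj_quarterExp {φ : HeisenbergSpace n → ℝ} {hφ : ContDiff ℝ ∞ φ} :
    cj (quarterExp φ hφ) = quarterExp φ hφ := by
  rw [quarterExp, cj_smul, cj_expFn]
  congr 1
  simp [Complex.conj_ofNat]

/-- A positive solution of the equation, written as `e^{nφ}`. -/
theorem isYamabe_of_equation (hn : 0 < n) {φ : HeisenbergSpace n → ℝ} (hφ : ContDiff ℝ ∞ φ)
    (heq : ∀ p, 4 * subLaplacian (fun p => Real.exp (n * φ p)) p =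
      (n : ℝ) ^ 2 * (Real.exp (φ p) ^ n * Real.exp (φ p) ^ 2)) :
    IsYamabe (ofRe φ hφ) (quarterExp φ hφ) := by
  have hf : cj (ofRe φ hφ) = ofRe φ hφ := cj_ofRe _ _
  refine ⟨hf, ?_, fun α => ?_, ?_, ?_⟩
  · exact cj_quarterExp
  · rw [quarterExp, Derivation.map_smul, Zd_expFn]
    ext p
    simp
    ring
  · rw [quarterExp, Derivation.map_smul, T_expFn]
    ext p
    simp
    ring
  · ext p
    have hn0 : (0 : ℝ) < n := by exact_mod_cast hn
    set S : SmoothFn n := ∑ α, Zb α (Zd α (ofRe φ hφ)) with hS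
    -- The sub-Laplacian sees only the real part of ∑ f_{αᾱ}. The imaginary part n f₀ is automatic
    -- from the commutator and agrees with that of -n g.
    have hSc : cj S = S - (n : SmoothFn n) * (2 * im * T (ofRe φ hφ)) := by
      have h1 : ∀ α, cj (Zb α (Zd α (ofRe φ hφ))) =
          Zb α (Zd α (ofRe φ hφ)) - 2 * im * T (ofRe φ hφ) := by
        intro α
        have c := commutator α α (ofRe φ hφ)
        rw [if_pos rfl] at c
        rw [← Zd_cj, ← Zb_real hf, c]
        ring
      rw [hS, map_sum, Finset.sum_congr rfl fun α _ => h1 α, Finset.sum_sub_distrib]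
      simp
    have hT : (T (ofRe φ hφ)).1 p = (((T (ofRe φ hφ)).1 p).re : ℂ) := val_of_real (T_real hf) p
    set b := ((T (ofRe φ hφ)).1 p).re with hb
    have him : (S.1 p).im = n * b := by
      have h1 := congrArg (fun G : SmoothFn n => (G.1 p).im) hSc
      simp only [cj_val, sub_val, mul_val, natCast_val, ofNat_val, im_val, hT] at h1
      simp at h1
      linarith
    have hlap : subLaplacian (fun p => Real.exp (n * φ p)) p =
        -(n * Real.exp (n * φ p) * ((S.1 p).re + n * nsq (fun α => Zd α (ofRe φ hφ)) p)) := by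
      have e1 : ∑ α, Zb α (Zd α (expFn φ hφ n)) =
          (n : SmoothFn n) * (expFn φ hφ n * (S + n * gradSq (ofRe φ hφ))) := by
        have h1 : ∀ α, Zb α (Zd α (expFn φ hφ n)) = (n : SmoothFn n) * (expFn φ hφ n *
            (Zb α (Zd α (ofRe φ hφ)) + n * (Zd α (ofRe φ hφ) * cj (Zd α (ofRe φ hφ))))) := by
          intro α
          rw [Zd_expFn, Derivation.map_smul, Derivation.leibniz, Zb_expFn]
          ext p
          simp
          ring
        rw [Finset.sum_congr rfl fun α _ => h1 α]
        simp only [← Finset.mul_sum, Finset.sum_add_distrib]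
        rfl
      have e2 : ∀ α : Fin n, Zbar α (Z α (fun q => ((Real.exp (n * φ q) : ℝ) : ℂ))) p =
          (Zb α (Zd α (expFn φ hφ n))).1 p := by
        intro α
        have : (fun q => ((Real.exp (n * φ q) : ℝ) : ℂ)) = (expFn φ hφ n).1 := rfl
        rw [this, Z_coe, Zbar_coe]
      rw [subLaplacian, Finset.sum_congr rfl fun α _ => e2 α, ← sum_val, e1, mul_val, mul_val,
        natCast_val, add_val, mul_val, natCast_val, gradSq_val, expFn_val, ← Complex.ofReal_natCast,
        Complex.re_ofReal_mul, Complex.re_ofReal_mul, ← Complex.ofReal_mul, Complex.add_re,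
        Complex.ofReal_re]
      ring
    have hre : (S.1 p).re = -(n * (nsq (fun α => Zd α (ofRe φ hφ)) p +
        Real.exp (φ p) ^ 2 / 4)) := by
      have h1 := heq p
      rw [hlap, Real.exp_nat_mul] at h1
      have hpos : 0 < n * Real.exp (φ p) ^ n := by positivity
      have h2 : (n * Real.exp (φ p) ^ n) * ((S.1 p).re + (n * (nsq (fun α => Zd α (ofRe φ hφ)) p +
        Real.exp (φ p) ^ 2 / 4))) = 0 := by linarith
      have := (mul_eq_zero.1 h2).resolve_left hpos.ne'
      linarith
    have hq : (quarterExp φ hφ).1 p = ((Real.exp (φ p) ^ 2 / 4 : ℝ) : ℂ) := by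
      rw [← quarterExp_re (hφ := hφ)]
      exact val_of_real cj_quarterExp p
    rw [neg_val, mul_val, natCast_val, jlG, sub_val, add_val, mul_val, gradSq_val, hT, im_val, hq]
    generalize Real.exp (φ p) ^ 2 / 4 = e at hre hq
    apply Complex.ext
    · rw [hre]
      simp
    · rw [him]
      simp

end SmoothFn

open SmoothFn

/-- Where ζ ≠ 0 one has |z|² + |t| ≥ R²/C, so the decay reads u ≤ C₀ C^{(n-2)/2} R^{2-n}. Such
points are away from the origin because ζ vanishes near it. -/
theorem annularDecay_of_le (hn : 2 ≤ n) {u φ : HeisenbergSpace n → ℝ}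
    (hu : ∀ p, u p = Real.exp (φ p) ^ n) {C C₀ : ℝ} (hC : 0 < C) (hC₀ : 0 < C₀)
    (hdecay : ∀ (z : EuclideanSpace ℂ (Fin n)) (t : ℝ), (z, t) ≠ (0, 0) →
        u (z, t) ≤ C₀ * (‖z‖ ^ 2 + |t|) ^ (-(((n : ℝ) - 2) / 2))) :
    AnnularDecay φ C (C₀ * C ^ (((n : ℝ) - 2) / 2)) := by
  intro R η ζ hR hc p hp
  have hR0 : 0 < R := by positivity
  have hn2 : (2 : ℝ) ≤ n := by exact_mod_cast hn
  set s : ℝ := ((n : ℝ) - 2) / 2 with hs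
  have hs0 : 0 ≤ s := by rw [hs]; linarith
  have hp0 : (p.1, p.2) ≠ (0, 0) := by
    intro h0
    have : p = 0 := h0
    refine hp ?_
    rw [hc.ζ_near p (by rw [this, norm_zero, mul_zero]; exact hR0.le)]
    rfl
  have hfar := hc.far p (fun h0 => hp (by rw [h0]; rfl))
  have hρ : R ^ 2 / C ≤ ‖p.1‖ ^ 2 + |p.2| := by
    rw [div_le_iff₀ hC]; linarith
  have h1 := hdecay p.1 p.2 hp0
  have h2 : (‖p.1‖ ^ 2 + |p.2|) ^ (-s) ≤ (R ^ 2 / C) ^ (-s) :=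
    Real.rpow_le_rpow_of_nonpos (by positivity) hρ (by linarith)
  have h3 : (R ^ 2 / C) ^ (-s) * R ^ n = C ^ s * R ^ 2 := by
    rw [Real.div_rpow (by positivity) hC.le, Real.rpow_neg hC.le, ← Real.rpow_natCast R 2,
      ← Real.rpow_mul hR0.le, div_inv_eq_mul, mul_comm _ (C ^ s), mul_assoc,
      ← Real.rpow_natCast R n, ← Real.rpow_add hR0]
    congr 2
    rw [hs]
    push_cast
    ring
  rw [← hu]
  calc u p * R ^ n ≤ (C₀ * (R ^ 2 / C) ^ (-s)) * R ^ n := by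
        gcongr
        exact h1.trans (by gcongr)
    _ = C₀ * C ^ s * R ^ 2 := by rw [mul_assoc, h3]; ring

theorem isJerisonLee_of_decay (hn : 2 ≤ n) {u : HeisenbergSpace n → ℝ} (hu : IsPositiveSolution u)
    {C₀ : ℝ} (hC₀ : 0 < C₀)
    (hdecay : ∀ (z : EuclideanSpace ℂ (Fin n)) (t : ℝ), (z, t) ≠ (0, 0) →
        u (z, t) ≤ C₀ * (‖z‖ ^ 2 + |t|) ^ (-(((n : ℝ) - 2) / 2))) :
    IsJerisonLee u := by
  have hn0 : (0 : ℝ) < n := by exact_mod_cast (by omega : 0 < n)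
  -- Dividing the logarithm by n turns u^{(n+2)/n} into e^{(n+2)φ}, leaving only e^{2φ} after the
  -- factor u is removed.
  set φ : HeisenbergSpace n → ℝ := fun p => Real.log (u p) / n with hφdef
  have hφ : ContDiff ℝ ∞ φ := (hu.smooth.log fun p => (hu.pos p).ne').div_const _
  have huφ' : ∀ p, u p = Real.exp (n * φ p) := fun p => by
    rw [hφdef]
    simp only
    rw [mul_div_cancel₀ _ hn0.ne', Real.exp_log (hu.pos p)]
  have huφ : ∀ p, u p = Real.exp (φ p) ^ n := fun p => by rw [huφ', Real.exp_nat_mul]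
  have hY : IsYamabe (ofRe φ hφ) (quarterExp φ hφ) := by
    refine isYamabe_of_equation (by omega) hφ fun p => ?_
    have h1 := hu.eqn p
    have h2 : (fun p => Real.exp (n * φ p)) = u := funext fun p => (huφ' p).symm
    have h3 : u p ^ (((n : ℝ) + 2) / n) = Real.exp (φ p) ^ n * Real.exp (φ p) ^ 2 := by
      rw [huφ', ← Real.exp_mul, ← pow_add, ← Real.exp_nat_mul]
      congr 1
      push_cast
      field_simp
    rw [h2, h1, h3]
  obtain ⟨C, hC, hcut⟩ := exists_isCutoffPair n
  have hM := hY.jlDensity_eq_zero hn hC (by positivity)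
    (annularDecay_of_le hn huφ hC hC₀ hdecay) hcut
  have hqpos : ∀ p, 0 < ((quarterExp φ hφ).1 p).re := fun p => by
    rw [quarterExp_re]; positivity
  have hz := fun p => eq_zero_of_jlDensity_eq_zero (hqpos p) (hM p)
  obtain ⟨μ, lam, hpos, hw⟩ := hY.exists_defining_function (by omega)
    (e := expFn φ hφ (-2)) (cj_expFn _)
    (fun α => by rw [Zd_expFn]; ext p; simp; ring)
    (by
      ext p
      simp only [quarterExp, mul_val, smul_val, ofNat_val, expFn_val, one_val]
      have : Real.exp (2 * φ p) * Real.exp (-2 * φ p) = 1 := by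
        rw [← Real.exp_add]; simp
      have h2 : (Real.exp (2 * φ p) : ℂ) * (Real.exp (-2 * φ p) : ℂ) = 1 := by exact_mod_cast this
      linear_combination h2)
    hqpos (fun α β => SmoothFn.ext fun p => (hz p).1 α β)
    (fun α β => SmoothFn.ext fun p => (hz p).2.1 α β) (fun α => SmoothFn.ext fun p => (hz p).2.2 α)
  refine ⟨μ, lam, hpos, fun z t => ?_⟩
  have h1 := hw (z, t)
  rw [quarterExp_re] at h1
  set N := ‖((z, t) : HeisenbergSpace n).2 + Complex.I *
    ((‖((z, t) : HeisenbergSpace n).1‖ ^ 2 : ℝ) : ℂ) +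
      inner ℂ μ ((z, t) : HeisenbergSpace n).1 + lam‖ with hN
  have hN0 : 0 < N := by
    refine lt_of_le_of_ne (norm_nonneg _) fun h0 => ?_
    rw [← h0] at h1
    simp at h1
    linarith
  -- From 4q = e^{2φ}; raising this square to the power n/2 gives u Nⁿ.
  have h2 : 4 * lam.im - ‖μ‖ ^ 2 = (Real.exp (φ (z, t)) * N) ^ 2 := by
    rw [← h1]; ring
  rw [h2, ← Real.rpow_natCast _ 2, ← Real.rpow_mul (by positivity)]
  have h3 : ((2 : ℕ) : ℝ) * ((n : ℝ) / 2) = n := by push_cast; ring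
  rw [h3, Real.rpow_natCast, mul_pow, huφ]
  rw [eq_div_iff (by positivity)]

end HeisenbergSpace

end

theorem theorem1p1 :
    (∀ (n : ℕ) (_ : 2 ≤ n) (u : HeisenbergSpace n → ℝ),
      HeisenbergSpace.IsPositiveSolution u →
      (∃ C : ℝ, 0 < C ∧ ∀ (z : EuclideanSpace ℂ (Fin n)) (t : ℝ), (z, t) ≠ (0, 0) →
        u (z, t) ≤ C * (‖z‖ ^ 2 + |t|) ^ (-(((n : ℝ) - 2) / 2))) →
      HeisenbergSpace.IsJerisonLee u) ∧
    (∀ u : HeisenbergSpace 2 → ℝ,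
      HeisenbergSpace.IsPositiveSolution u →
      (∃ C : ℝ, ∀ p : HeisenbergSpace 2, u p ≤ C) →
      HeisenbergSpace.IsJerisonLee u) := by
  refine ⟨fun n hn u hu ⟨C, hC, hdecay⟩ =>
    HeisenbergSpace.isJerisonLee_of_decay hn hu hC hdecay, fun u hu ⟨C, hC⟩ => ?_⟩
  -- For n = 2 the decay factor is a zeroth power, so a bound suffices; the maximum with 1 makes the
  -- constant positive.
  refine HeisenbergSpace.isJerisonLee_of_decay le_rfl hu (C₀ := max C 1) (by positivity)
    fun z t _ => ?_
  have h : -((((2 : ℕ) : ℝ) - 2) / 2) = 0 := by norm_num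
  rw [h, Real.rpow_zero, mul_one]
  exact (hC _).trans (le_max_left _ _)
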